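/- **Lemma (Equilibria Through Shooting).** Let $a,f\in C^2([0,\pi]\times\mathbb R^2)$ be real functions of $(\theta,u,p)$ with $a\ge\epsilon>0$ and $|f(\theta,u,p)|<f_1(u)+f_2(u)|p|^{\kappa}$ for some continuous $f_1,f_2$ and some $\kappa<2$. Consider $$u_t=a(\theta,u,u_\theta)\Big[u_{\theta\theta}+\frac{u_\theta}{\tan\theta}\Big]+f(\theta,u,u_\theta),\qquad \theta\in(0,\pi),\qquad u_\theta=0\ \text{ at }\theta=0,\pi .$$ Let $\mathcal E$ be the set of its equilibria, i.e. of the time-independent solutions $u\in C^2([0,\pi])$. With $\tau=\ln\tan(\theta/2)$ and $p=u_\tau=u_\theta\sin\theta$, the equilibrium equation becomes the shooting system $$\theta_\tau=\sin\theta,\qquad u_\tau=p,\qquad p_\tau=-\frac{f(\theta,u,p/\sin\theta)}{a(\theta,u,p/\sin\theta)}\sin^2\theta ,$$ extended to $\theta\in\{0,\pi\}$ by $(\theta,u,p)_\tau=(0,p,0)$. Assume that every initial point with $\theta\in(0,\pi)$ has a solution defined for all $\tau\in\mathbb R$. For $d\in\mathbb R$ let $W^u(0,d,0)$ be the strong unstable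 manifold of the rest point $(\theta,u,p)=(0,d,0)$, i.e. the union of the orbits that converge to it exponentially as $\tau\to-\infty$. For $e\in\mathbb R$ let $W^s(\pi,e,0)$ be the strong stable manifold of $(\pi,e,0)$, i.e. the union of the orbits that converge to it exponentially as $\tau\to+\infty$. Each of these orbits is taken together with its limit at the other end, $\tau\to+\infty$ or $\tau\to-\infty$ respectively, if that limit exists. Put $M^u=\bigcup_dW^u(0,d,0)$ and $M^s=\bigcup_eW^s(\pi,e,0)$, and let $M^u_\theta,M^s_\theta\subset\mathbb R^2$ be their cross-sections at $\theta$. For each $\theta\in(0,\pi)$, $W^u(0,d,0)$ and $W^s(\pi,e,0)$ each contain exactly one point of height $\theta$, so that $M^u_\theta$ and $M^s_\theta$ are curves parametrized by $d\in\mathbb R$ and $e\in\mathbb R$. These parametrizations are differentiable with nowhere vanishing derivative. Moreover: 1. For every $\theta\in[0,\pi]$, the map $u\mapsto(u(\theta),u_\theta(\theta)\sin\theta)$ is a bijection from $\mathcal E$ onto $M^u_\theta\cap M^s_\theta$. 2. Let $u_*\in\mathcal E$, $\theta_0\in(0,\pi)$ and $d,e\in\mathbb R$ be such that $(\theta_0,u_*(\theta_0),\partial_\theta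 u_*(\theta_0)\sin\theta_0)\in W^u(0,d,0)\cap W^s(\pi,e,0)$. Then $u_*$ is hyperbolic (the linearization at $u_*$ of the right-hand side of the equation, with Neumann boundary conditions, has no eigenvalue on the imaginary axis) if and only if the surfaces $M^u$ and $M^s$ intersect transversely at this point, i.e. their tangent planes there together span $\mathbb R^3$. Here the tangent planes are spanned by the direction of the flow and by the tangent vector of $M^u_{\theta_0}$ at $d$, respectively of $M^s_{\theta_0}$ at $e$. 3. If, in the situation of 2, $u_*$ is hyperbolic, then its Morse index $i(u_*)$ (the number of positive eigenvalues of that linearization) is finite and $$i(u_*)=1+\Big\lfloor\frac{\zeta(\theta_0)}{\pi}\Big\rfloor ,\qquad \zeta=\nu-\tilde\nu .$$ Here $\nu(\theta)$ is the clockwise angle in the $(u,p)$-plane from the $u$-axis to the tangent vector of $M^u_\theta$ at the parameter $d$, and $\tilde\nu(\theta)$ is the clockwise angle to the tangent vector of $M^s_\theta$ at the parameter $e$. Both are continuous in $\theta\in(0,\pi)$ and normalized by $\nu(\theta)\to0$ as $\theta\to0$ and $\tilde\nu(\theta)\to0$ as $\theta\to\pi$; such $\nu$ and $\tilde\nu$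 exist. -/

import Mathlib

open Set Filter Topology

noncomputable section

namespace AxisymShooting

/-! ### The axisymmetric equation, its equilibria and their linearization -/

/-- The axisymmetric Laplacian `v_θθ + v_θ / tan θ` on the sphere, for `θ ∈ (0, π)`. -/
def sphLap {E : Type*} [NormedAddCommGroup E] [NormedSpace ℝ E] (v : ℝ → E) (θ : ℝ) : E :=
  deriv (deriv v) θ + (Real.cos θ / Real.sin θ) • deriv v θ

/-- A classical equilibrium of `u_t = a(θ,u,u_θ) [u_θθ + u_θ / tan θ] + f(θ,u,u_θ)` on `[0, π]`
with Neumann boundary conditions. Only the values of `u` on `[0, π]` matter. -/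
structure IsEquilibrium (a f : ℝ → ℝ → ℝ → ℝ) (u : ℝ → ℝ) : Prop where
  contDiffOn : ContDiffOn ℝ 2 u (Icc 0 Real.pi)
  neumann_zero : derivWithin u (Icc 0 Real.pi) 0 = 0
  neumann_pi : derivWithin u (Icc 0 Real.pi) Real.pi = 0
  equation : ∀ θ ∈ Ioo 0 Real.pi,
    a θ (u θ) (deriv u θ) * sphLap u θ + f θ (u θ) (deriv u θ) = 0

/-- The set of equilibria, as functions on `[0, π]`. -/
def equilibria (a f : ℝ → ℝ → ℝ → ℝ) : Set (Icc (0 : ℝ) Real.pi → ℝ) :=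
  {u | IsEquilibrium a f (IccExtend Real.pi_pos.le u)}

/-- The linearization of `u ↦ a(θ,u,u_θ) [u_θθ + u_θ / tan θ] + f(θ,u,u_θ)` at `u`, applied to a
complex-valued function `v`, at `θ ∈ (0, π)`. -/
def linearization (a f : ℝ → ℝ → ℝ → ℝ) (u : ℝ → ℝ) (v : ℝ → ℂ) (θ : ℝ) : ℂ :=
  a θ (u θ) (deriv u θ) • sphLap v θ
    + (deriv (fun s => a θ s (deriv u θ)) (u θ) * sphLap u θ
        + deriv (fun s => f θ s (deriv u θ)) (u θ)) • v θ
    + (deriv (fun q => a θ (u θ) q) (deriv u θ) * sphLap u θ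
        + deriv (fun q => f θ (u θ) q) (deriv u θ)) • deriv v θ

/-- `z` is an eigenvalue of the linearization at `u`, acting on twice continuously differentiable
complex functions on `[0, π]` with Neumann boundary conditions. -/
def IsEigenvalue (a f : ℝ → ℝ → ℝ → ℝ) (u : ℝ → ℝ) (z : ℂ) : Prop :=
  ∃ v : ℝ → ℂ, ContDiffOn ℝ 2 v (Icc 0 Real.pi) ∧
    derivWithin v (Icc 0 Real.pi) 0 = 0 ∧ derivWithin v (Icc 0 Real.pi) Real.pi = 0 ∧
    (∃ θ ∈ Icc 0 Real.pi, v θ ≠ 0) ∧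
    ∀ θ ∈ Ioo 0 Real.pi, linearization a f u v θ = z * v θ

/-- No eigenvalue of the linearization lies on the imaginary axis. -/
def IsHyperbolic (a f : ℝ → ℝ → ℝ → ℝ) (u : ℝ → ℝ) : Prop :=
  ∀ z : ℂ, z.re = 0 → ¬ IsEigenvalue a f u z

/-- The number of positive eigenvalues of the linearization. -/
def morseIndex (a f : ℝ → ℝ → ℝ → ℝ) (u : ℝ → ℝ) : ℕ∞ :=
  {l : ℝ | 0 < l ∧ IsEigenvalue a f u (l : ℂ)}.encard

/-! ### The shooting system. Points of `ℝ³` are written `(θ, u, p)`. -/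

/-- The vector field `θ_τ = sin θ`, `u_τ = p`, `p_τ = -(f/a)(θ, u, p / sin θ) sin² θ`.
For `θ ∈ {0, π}` it is `(0, p, 0)`. -/
def shootField (a f : ℝ → ℝ → ℝ → ℝ) (x : ℝ × ℝ × ℝ) : ℝ × ℝ × ℝ :=
  (Real.sin x.1, x.2.2,
    -(f x.1 x.2.1 (x.2.2 / Real.sin x.1) / a x.1 x.2.1 (x.2.2 / Real.sin x.1))
      * Real.sin x.1 ^ 2)

/-- A complete orbit `τ ↦ (θ, u, p)` of the shooting system in `[0, π] × ℝ²`. -/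
def IsShootOrbit (a f : ℝ → ℝ → ℝ → ℝ) (g : ℝ → ℝ × ℝ × ℝ) : Prop :=
  ∀ τ, (g τ).1 ∈ Icc 0 Real.pi ∧ HasDerivAt g (shootField a f (g τ)) τ

/-- The strong unstable manifold of the rest point `(0, d, 0)`: the orbits which converge to it
exponentially as `τ → -∞`. An orbit which has a limit as `τ → ∞` (necessarily in `θ = π`, unless
it is constant) is taken together with that limit, so that cross-sections make sense for all
`θ ∈ [0, π]`. -/
def Wu (a f : ℝ → ℝ → ℝ → ℝ) (d : ℝ) : Set (ℝ × ℝ × ℝ) :=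
  {x | ∃ g, IsShootOrbit a f g ∧
    (∃ r > 0, ∃ C : ℝ, ∀ τ ≤ 0, ‖g τ - (0, d, 0)‖ ≤ C * Real.exp (r * τ)) ∧
    ((∃ τ, g τ = x) ∨ Tendsto g atTop (𝓝 x))}

/-- The strong stable manifold of the rest point `(π, e, 0)`: the orbits which converge to it
exponentially as `τ → ∞`, each taken together with its limit as `τ → -∞` if there is one. -/
def Ws (a f : ℝ → ℝ → ℝ → ℝ) (e : ℝ) : Set (ℝ × ℝ × ℝ) :=
  {x | ∃ g, IsShootOrbit a f g ∧
    (∃ r > 0, ∃ C : ℝ, ∀ τ ≥ 0, ‖g τ - (Real.pi, e, 0)‖ ≤ C * Real.exp (-r * τ)) ∧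
    ((∃ τ, g τ = x) ∨ Tendsto g atBot (𝓝 x))}

/-- The unstable shooting manifold. -/
def Mu (a f : ℝ → ℝ → ℝ → ℝ) : Set (ℝ × ℝ × ℝ) := ⋃ d : ℝ, Wu a f d

/-- The stable shooting manifold. -/
def Ms (a f : ℝ → ℝ → ℝ → ℝ) : Set (ℝ × ℝ × ℝ) := ⋃ e : ℝ, Ws a f e

/-- The cross-section at `θ` of a subset of `ℝ³`, as a set of points `(u, p)`. -/
def crossSection (M : Set (ℝ × ℝ × ℝ)) (θ : ℝ) : Set (ℝ × ℝ) := {q | (θ, q) ∈ M}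

/-- The point `(u, p) = (u, u_τ) = (u, u_θ sin θ)` at `θ` of the orbit given by `u`. -/
def phasePoint (u : ℝ → ℝ) (θ : ℝ) : ℝ × ℝ := (u θ, Real.sin θ * deriv u θ)

/-- The parametrization `d ↦ (u^u(θ,d), p^u(θ,d))` of the cross-section of `Mu` at `θ ∈ (0, π)`:
the point in which the strong unstable manifold of `(0, d, 0)` meets the plane of height `θ`. -/
def unstableCurve (a f : ℝ → ℝ → ℝ → ℝ) (θ d : ℝ) : ℝ × ℝ :=
  Classical.epsilon fun q : ℝ × ℝ => (θ, q) ∈ Wu a f d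

/-- The parametrization `e ↦ (u^s(θ,e), p^s(θ,e))` of the cross-section of `Ms` at
`θ ∈ (0, π)`. -/
def stableCurve (a f : ℝ → ℝ → ℝ → ℝ) (θ e : ℝ) : ℝ × ℝ :=
  Classical.epsilon fun q : ℝ × ℝ => (θ, q) ∈ Ws a f e

/-- The tangent vector `(∂u/∂d, ∂p/∂d)` of the unstable shooting curve at height `θ`. -/
def unstableTangent (a f : ℝ → ℝ → ℝ → ℝ) (θ d : ℝ) : ℝ × ℝ :=
  deriv (fun d' => unstableCurve a f θ d') d

/-- The tangent vector `(∂u/∂e, ∂p/∂e)` of the stable shooting curve at height `θ`. -/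
def stableTangent (a f : ℝ → ℝ → ℝ → ℝ) (θ e : ℝ) : ℝ × ℝ :=
  deriv (fun e' => stableCurve a f θ e') e

/-- The tangent plane of `Mu` at its point with parameters `(θ, d)`, spanned by the direction of
the flow and the tangent vector of the cross-section. -/
def unstableTangentPlane (a f : ℝ → ℝ → ℝ → ℝ) (θ d : ℝ) : Submodule ℝ (ℝ × ℝ × ℝ) :=
  Submodule.span ℝ {shootField a f (θ, unstableCurve a f θ d), (0, unstableTangent a f θ d)}

/-- The tangent plane of `Ms` at its point with parameters `(θ, e)`. -/
def stableTangentPlane (a f : ℝ → ℝ → ℝ → ℝ) (θ e : ℝ) : Submodule ℝ (ℝ × ℝ × ℝ) :=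
  Submodule.span ℝ {shootField a f (θ, stableCurve a f θ e), (0, stableTangent a f θ e)}

/-- At the common point at height `θ` of the strong unstable manifold of `(0, d, 0)` and the
strong stable manifold of `(π, e, 0)`, the surfaces `Mu` and `Ms` intersect transversely: their
tangent planes together span `ℝ³`. -/
def MeetTransversely (a f : ℝ → ℝ → ℝ → ℝ) (θ d e : ℝ) : Prop :=
  unstableTangentPlane a f θ d ⊔ stableTangentPlane a f θ e = ⊤

/-- `ν` is the clockwise angle from the `u`-axis to the tangent vectors of the unstable shooting
curves along the orbit with parameter `d`: the continuous lift with `ν → 0` as `θ → 0`. -/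
structure IsUnstableAngle (a f : ℝ → ℝ → ℝ → ℝ) (d : ℝ) (ν : ℝ → ℝ) : Prop where
  continuousOn : ContinuousOn ν (Ioo 0 Real.pi)
  polar : ∀ θ ∈ Ioo 0 Real.pi, ∃ r > 0,
    unstableTangent a f θ d = (r * Real.cos (ν θ), -(r * Real.sin (ν θ)))
  tendsto_zero : Tendsto ν (𝓝[>] 0) (𝓝 0)

/-- `ν` is the clockwise angle from the `u`-axis to the tangent vectors of the stable shooting
curves along the orbit with parameter `e`: the continuous lift with `ν → 0` as `θ → π`. -/
structure IsStableAngle (a f : ℝ → ℝ → ℝ → ℝ) (e : ℝ) (ν : ℝ → ℝ) : Prop where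
  continuousOn : ContinuousOn ν (Ioo 0 Real.pi)
  polar : ∀ θ ∈ Ioo 0 Real.pi, ∃ r > 0,
    stableTangent a f θ e = (r * Real.cos (ν θ), -(r * Real.sin (ν θ)))
  tendsto_zero : Tendsto ν (𝓝[<] Real.pi) (𝓝 0)

end AxisymShooting

end

open Set Filter Topology

noncomputable section

namespace AxisymShooting

open Real (sin cos)

/-! In the variable θ the shooting system is the scalar equation u'' + cot θ u' = h with h = -f/a,
and an orbit that runs between the poles is a solution on (0, π). The proof rests on three facts: an
orbit that converges to a rest point at a pole is a solution regular at that pole, regular solutions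
depend differentiably on their value at the pole, and eigenvalues are counted by a Sturm rotation
argument.

Regularity. The equation reads (sin θ u')' = sin θ h, and dividing a primitive of sin θ h by sin θ
does no harm at θ = 0. This gives a Gronwall inequality (`singular_gronwall`), existence
(`exists_regSol`) and uniqueness (`RegSol.eq`) for the singular problem u(0) = d, u'(0) = 0.
Conversely, κ < 2 makes θ^(1-κ) integrable, which forces u' → 0 as soon as u → d and sin θ u' → 0
(`Sol.tendsto_zero`). Hence inside (0, π) the strong unstable manifold of (0, d, 0) is the single
orbit of the regular solution with value d (`orbit_of_tendsto`, `mem_Wu_iff`); plain convergence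
already suffices. The reflection (θ, u, p) ↦ (π - θ, u, -p) with time reversal turns stable into
unstable manifolds. A point of both manifolds comes from a solution regular at both poles
(`exists_fullSol_of_mem`). Such solutions are C² up to the poles, and they are the equilibria.

Transversality. The derivative of the regular solution in d is the solution (U, V) of the linearized
equation with U(0) = 1, V(0) = 0 (`hasDerivAt_family`), so the tangent of the unstable curve is (U,
sin θ V); the other pole is analogous. Since f = -a h, the linearization at an equilibrium is a
times w'' + cot θ w' - h_u w - h_p w'. So z is an eigenvalue if and only if w'' + cot θ w' = h_u w +
h_p w' + (z/a) w has a nontrivial solution regular at both poles. Lagrange's identity with the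
weight exp(-∫ h_p) shows that eigenvalues are real. For z = 0 such a solution exists exactly when
the two tangents are parallel, which is the failure of transversality because both planes contain
the flow direction.

Morse index. For real l, the solutions from the two poles have continuous angles, and l is an
eigenvalue if and only if the sum F(l) of these angles is a multiple of π (`match_iff_angle`). F is
continuous, strictly decreasing (Lagrange's identity again, `strictAnti_angle`) and lies in (-π, 0)
for large l (`eventually_angle_mem`). So the positive eigenvalues correspond to the integers m ≥ 0
with m π < F(0), and F(0) = ν - ν̃, the reflection being responsible for the minus sign. -/

/-! ### Singular initial value problems -/

/-- `u' = v` and `v' + cot θ v = h(θ,u,v)` on `(0, b)`. -/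
def Sol (h : ℝ → ℝ → ℝ → ℝ) (b : ℝ) (u v : ℝ → ℝ) : Prop :=
  ∀ θ ∈ Ioo 0 b, HasDerivAt u (v θ) θ ∧
    HasDerivAt v (h θ (u θ) (v θ) - cos θ / sin θ * v θ) θ

/-- Solutions that are regular at the singular point `θ = 0`. -/
structure RegSol (h : ℝ → ℝ → ℝ → ℝ) (b d : ℝ) (u v : ℝ → ℝ) : Prop where
  sol : Sol h b u v
  cu : ContinuousOn u (Ico 0 b)
  cv : ContinuousOn v (Ico 0 b)
  u0 : u 0 = d
  v0 : v 0 = 0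

/-- Local Lipschitz continuity in `(u, v)`, uniform for `θ` away from `π`. -/
def LocLip (h : ℝ → ℝ → ℝ → ℝ) : Prop :=
  ∀ θ₁ < Real.pi, ∀ R : ℝ, ∃ L ≥ 0, ∀ θ ∈ Icc 0 θ₁, ∀ u v u' v' : ℝ, |u| ≤ R → |v| ≤ R → |u'| ≤ R →
    |v'| ≤ R → |h θ u' v' - h θ u v| ≤ L * (|u' - u| + |v' - v|)

/-- Global Lipschitz continuity in `(u, v)`, uniform for `θ` away from `π`. -/
def GlobLip (h : ℝ → ℝ → ℝ → ℝ) : Prop :=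
  ∀ θ₁ < Real.pi, ∃ L ≥ 0, ∀ θ ∈ Icc 0 θ₁, ∀ u v u' v' : ℝ,
    |h θ u' v' - h θ u v| ≤ L * (|u' - u| + |v' - v|)

lemma GlobLip.locLip {h : ℝ → ℝ → ℝ → ℝ} (H : GlobLip h) : LocLip h := fun θ₁ h₁ _ =>
  let ⟨L, hL, H'⟩ := H θ₁ h₁
  ⟨L, hL, fun θ hθ u v u' v' _ _ _ _ => H' θ hθ u v u' v'⟩

lemma sin_pos_of_mem {θ : ℝ} (h : θ ∈ Ioo 0 Real.pi) : 0 < sin θ :=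
  Real.sin_pos_of_pos_of_lt_pi h.1 h.2

lemma abs_sub_le_of_abs_deriv_le {f f' B B' : ℝ → ℝ} {a b : ℝ} (hab : a ≤ b)
    (hf : ContinuousOn f (Icc a b)) (hf' : ∀ x ∈ Ioo a b, HasDerivAt f (f' x) x)
    (hB : ContinuousOn B (Icc a b)) (hB' : ∀ x ∈ Ioo a b, HasDerivAt B (B' x) x)
    (h : ∀ x ∈ Ioo a b, |f' x| ≤ B' x) : |f b - f a| ≤ B b - B a := by
  have h1 : MonotoneOn (fun x => B x - f x) (Icc a b) := by
    apply monotoneOn_of_hasDerivWithinAt_nonneg (f' := fun x => B' x - f' x) (convex_Icc a b)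
      (hB.sub hf)
    · intro x hx; rw [interior_Icc] at hx
      exact ((hB' x hx).sub (hf' x hx)).hasDerivWithinAt
    · intro x hx; rw [interior_Icc] at hx
      linarith [(abs_le.1 (h x hx)).2]
  have h2 : MonotoneOn (fun x => B x + f x) (Icc a b) := by
    apply monotoneOn_of_hasDerivWithinAt_nonneg (f' := fun x => B' x + f' x) (convex_Icc a b)
      (hB.add hf)
    · intro x hx; rw [interior_Icc] at hx
      exact ((hB' x hx).add (hf' x hx)).hasDerivWithinAt
    · intro x hx; rw [interior_Icc] at hx
      linarith [(abs_le.1 (h x hx)).1]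
  have h1' := h1 (left_mem_Icc.2 hab) (right_mem_Icc.2 hab) hab
  have h2' := h2 (left_mem_Icc.2 hab) (right_mem_Icc.2 hab) hab
  simp only at h1' h2'
  rw [abs_le]; constructor <;> linarith

/-- The derivative of sin θ · exp (K θ) is (cos θ + K sin θ) exp (K θ), and this bound makes it a
barrier for primitives of sin θ · exp (K θ) with the small factor 2 / K. Up to π / 2 the cosine is
nonnegative; beyond, sin θ ≥ sin θ₁, so half of K sin θ is at least 1 and absorbs cos θ ≥ -1. -/
lemma half_mul_sin_le {θ₁ K θ : ℝ} (h₁ : θ₁ ∈ Ioo 0 Real.pi) (hK : 2 / sin θ₁ ≤ K)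
    (hθ : θ ∈ Ioc 0 θ₁) : K / 2 * sin θ ≤ cos θ + K * sin θ := by
  have hs₁ := sin_pos_of_mem h₁
  have hs := sin_pos_of_mem ⟨hθ.1, hθ.2.trans_lt h₁.2⟩
  have hK0 : 0 < K := (by positivity : 0 < 2 / sin θ₁).trans_le hK
  rcases le_or_gt θ (Real.pi / 2) with h | h
  · have := Real.cos_nonneg_of_mem_Icc ⟨by linarith [hθ.1, Real.pi_pos], h⟩
    nlinarith
  · have h2 : sin θ₁ ≤ sin θ := by
      rw [← Real.sin_pi_sub θ, ← Real.sin_pi_sub θ₁]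
      apply Real.sin_le_sin_of_le_of_le_pi_div_two <;> linarith [hθ.2, h₁.2]
    have h3 : 2 ≤ K * sin θ := by
      have : 2 ≤ K * sin θ₁ := by rwa [div_le_iff₀ hs₁] at hK
      nlinarith
    linarith [Real.neg_one_le_cos θ]

/-- The weighted bound for primitives of `sin θ * r θ`. -/
lemma sin_primitive_bound {θ₁ K θ₂ m : ℝ} (h₁ : θ₁ ∈ Ioo 0 Real.pi) (hK : 2 / sin θ₁ ≤ K)
    (h₂ : θ₂ ∈ Icc 0 θ₁) {P r : ℝ → ℝ} (hP : ContinuousOn P (Icc 0 θ₂)) (hP0 : P 0 = 0)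
    (hP' : ∀ θ ∈ Ioo 0 θ₂, HasDerivAt P (sin θ * r θ) θ)
    (hr : ∀ θ ∈ Ioo 0 θ₂, |r θ| ≤ m * Real.exp (K * θ)) :
    |P θ₂| ≤ sin θ₂ * (2 * m / K * Real.exp (K * θ₂)) := by
  have hs₁ := sin_pos_of_mem h₁
  have hK0 : 0 < K := (by positivity : 0 < 2 / sin θ₁).trans_le hK
  have := abs_sub_le_of_abs_deriv_le (f := P) (f' := fun θ => sin θ * r θ)
    (B := fun θ => sin θ * (2 * m / K * Real.exp (K * θ)))
    (B' := fun θ => cos θ * (2 * m / K * Real.exp (K * θ)) +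
      sin θ * (2 * m / K * (Real.exp (K * θ) * (K * 1)))) h₂.1 hP hP' (by fun_prop)
    (fun θ _ => (Real.hasDerivAt_sin θ).mul
      ((((hasDerivAt_id θ).const_mul K).exp).const_mul (2 * m / K))) ?_
  · simpa [hP0] using this
  · intro θ hθ
    have hs := sin_pos_of_mem ⟨hθ.1, (hθ.2.trans_le h₂.2).trans h₁.2⟩
    have hr' := hr θ hθ
    have hE := Real.exp_pos (K * θ)
    have hm : 0 ≤ m := by
      by_contra hm
      have := abs_nonneg (r θ)
      nlinarith
    have h3 := half_mul_sin_le h₁ hK ⟨hθ.1, hθ.2.le.trans h₂.2⟩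
    rw [abs_mul, abs_of_pos hs]
    calc sin θ * |r θ| ≤ sin θ * (m * Real.exp (K * θ)) := by gcongr
      _ = (K / 2 * sin θ) * (2 * m / K * Real.exp (K * θ)) := by field_simp
      _ ≤ (cos θ + K * sin θ) * (2 * m / K * Real.exp (K * θ)) := by gcongr
      _ = _ := by ring

/-- The integrating factor sin θ absorbs the cotangent term, so that the singular equation can be
integrated from the pole. -/
lemma hasDerivAt_sin_mul {y : ℝ → ℝ} {r θ : ℝ} (hs : sin θ ≠ 0)
    (hy : HasDerivAt y (r - cos θ / sin θ * y θ) θ) :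
    HasDerivAt (fun θ => sin θ * y θ) (sin θ * r) θ := by
  have := (Real.hasDerivAt_sin θ).mul hy
  refine this.congr_deriv ?_
  field_simp; ring

/-- A Gronwall inequality for the singular problem `x' = y`, `y' + cot θ y = r`, `y 0 = 0`. -/
theorem singular_gronwall {θ₁ : ℝ} (h₁ : θ₁ ∈ Ioo 0 Real.pi) {L : ℝ} (hL : 0 ≤ L) :
    ∃ C ≥ 1, ∀ θ₂ ∈ Icc 0 θ₁, ∀ (x y r : ℝ → ℝ) (η : ℝ), 0 ≤ η →
      ContinuousOn x (Icc 0 θ₂) → ContinuousOn y (Icc 0 θ₂) → y 0 = 0 →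
      (∀ θ ∈ Ioo 0 θ₂, HasDerivAt x (y θ) θ ∧ HasDerivAt y (r θ - cos θ / sin θ * y θ) θ) →
      (∀ θ ∈ Ioo 0 θ₂, |r θ| ≤ L * (|x θ| + |y θ|) + η) →
      ∀ θ ∈ Icc 0 θ₂, |x θ| + |y θ| ≤ C * (|x 0| + η) := by
  have hs₁ := sin_pos_of_mem h₁
  -- The summand 2 / sin θ₁ is required by `sin_primitive_bound`; 4 L + 4 lets m / K + 2 (L m + η) /
  -- K be absorbed into m / 2 + η below.
  set K := 2 / sin θ₁ + 4 * L + 4 with hK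
  have hKs : 2 / sin θ₁ ≤ K := by linarith
  have hK1 : 4 + 4 * L ≤ K := by
    have : 0 < 2 / sin θ₁ := by positivity
    linarith
  have hK0 : 0 < K := by linarith
  refine ⟨2 * Real.exp (K * Real.pi), ?_, ?_⟩
  · have : 1 ≤ Real.exp (K * Real.pi) := Real.one_le_exp (by have := Real.pi_pos; positivity)
    linarith
  intro θ₂ h₂ x y r η hη hx hy hy0 hd hr
  -- Maximum m of the exponentially weighted norm: integrating both equations up to the maximum
  -- point bounds m by the data plus at most m / 2.
  obtain ⟨θm, hθm, hmax⟩ := isCompact_Icc.exists_isMaxOn (nonempty_Icc.2 h₂.1)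
    (f := fun θ => Real.exp (-(K * θ)) * (|x θ| + |y θ|)) (by fun_prop)
  set m := Real.exp (-(K * θm)) * (|x θm| + |y θm|) with hm
  have hm0 : 0 ≤ m := by positivity
  have hM : ∀ θ ∈ Icc 0 θ₂, |x θ| + |y θ| ≤ m * Real.exp (K * θ) := by
    intro θ hθ
    have : Real.exp (-(K * θ)) * (|x θ| + |y θ|) ≤ m := hmax hθ
    rw [Real.exp_neg, inv_mul_le_iff₀ (Real.exp_pos _)] at this
    linarith
  have hxb : |x θm - x 0| ≤ m / K * Real.exp (K * θm) - m / K * Real.exp (K * 0) := by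
    apply abs_sub_le_of_abs_deriv_le (f := x) (f' := y) (B := fun θ => m / K * Real.exp (K * θ))
      (B' := fun θ => m / K * (Real.exp (K * θ) * (K * 1))) hθm.1
      (hx.mono (Icc_subset_Icc_right hθm.2)) _ (by fun_prop)
    · intro θ _
      exact (((hasDerivAt_id θ).const_mul K).exp).const_mul (m / K)
    · intro θ hθ
      have := hM θ ⟨hθ.1.le, hθ.2.le.trans hθm.2⟩
      calc |y θ| ≤ m * Real.exp (K * θ) := by linarith [abs_nonneg (x θ)]
        _ = _ := by field_simp
    · intro θ hθ
      exact (hd θ ⟨hθ.1, hθ.2.trans_le hθm.2⟩).1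
  have hyb : |y θm| ≤ 2 * (L * m + η) / K * Real.exp (K * θm) := by
    rcases hθm.1.eq_or_lt with h0 | h0
    · rw [← h0, hy0]; simp; positivity
    have hs := sin_pos_of_mem ⟨h0, (hθm.2.trans h₂.2).trans_lt h₁.2⟩
    have := sin_primitive_bound (P := fun θ => sin θ * y θ) (r := r) (m := L * m + η)
      h₁ hKs ⟨hθm.1, hθm.2.trans h₂.2⟩
      (ContinuousOn.mul (by fun_prop) (hy.mono (Icc_subset_Icc_right hθm.2))) (by simp) ?_ ?_
    · simp only [abs_mul, abs_of_pos hs] at this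
      exact le_of_mul_le_mul_left this hs
    · intro θ hθ
      exact hasDerivAt_sin_mul
        (sin_pos_of_mem ⟨hθ.1, hθ.2.trans ((hθm.2.trans h₂.2).trans_lt h₁.2)⟩).ne'
        (hd θ ⟨hθ.1, hθ.2.trans_le hθm.2⟩).2
    · intro θ hθ
      have h1 := hr θ ⟨hθ.1, hθ.2.trans_le hθm.2⟩
      have h2 := hM θ ⟨hθ.1.le, hθ.2.le.trans hθm.2⟩
      have h3 : 1 ≤ Real.exp (K * θ) := Real.one_le_exp (mul_nonneg hK0.le hθ.1.le)
      nlinarith [mul_le_mul_of_nonneg_left h2 hL]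
  have hxm : |x θm| ≤ |x 0| + (m / K * Real.exp (K * θm) - m / K) := by
    have := abs_sub_abs_le_abs_sub (x θm) (x 0)
    simp at hxb
    linarith
  have key : m ≤ 2 * (|x 0| + η) := by
    have hE : 0 < Real.exp (-(K * θm)) := Real.exp_pos _
    have hE1 : Real.exp (-(K * θm)) ≤ 1 :=
      Real.exp_le_one_iff.2 (neg_nonpos.2 (mul_nonneg hK0.le hθm.1))
    have hEE : Real.exp (-(K * θm)) * Real.exp (K * θm) = 1 := by
      rw [← Real.exp_add]; simp
    have hmK : 0 ≤ m / K := by positivity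
    have h1 : m ≤ |x 0| + m / K + 2 * (L * m + η) / K := by
      calc m ≤ Real.exp (-(K * θm)) * (|x 0| + (m / K * Real.exp (K * θm) - m / K) +
            2 * (L * m + η) / K * Real.exp (K * θm)) := by
            rw [hm]; gcongr
        _ = Real.exp (-(K * θm)) * |x 0| + (m / K + 2 * (L * m + η) / K) *
            (Real.exp (-(K * θm)) * Real.exp (K * θm)) - Real.exp (-(K * θm)) * (m / K) := by ring
        _ ≤ 1 * |x 0| + (m / K + 2 * (L * m + η) / K) * 1 - 0 := by
            rw [hEE]; gcongr; positivity
        _ = _ := by ring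
    have h2 : m / K + 2 * (L * m + η) / K ≤ m / 2 + η := by
      rw [← add_div, div_le_iff₀ hK0]
      nlinarith [mul_nonneg hm0 hL]
    linarith
  intro θ hθ
  calc |x θ| + |y θ| ≤ m * Real.exp (K * θ) := hM θ hθ
    _ ≤ (2 * (|x 0| + η)) * Real.exp (K * Real.pi) := by
        gcongr
        exact hθ.2.trans (h₂.2.trans h₁.2.le)
    _ = _ := by ring

lemma exists_abs_le_of_continuousOn {f : ℝ → ℝ} {a b : ℝ} (hf : ContinuousOn f (Icc a b)) :
    ∃ R ≥ 0, ∀ θ ∈ Icc a b, |f θ| ≤ R := by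
  obtain ⟨R, hR⟩ := isCompact_Icc.exists_bound_of_continuousOn hf
  exact ⟨max R 0, le_max_right _ _, fun θ hθ => (hR θ hθ).trans (le_max_left _ _)⟩

lemma Sol.mono {h : ℝ → ℝ → ℝ → ℝ} {b b' : ℝ} {u v : ℝ → ℝ} (H : Sol h b u v) (hb : b' ≤ b) :
    Sol h b' u v := fun θ hθ => H θ ⟨hθ.1, hθ.2.trans_le hb⟩

lemma RegSol.mono {h : ℝ → ℝ → ℝ → ℝ} {b b' d : ℝ} {u v : ℝ → ℝ} (H : RegSol h b d u v)
    (hb : b' ≤ b) : RegSol h b' d u v :=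
  ⟨H.sol.mono hb, H.cu.mono (Ico_subset_Ico_right hb), H.cv.mono (Ico_subset_Ico_right hb),
    H.u0, H.v0⟩

lemma Sol.continuousOn {h : ℝ → ℝ → ℝ → ℝ} {b : ℝ} {u v : ℝ → ℝ} (H : Sol h b u v) :
    ContinuousOn u (Ioo 0 b) ∧ ContinuousOn v (Ioo 0 b) :=
  ⟨fun θ hθ => (H θ hθ).1.continuousAt.continuousWithinAt,
    fun θ hθ => (H θ hθ).2.continuousAt.continuousWithinAt⟩

/-- Uniqueness for the regular initial value problem. -/
theorem Sol.eq {h : ℝ → ℝ → ℝ → ℝ} (hh : LocLip h) {b : ℝ} (hb : b ≤ Real.pi) {u v u' v' : ℝ → ℝ}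
    (H : Sol h b u v) (H' : Sol h b u' v') {θ₀ : ℝ} (h₀ : θ₀ ∈ Ioo 0 b) (eu : u θ₀ = u' θ₀)
    (ev : v θ₀ = v' θ₀) : ∀ θ ∈ Ioo 0 b, u θ = u' θ ∧ v θ = v' θ := by
  intro θ hθ
  obtain ⟨α, hα0, hα⟩ : ∃ α, 0 < α ∧ α < min θ θ₀ := exists_between (lt_min hθ.1 h₀.1)
  obtain ⟨β, hβ, hβb⟩ : ∃ β, max θ θ₀ < β ∧ β < b := exists_between (max_lt hθ.2 h₀.2)
  have hsub : Icc α β ⊆ Ioo 0 b := fun t ht => ⟨hα0.trans_le ht.1, ht.2.trans_lt hβb⟩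
  obtain ⟨R1, -, hR1⟩ := exists_abs_le_of_continuousOn (H.continuousOn.1.mono hsub)
  obtain ⟨R2, -, hR2⟩ := exists_abs_le_of_continuousOn (H.continuousOn.2.mono hsub)
  obtain ⟨R3, -, hR3⟩ := exists_abs_le_of_continuousOn (H'.continuousOn.1.mono hsub)
  obtain ⟨R4, -, hR4⟩ := exists_abs_le_of_continuousOn (H'.continuousOn.2.mono hsub)
  -- On [α, β], away from both poles, the cotangent is bounded, so the classical uniqueness theorem
  -- applies.
  obtain ⟨c, hc0, hc⟩ := exists_abs_le_of_continuousOn (f := fun t => cos t / sin t) (a := α)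
    (b := β) (ContinuousOn.div (by fun_prop) (by fun_prop) fun t ht =>
      (sin_pos_of_mem ⟨(hsub ht).1, (hsub ht).2.trans_le hb⟩).ne')
  set R := max (max R1 R2) (max R3 R4)
  obtain ⟨L, hL, hlip⟩ := hh β (hβb.trans_le hb) R
  have key := ODE_solution_unique_of_mem_Icc (E := ℝ × ℝ) (a := α) (b := β) (t₀ := θ₀)
    (v := fun t z => (z.2, h t z.1 z.2 - cos t / sin t * z.2))
    (s := fun _ => {z | |z.1| ≤ R ∧ |z.2| ≤ R}) (K := (1 + 2 * L + c).toNNReal)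
    (f := fun t => (u t, v t)) (g := fun t => (u' t, v' t)) ?_
    ⟨hα.trans_le (min_le_right _ _), (le_max_right _ _).trans_lt hβ⟩ ?_ ?_ ?_ ?_ ?_ ?_ ?_
  · have := key (show θ ∈ Icc α β from
      ⟨(hα.trans_le (min_le_left _ _)).le, ((le_max_left _ _).trans_lt hβ).le⟩)
    simpa using this
  · intro t ht
    apply LipschitzOnWith.of_dist_le_mul
    rintro ⟨z1, z2⟩ hz ⟨w1, w2⟩ hw
    have hz' : |z1| ≤ R ∧ |z2| ≤ R := hz
    have hw' : |w1| ≤ R ∧ |w2| ≤ R := hw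
    have ht' : t ∈ Icc α β := Ioo_subset_Icc_self ht
    have h1 := hlip t ⟨(hsub ht').1.le, ht'.2⟩ w1 w2 z1 z2 hw'.1 hw'.2 hz'.1 hz'.2
    have h2 := hc t ht'
    simp only [Prod.dist_eq, Real.dist_eq, Real.coe_toNNReal _ (by positivity : 0 ≤ 1 + 2 * L + c)]
    set D := max |z1 - w1| |z2 - w2| with hD
    have hD1 : |z1 - w1| ≤ D := le_max_left _ _
    have hD2 : |z2 - w2| ≤ D := le_max_right _ _
    have hD0 : 0 ≤ D := (abs_nonneg _).trans hD1
    apply max_le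
    · nlinarith [mul_nonneg hL hD0, mul_nonneg hc0 hD0]
    · have : h t z1 z2 - cos t / sin t * z2 - (h t w1 w2 - cos t / sin t * w2) =
        (h t z1 z2 - h t w1 w2) - cos t / sin t * (z2 - w2) := by ring
      rw [this]
      calc _ ≤ |h t z1 z2 - h t w1 w2| + |cos t / sin t * (z2 - w2)| := abs_sub _ _
        _ ≤ L * (D + D) + c * D := by
          rw [abs_mul]
          refine add_le_add (h1.trans ?_) ?_
          · gcongr
          · gcongr
        _ ≤ (1 + 2 * L + c) * D := by linarith
  · exact (H.continuousOn.1.mono hsub).prodMk (H.continuousOn.2.mono hsub)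
  · intro t ht
    exact (H t (hsub (Ioo_subset_Icc_self ht))).1.prodMk (H t (hsub (Ioo_subset_Icc_self ht))).2
  · intro t ht
    have ht' := Ioo_subset_Icc_self ht
    exact ⟨(hR1 t ht').trans (by simp [R]), (hR2 t ht').trans (by simp [R])⟩
  · exact (H'.continuousOn.1.mono hsub).prodMk (H'.continuousOn.2.mono hsub)
  · intro t ht
    exact (H' t (hsub (Ioo_subset_Icc_self ht))).1.prodMk (H' t (hsub (Ioo_subset_Icc_self ht))).2
  · intro t ht
    have ht' := Ioo_subset_Icc_self ht
    exact ⟨(hR3 t ht').trans (by simp [R]), (hR4 t ht').trans (by simp [R])⟩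
  · simp [eu, ev]

/-- Uniqueness for the singular initial value problem. -/
theorem RegSol.eq {h : ℝ → ℝ → ℝ → ℝ} (hh : LocLip h) {b d : ℝ} (hb : b ≤ Real.pi)
    {u v u' v' : ℝ → ℝ}
    (H : RegSol h b d u v) (H' : RegSol h b d u' v') :
    ∀ θ ∈ Ico 0 b, u θ = u' θ ∧ v θ = v' θ := by
  intro θ hθ
  rcases hθ.1.eq_or_lt with h0 | h0
  · rw [← h0, H.u0, H'.u0, H.v0, H'.v0]; exact ⟨rfl, rfl⟩
  have hsub : Icc 0 θ ⊆ Ico 0 b := fun t ht => ⟨ht.1, ht.2.trans_lt hθ.2⟩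
  obtain ⟨R1, -, hR1⟩ := exists_abs_le_of_continuousOn (H.cu.mono hsub)
  obtain ⟨R2, -, hR2⟩ := exists_abs_le_of_continuousOn (H.cv.mono hsub)
  obtain ⟨R3, -, hR3⟩ := exists_abs_le_of_continuousOn (H'.cu.mono hsub)
  obtain ⟨R4, -, hR4⟩ := exists_abs_le_of_continuousOn (H'.cv.mono hsub)
  set R := max (max R1 R2) (max R3 R4)
  have hθReal.pi : θ < Real.pi := hθ.2.trans_le hb
  obtain ⟨L, hL, hlip⟩ := hh θ hθReal.pi R
  obtain ⟨C, -, hC⟩ := singular_gronwall (θ₁ := θ) ⟨h0, hθReal.pi⟩ hL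
  have := hC θ ⟨hθ.1, le_rfl⟩ (fun t => u t - u' t) (fun t => v t - v' t)
    (fun t => h t (u t) (v t) - h t (u' t) (v' t)) 0 le_rfl ((H.cu.mono hsub).sub (H'.cu.mono hsub))
    ((H.cv.mono hsub).sub (H'.cv.mono hsub)) (by simp [H.v0, H'.v0]) ?_ ?_ θ ⟨hθ.1, le_rfl⟩
  · simp only [H.u0, H'.u0, sub_self, abs_zero, add_zero, mul_zero] at this
    have h1 := abs_nonneg (u θ - u' θ)
    have h2 := abs_nonneg (v θ - v' θ)
    exact ⟨sub_eq_zero.1 (abs_eq_zero.1 (by linarith)), sub_eq_zero.1 (abs_eq_zero.1 (by linarith))⟩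
  · intro t ht
    have ht' : t ∈ Ioo 0 b := ⟨ht.1, ht.2.trans hθ.2⟩
    refine ⟨(H.sol t ht').1.sub (H'.sol t ht').1, ?_⟩
    refine ((H.sol t ht').2.sub (H'.sol t ht').2).congr_deriv ?_
    ring
  · intro t ht
    have ht' := Ioo_subset_Icc_self ht
    rw [add_zero]
    exact hlip t ht' _ _ _ _ ((hR3 t ht').trans (by simp [R])) ((hR4 t ht').trans (by simp [R]))
      ((hR1 t ht').trans (by simp [R])) ((hR2 t ht').trans (by simp [R]))

/-! ### Existence for the singular problem by a weighted contraction -/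

/-- The solution operator of `(sin θ v)' = sin θ w`, `v 0 = 0`. -/
def sinAvg (w : ℝ → ℝ) (θ : ℝ) : ℝ := (∫ φ in (0)..θ, sin φ * w φ) / sin θ

lemma hasDerivAt_sin_integral {w : ℝ → ℝ} (hw : Continuous w) (θ : ℝ) :
    HasDerivAt (fun θ => ∫ φ in (0)..θ, sin φ * w φ) (sin θ * w θ) θ :=
  (Real.continuous_sin.mul hw).integral_hasStrictDerivAt 0 θ |>.hasDerivAt

lemma hasDerivAt_sinAvg {w : ℝ → ℝ} (hw : Continuous w) {θ : ℝ} (hθ : sin θ ≠ 0) :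
    HasDerivAt (sinAvg w) (w θ - cos θ / sin θ * sinAvg w θ) θ := by
  refine ((hasDerivAt_sin_integral hw θ).div (Real.hasDerivAt_sin θ) hθ).congr_deriv ?_
  rw [sinAvg]; field_simp

/-- At θ = 0 the quotient is 0 / 0, hence 0 by convention, and this is the correct limit: dividing
numerator and denominator by θ leads to the quotient of their derivatives, sin 0 · w 0 / cos 0. -/
lemma continuousOn_sinAvg {w : ℝ → ℝ} (hw : Continuous w) :
    ContinuousOn (sinAvg w) (Ico 0 Real.pi) := by
  intro θ hθ
  apply ContinuousAt.continuousWithinAt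
  rcases hθ.1.eq_or_lt with h0 | h0
  · rw [← h0]
    rw [continuousAt_iff_punctured_nhds]
    have h1 := hasDerivAt_iff_tendsto_slope.1 (hasDerivAt_sin_integral hw 0)
    have h2 := hasDerivAt_iff_tendsto_slope.1 (Real.hasDerivAt_sin 0)
    have h3 := h1.div h2 (by simp)
    have h4 : sinAvg w 0 = sin 0 * w 0 / cos 0 := by simp [sinAvg]
    rw [h4]
    refine h3.congr' ?_
    filter_upwards [self_mem_nhdsWithin] with t ht
    have ht : t ≠ 0 := ht
    simp only [Pi.div_apply, slope_def_field, sinAvg, Real.sin_zero, sub_zero,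
      intervalIntegral.integral_same]
    exact div_div_div_cancel_right₀ ht _ _
  · exact (hasDerivAt_sinAvg hw (sin_pos_of_mem ⟨h0, hθ.2⟩).ne').continuousAt

lemma sinAvg_bound {θ₁ K θ m : ℝ} (h₁ : θ₁ ∈ Ioo 0 Real.pi) (hK : 2 / sin θ₁ ≤ K)
    (hθ : θ ∈ Icc 0 θ₁) {w w' : ℝ → ℝ} (hw : Continuous w) (hw' : Continuous w')
    (hr : ∀ φ ∈ Ioo 0 θ, |w φ - w' φ| ≤ m * Real.exp (K * φ)) (hm : 0 ≤ m) :
    |sinAvg w θ - sinAvg w' θ| ≤ 2 * m / K * Real.exp (K * θ) := by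
  have hs₁ := sin_pos_of_mem h₁
  have hK0 : 0 < K := (by positivity : 0 < 2 / sin θ₁).trans_le hK
  rcases hθ.1.eq_or_lt with h0 | h0
  · rw [← h0]; simp [sinAvg]; positivity
  have hs := sin_pos_of_mem ⟨h0, hθ.2.trans_lt h₁.2⟩
  have := sin_primitive_bound h₁ hK hθ (r := fun φ => w φ - w' φ)
    (P := fun θ => (∫ φ in (0)..θ, sin φ * w φ) - ∫ φ in (0)..θ, sin φ * w' φ)
    (fun t _ => ((hasDerivAt_sin_integral hw t).sub
      (hasDerivAt_sin_integral hw' t)).continuousAt.continuousWithinAt) (by simp)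
    (fun t _ => ((hasDerivAt_sin_integral hw t).sub
      (hasDerivAt_sin_integral hw' t)).congr_deriv (by ring)) hr
  rw [sinAvg, sinAvg, ← sub_div, abs_div, abs_of_pos hs, div_le_iff₀ hs]
  linarith

/-- Existence for the singular initial value problem with a globally Lipschitz right-hand side,
on a compact interval. -/
lemma exists_regSol_of_continuous {h : ℝ → ℝ → ℝ → ℝ}
    (hc : Continuous fun x : ℝ × ℝ × ℝ => h x.1 x.2.1 x.2.2) {θ₁ L : ℝ} (h₁ : θ₁ ∈ Ioo 0 Real.pi)
    (hL : 0 ≤ L) (hlip : ∀ θ ∈ Icc 0 θ₁, ∀ u v u' v' : ℝ,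
      |h θ u' v' - h θ u v| ≤ L * (|u' - u| + |v' - v|)) (d : ℝ) :
    ∃ u v, RegSol h θ₁ d u v := by
  have hs₁ := sin_pos_of_mem h₁
  -- Chosen so that the contraction factor 4 L / K is at most 1 / 2.
  set K := 2 / sin θ₁ + 8 * L + 1 with hK
  have hKs : 2 / sin θ₁ ≤ K := by linarith
  have hK1 : 8 * L + 1 ≤ K := by
    have : 0 < 2 / sin θ₁ := by positivity
    linarith
  have hK0 : 0 < K := by linarith
  -- The unknown y stands for exp (-K θ) · v. The sup norm of y is thus a weighted norm of v, in
  -- which the integral operator contracts however large L is.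
  let V : C(Icc 0 θ₁, ℝ) → ℝ → ℝ := fun y θ => Real.exp (K * θ) * IccExtend h₁.1.le y θ
  have hV : ∀ y, Continuous (V y) := fun y =>
    (by fun_prop : Continuous fun θ : ℝ => Real.exp (K * θ)).mul y.continuous.Icc_extend'
  let U : C(Icc 0 θ₁, ℝ) → ℝ → ℝ := fun y θ => d + ∫ φ in (0)..θ, V y φ
  have hU' : ∀ y θ, HasDerivAt (U y) (V y θ) θ := fun y θ =>
    ((hV y).integral_hasStrictDerivAt 0 θ).hasDerivAt.const_add d
  have hU : ∀ y, Continuous (U y) := fun y =>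
    continuous_iff_continuousAt.2 fun θ => (hU' y θ).continuousAt
  let W : C(Icc 0 θ₁, ℝ) → ℝ → ℝ := fun y θ => h θ (U y θ) (V y θ)
  have hW : ∀ y, Continuous (W y) := fun y =>
    hc.comp (continuous_id.prodMk ((hU y).prodMk (hV y)))
  let T : C(Icc 0 θ₁, ℝ) → C(Icc 0 θ₁, ℝ) := fun y =>
    ⟨fun θ => Real.exp (-(K * θ)) * sinAvg (W y) θ, by
      have : ContinuousOn (fun θ => Real.exp (-(K * θ)) * sinAvg (W y) θ) (Icc 0 θ₁) :=
        ContinuousOn.mul (by fun_prop)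
          ((continuousOn_sinAvg (hW y)).mono fun t ht => ⟨ht.1, ht.2.trans_lt h₁.2⟩)
      exact continuousOn_iff_continuous_domRestrict.1 this⟩
  have hT : ContractingWith (1 / 2) T := by
    refine ⟨by norm_num [← NNReal.coe_lt_coe], LipschitzWith.of_dist_le_mul fun y y' => ?_⟩
    rw [ContinuousMap.dist_le (by positivity)]
    rintro ⟨θ, hθ⟩
    set D := dist y y' with hD
    have hD0 : 0 ≤ D := dist_nonneg
    have hVd : ∀ φ, |V y φ - V y' φ| ≤ D * Real.exp (K * φ) := by
      intro φ
      simp only [V]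
      rw [← mul_sub, abs_mul, abs_of_pos (Real.exp_pos _), mul_comm]
      gcongr
      exact ContinuousMap.dist_apply_le_dist (f := y) (g := y') _
    have hUd : ∀ φ ≥ 0, |U y φ - U y' φ| ≤ D * Real.exp (K * φ) := by
      intro φ hφ
      have := abs_sub_le_of_abs_deriv_le (f := fun t => U y t - U y' t)
        (f' := fun t => V y t - V y' t) (B := fun t => D / K * Real.exp (K * t))
        (B' := fun t => D / K * (Real.exp (K * t) * (K * 1))) hφ
        ((hU y).sub (hU y')).continuousOn (fun t _ => (hU' y t).sub (hU' y' t)) (by fun_prop)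
        (fun t _ => (((hasDerivAt_id t).const_mul K).exp).const_mul (D / K))
        (fun t _ => (hVd t).trans_eq (by field_simp))
      have h0 : U y 0 - U y' 0 = 0 := by simp [U]
      have hDK : 0 ≤ D / K := by positivity
      rw [h0, sub_zero] at this
      have h2 : D / K ≤ D := div_le_self hD0 (by linarith)
      have h3 := mul_le_mul_of_nonneg_right h2 (Real.exp_pos (K * φ)).le
      have h4 := Real.exp_pos (K * 0)
      nlinarith
    have hWd := sinAvg_bound (m := 2 * L * D) h₁ hKs hθ (hW y) (hW y') (fun φ hφ => by
      refine (hlip φ ⟨hφ.1.le, hφ.2.le.trans hθ.2⟩ _ _ _ _).trans ?_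
      calc _ ≤ L * (D * Real.exp (K * φ) + D * Real.exp (K * φ)) := by
            gcongr
            · exact hUd φ hφ.1.le
            · exact hVd φ
        _ = _ := by ring) (by positivity)
    change |Real.exp (-(K * θ)) * sinAvg (W y) θ - Real.exp (-(K * θ)) * sinAvg (W y') θ| ≤ _
    rw [← mul_sub, abs_mul, abs_of_pos (Real.exp_pos _)]
    calc _ ≤ Real.exp (-(K * θ)) * (2 * (2 * L * D) / K * Real.exp (K * θ)) := by gcongr
      _ = (4 * L / K) * D * (Real.exp (-(K * θ)) * Real.exp (K * θ)) := by ring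
      _ = (4 * L / K) * D := by rw [← Real.exp_add]; simp
      _ ≤ (1 / 2) * D := by
        refine mul_le_mul_of_nonneg_right ?_ hD0
        rw [div_le_iff₀ hK0]; linarith
      _ = _ := by simp
  obtain ⟨y, hy⟩ : ∃ y, T y = y := ⟨_, hT.fixedPoint_isFixedPt⟩
  have hVy : ∀ θ ∈ Icc 0 θ₁, V y θ = sinAvg (W y) θ := by
    intro θ hθ
    simp only [V]
    rw [IccExtend_of_mem _ _ hθ]
    conv_lhs => rw [← hy]
    change Real.exp (K * θ) * (Real.exp (-(K * θ)) * sinAvg (W y) θ) = _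
    rw [← mul_assoc, ← Real.exp_add]; simp
  refine ⟨U y, V y, ⟨fun θ hθ => ⟨hU' y θ, ?_⟩, (hU y).continuousOn, (hV y).continuousOn,
    by simp [U], ?_⟩⟩
  · have hs := sin_pos_of_mem ⟨hθ.1, hθ.2.trans h₁.2⟩
    have h1 := hasDerivAt_sinAvg (hW y) hs.ne'
    rw [← hVy θ (Ioo_subset_Icc_self hθ)] at h1
    refine h1.congr_of_eventuallyEq ?_
    filter_upwards [Ioo_mem_nhds hθ.1 hθ.2] with t ht using hVy t (Ioo_subset_Icc_self ht)
  · rw [hVy 0 ⟨le_rfl, h₁.1.le⟩]; simp [sinAvg]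

lemma Sol.congr {h h' : ℝ → ℝ → ℝ → ℝ} {b : ℝ} {u v : ℝ → ℝ} (H : Sol h b u v)
    (hh : ∀ θ ∈ Ioo 0 b, h θ (u θ) (v θ) = h' θ (u θ) (v θ)) : Sol h' b u v := fun θ hθ => by
  rw [← hh θ hθ]; exact H θ hθ

lemma RegSol.congr {h h' : ℝ → ℝ → ℝ → ℝ} {b d : ℝ} {u v : ℝ → ℝ} (H : RegSol h b d u v)
    (hh : ∀ θ ∈ Ioo 0 b, h θ (u θ) (v θ) = h' θ (u θ) (v θ)) : RegSol h' b d u v :=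
  ⟨H.sol.congr hh, H.cu, H.cv, H.u0, H.v0⟩

/-- Existence for the singular initial value problem with a globally Lipschitz right-hand side. -/
theorem exists_regSol {h : ℝ → ℝ → ℝ → ℝ}
    (hc : ContinuousOn (fun x : ℝ × ℝ × ℝ => h x.1 x.2.1 x.2.2) (Ico 0 Real.pi ×ˢ univ))
    (hlip : GlobLip h) (d : ℝ) : ∃ u v, RegSol h Real.pi d u v := by
  have key : ∀ θ₁ ∈ Ioo 0 Real.pi, ∃ u v, RegSol h θ₁ d u v := by
    intro θ₁ h₁
    obtain ⟨L, hL, hl⟩ := hlip θ₁ h₁.2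
    -- Freezing θ outside [0, θ₁] turns h into a function that is continuous everywhere.
    have hp : Continuous fun x : ℝ × ℝ × ℝ => (((projIcc 0 θ₁ h₁.1.le x.1 : ℝ), x.2) : ℝ × ℝ × ℝ) :=
      (continuous_subtype_val.comp (continuous_projIcc.comp continuous_fst)).prodMk continuous_snd
    obtain ⟨u, v, H⟩ := exists_regSol_of_continuous
      (h := fun θ u v => h (projIcc 0 θ₁ h₁.1.le θ) u v)
      (hc.comp_continuous hp fun x =>
        ⟨⟨(projIcc 0 θ₁ h₁.1.le x.1).2.1, (projIcc 0 θ₁ h₁.1.le x.1).2.2.trans_lt h₁.2⟩,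
          mem_univ _⟩) h₁ hL
      (fun θ hθ u v u' v' => by rw [projIcc_of_mem _ hθ]; exact hl θ hθ u v u' v') d
    refine ⟨u, v, H.congr fun θ hθ => ?_⟩
    rw [projIcc_of_mem _ (Ioo_subset_Icc_self hθ)]
  choose! u v H using key
  have hpi := Real.pi_pos
  -- Gluing: the value at θ is taken from the solution on [0, (θ + π) / 2). By uniqueness it may be
  -- read off from the solution on any [0, θ₁) that contains θ.
  let m : ℝ → ℝ := fun θ => (θ + Real.pi) / 2
  have hm : ∀ θ ∈ Ico 0 Real.pi, m θ ∈ Ioo 0 Real.pi := fun θ hθ => by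
    constructor <;> simp only [m] <;> linarith [hθ.1, hθ.2]
  have hmθ : ∀ θ ∈ Ico 0 Real.pi, θ < m θ := fun θ hθ => by simp only [m]; linarith [hθ.2]
  have hagree : ∀ θ₁ ∈ Ioo 0 Real.pi, ∀ θ ∈ Ico 0 θ₁,
      u (m θ) θ = u θ₁ θ ∧ v (m θ) θ = v θ₁ θ := by
    intro θ₁ h₁ θ hθ
    have hθ' : θ ∈ Ico 0 Real.pi := ⟨hθ.1, hθ.2.trans h₁.2⟩
    exact RegSol.eq hlip.locLip (b := min (m θ) θ₁) ((min_le_right _ _).trans h₁.2.le)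
      ((H _ (hm θ hθ')).mono (min_le_left _ _)) ((H _ h₁).mono (min_le_right _ _)) θ
      ⟨hθ.1, lt_min (hmθ θ hθ') hθ.2⟩
  have ev : ∀ θ₁ ∈ Ioo 0 Real.pi, ∀ θ ∈ Ico 0 θ₁,
      ContinuousWithinAt (fun θ => u (m θ) θ) (Ico 0 Real.pi) θ ∧
      ContinuousWithinAt (fun θ => v (m θ) θ) (Ico 0 Real.pi) θ := by
    intro θ₁ h₁ θ hθ
    have e : ∀ᶠ t in 𝓝[Ico 0 Real.pi] θ, t ∈ Ico 0 θ₁ := by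
      filter_upwards [self_mem_nhdsWithin, mem_nhdsWithin_of_mem_nhds (Iio_mem_nhds hθ.2)]
        with t ht ht' using ⟨ht.1, ht'⟩
    have hle : 𝓝[Ico 0 Real.pi] θ ≤ 𝓝[Ico 0 θ₁] θ :=
      le_inf inf_le_left (le_principal_iff.2 e)
    constructor
    · rw [ContinuousWithinAt, (hagree θ₁ h₁ θ hθ).1]
      refine (((H θ₁ h₁).cu θ hθ).mono_left hle).congr' ?_
      filter_upwards [e] with t ht using ((hagree θ₁ h₁ t ht).1).symm
    · rw [ContinuousWithinAt, (hagree θ₁ h₁ θ hθ).2]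
      refine (((H θ₁ h₁).cv θ hθ).mono_left hle).congr' ?_
      filter_upwards [e] with t ht using ((hagree θ₁ h₁ t ht).2).symm
  refine ⟨fun θ => u (m θ) θ, fun θ => v (m θ) θ, ?_, fun θ hθ => ?_, fun θ hθ => ?_, ?_, ?_⟩
  · intro θ hθ
    have h₁ := hm θ ⟨hθ.1.le, hθ.2⟩
    have hlt := hmθ θ ⟨hθ.1.le, hθ.2⟩
    obtain ⟨e1, e2⟩ := H (m θ) h₁ |>.sol θ ⟨hθ.1, hlt⟩
    have e : ∀ᶠ t in 𝓝 θ, t ∈ Ico 0 (m θ) := by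
      filter_upwards [Ioo_mem_nhds hθ.1 hlt] with t ht using ⟨ht.1.le, ht.2⟩
    refine ⟨e1.congr_of_eventuallyEq ?_, e2.congr_of_eventuallyEq ?_⟩
    · filter_upwards [e] with t ht using (hagree _ h₁ t ht).1
    · filter_upwards [e] with t ht using (hagree _ h₁ t ht).2
  · exact (ev (m θ) (hm θ hθ) θ ⟨hθ.1, hmθ θ hθ⟩).1
  · exact (ev (m θ) (hm θ hθ) θ ⟨hθ.1, hmθ θ hθ⟩).2
  · exact (H _ (hm 0 ⟨le_rfl, hpi⟩)).u0
  · exact (H _ (hm 0 ⟨le_rfl, hpi⟩)).v0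

/-! ### Regularity of the right-hand side -/

/-- Partial derivative in `u`. -/
def dU (h : ℝ → ℝ → ℝ → ℝ) (θ u p : ℝ) : ℝ := deriv (fun s => h θ s p) u

/-- Partial derivative in `p`. -/
def dP (h : ℝ → ℝ → ℝ → ℝ) (θ u p : ℝ) : ℝ := deriv (fun q => h θ u q) p

/-- The closed slab `[0, π] × ℝ²`. -/
abbrev slab : Set (ℝ × ℝ × ℝ) := Icc 0 Real.pi ×ˢ univ

/-- `C²` regularity on the slab. -/
def C2 (h : ℝ → ℝ → ℝ → ℝ) : Prop :=
  ContDiffOn ℝ 2 (fun x : ℝ × ℝ × ℝ => h x.1 x.2.1 x.2.2) slab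

lemma uniqueDiffOn_slab : UniqueDiffOn ℝ slab :=
  (uniqueDiffOn_Icc Real.pi_pos).prod uniqueDiffOn_univ

lemma C2.hasFDerivWithinAt {h : ℝ → ℝ → ℝ → ℝ} (hh : C2 h) {x : ℝ × ℝ × ℝ} (hx : x ∈ slab) :
    HasFDerivWithinAt (fun x : ℝ × ℝ × ℝ => h x.1 x.2.1 x.2.2)
      (fderivWithin ℝ (fun x : ℝ × ℝ × ℝ => h x.1 x.2.1 x.2.2) slab x) slab x :=
  ((hh.differentiableOn (by norm_num)) x hx).hasFDerivWithinAt

/-- The slab contains whole lines in the u-direction, so the derivative within the slab yields a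
two-sided partial derivative even at θ = 0 and θ = π. -/
lemma C2.hasDerivAt_dU' {h : ℝ → ℝ → ℝ → ℝ} (hh : C2 h) {θ : ℝ} (hθ : θ ∈ Icc 0 Real.pi)
    (u p : ℝ) : HasDerivAt (fun s => h θ s p)
      (fderivWithin ℝ (fun x : ℝ × ℝ × ℝ => h x.1 x.2.1 x.2.2) slab (θ, u, p) (0, 1, 0)) u := by
  have h1 : HasDerivAt (fun s : ℝ => ((θ, s, p) : ℝ × ℝ × ℝ)) (0, 1, 0) u :=
    (hasDerivAt_const u θ).prodMk ((hasDerivAt_id u).prodMk (hasDerivAt_const u p))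
  have := (hh.hasFDerivWithinAt (x := (θ, u, p)) ⟨hθ, mem_univ _⟩).comp_hasDerivWithinAt u
    (h1.hasDerivWithinAt (s := univ)) (fun s _ => (⟨hθ, mem_univ _⟩ : _ ∈ slab))
  exact hasDerivWithinAt_univ.1 this

lemma C2.hasDerivAt_dP' {h : ℝ → ℝ → ℝ → ℝ} (hh : C2 h) {θ : ℝ} (hθ : θ ∈ Icc 0 Real.pi)
    (u p : ℝ) : HasDerivAt (fun q => h θ u q)
      (fderivWithin ℝ (fun x : ℝ × ℝ × ℝ => h x.1 x.2.1 x.2.2) slab (θ, u, p) (0, 0, 1)) p := by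
  have h1 : HasDerivAt (fun q : ℝ => ((θ, u, q) : ℝ × ℝ × ℝ)) (0, 0, 1) p :=
    (hasDerivAt_const p θ).prodMk ((hasDerivAt_const p u).prodMk (hasDerivAt_id p))
  have := (hh.hasFDerivWithinAt (x := (θ, u, p)) ⟨hθ, mem_univ _⟩).comp_hasDerivWithinAt p
    (h1.hasDerivWithinAt (s := univ)) (fun s _ => (⟨hθ, mem_univ _⟩ : _ ∈ slab))
  exact hasDerivWithinAt_univ.1 this

lemma C2.hasDerivAt_dU {h : ℝ → ℝ → ℝ → ℝ} (hh : C2 h) {θ : ℝ} (hθ : θ ∈ Icc 0 Real.pi)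
    (u p : ℝ) : HasDerivAt (fun s => h θ s p) (dU h θ u p) u :=
  (hh.hasDerivAt_dU' hθ u p).differentiableAt.hasDerivAt

lemma C2.hasDerivAt_dP {h : ℝ → ℝ → ℝ → ℝ} (hh : C2 h) {θ : ℝ} (hθ : θ ∈ Icc 0 Real.pi)
    (u p : ℝ) : HasDerivAt (fun q => h θ u q) (dP h θ u p) p :=
  (hh.hasDerivAt_dP' hθ u p).differentiableAt.hasDerivAt

lemma C2.contDiffOn_fderivWithin {h : ℝ → ℝ → ℝ → ℝ} (hh : C2 h) :
    ContDiffOn ℝ 1 (fderivWithin ℝ (fun x : ℝ × ℝ × ℝ => h x.1 x.2.1 x.2.2) slab) slab :=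
  ContDiffOn.fderivWithin hh uniqueDiffOn_slab (by norm_num)

lemma C2.continuousOn {h : ℝ → ℝ → ℝ → ℝ} (hh : C2 h) :
    ContinuousOn (fun x : ℝ × ℝ × ℝ => h x.1 x.2.1 x.2.2) slab := ContDiffOn.continuousOn hh

lemma C2.continuousOn_dU {h : ℝ → ℝ → ℝ → ℝ} (hh : C2 h) :
    ContinuousOn (fun x : ℝ × ℝ × ℝ => dU h x.1 x.2.1 x.2.2) slab := by
  refine (hh.contDiffOn_fderivWithin.continuousOn.clm_apply
    (continuousOn_const (c := ((0, 1, 0) : ℝ × ℝ × ℝ)))).congr ?_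
  rintro ⟨θ, u, p⟩ hx
  exact (hh.hasDerivAt_dU' hx.1 u p).deriv

lemma C2.continuousOn_dP {h : ℝ → ℝ → ℝ → ℝ} (hh : C2 h) :
    ContinuousOn (fun x : ℝ × ℝ × ℝ => dP h x.1 x.2.1 x.2.2) slab := by
  refine (hh.contDiffOn_fderivWithin.continuousOn.clm_apply
    (continuousOn_const (c := ((0, 0, 1) : ℝ × ℝ × ℝ)))).congr ?_
  rintro ⟨θ, u, p⟩ hx
  exact (hh.hasDerivAt_dP' hx.1 u p).deriv

/-- The compact convex box `[0, π] × [-R, R]²`. -/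
abbrev box (R : ℝ) : Set (ℝ × ℝ × ℝ) := Icc 0 Real.pi ×ˢ (Icc (-R) R ×ˢ Icc (-R) R)

lemma isCompact_box (R : ℝ) : IsCompact (box R) :=
  isCompact_Icc.prod (isCompact_Icc.prod isCompact_Icc)

lemma convex_box (R : ℝ) : Convex ℝ (box R) :=
  (convex_Icc _ _).prod ((convex_Icc _ _).prod (convex_Icc _ _))

lemma box_subset_slab (R : ℝ) : box R ⊆ slab := fun _ hx => ⟨hx.1, mem_univ _⟩

lemma exists_lipschitz_box {F : Type*} [NormedAddCommGroup F] [NormedSpace ℝ F]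
    {G : ℝ × ℝ × ℝ → F} (hG : ContDiffOn ℝ 1 G slab) (R : ℝ) :
    ∃ L ≥ 0, ∀ x ∈ box R, ∀ y ∈ box R, ‖G y - G x‖ ≤ L * ‖y - x‖ := by
  obtain ⟨L, hL⟩ := (isCompact_box R).exists_bound_of_continuousOn
    ((hG.continuousOn_fderivWithin uniqueDiffOn_slab le_rfl).mono (box_subset_slab R))
  refine ⟨max L 0, le_max_right _ _, fun x hx y hy => ?_⟩
  exact (convex_box R).norm_image_sub_le_of_norm_hasFDerivWithin_le
    (fun z hz => ((hG.differentiableOn one_ne_zero) z (box_subset_slab R hz)).hasFDerivWithinAt.mono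
      (box_subset_slab R)) (fun z hz => (hL z hz).trans (le_max_left _ _)) hx hy

lemma norm_sub_le_add (θ u v u' v' : ℝ) :
    ‖((θ, u', v') : ℝ × ℝ × ℝ) - (θ, u, v)‖ ≤ |u' - u| + |v' - v| := by
  simp only [Prod.mk_sub_mk, Prod.norm_mk, sub_self, norm_zero, Real.norm_eq_abs]
  have h1 := abs_nonneg (u' - u)
  have h2 := abs_nonneg (v' - v)
  exact max_le (by positivity) (max_le (by linarith) (by linarith))

lemma mem_box {R θ u v : ℝ} (hθ : θ ∈ Icc 0 Real.pi) (hu : |u| ≤ R) (hv : |v| ≤ R) :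
    (θ, u, v) ∈ box R := ⟨hθ, abs_le.1 hu, abs_le.1 hv⟩

/-- Lipschitz bound and second order Taylor estimate on bounded sets. -/
theorem C2.exists_taylor {h : ℝ → ℝ → ℝ → ℝ} (hh : C2 h) (R : ℝ) :
    ∃ L ≥ 0, ∀ θ ∈ Icc 0 Real.pi, ∀ u v u' v' : ℝ, |u| ≤ R → |v| ≤ R → |u'| ≤ R → |v'| ≤ R →
      |h θ u' v' - h θ u v| ≤ L * (|u' - u| + |v' - v|) ∧
      |h θ u' v' - h θ u v - (dU h θ u v * (u' - u) + dP h θ u v * (v' - v))| ≤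
        L * (|u' - u| + |v' - v|) ^ 2 := by
  obtain ⟨L₁, hL₁, h₁⟩ := exists_lipschitz_box (hh.of_le (by norm_num)) R
  obtain ⟨L₂, hL₂, h₂⟩ := exists_lipschitz_box hh.contDiffOn_fderivWithin R
  refine ⟨max L₁ L₂, le_max_of_le_left hL₁, fun θ hθ u v u' v' hu hv hu' hv' => ⟨?_, ?_⟩⟩
  · have := h₁ _ (mem_box hθ hu hv) _ (mem_box hθ hu' hv')
    calc _ ≤ _ := this
      _ ≤ _ := mul_le_mul (le_max_left _ _) (norm_sub_le_add _ _ _ _ _) (norm_nonneg _)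
        (le_max_of_le_left hL₁)
  · set x : ℝ × ℝ × ℝ := (θ, u, v) with hx
    set y : ℝ × ℝ × ℝ := (θ, u', v') with hy
    have hxb : x ∈ box R := mem_box hθ hu hv
    have hyb : y ∈ box R := mem_box hθ hu' hv'
    have hseg : segment ℝ x y ⊆ box R := (convex_box R).segment_subset hxb hyb
    -- On the segment the derivative differs from its value at x by at most L₂ ‖y - x‖; the mean
    -- value inequality for h minus its linear part then produces the square.
    have := (convex_segment x y).norm_image_sub_le_of_norm_hasFDerivWithin_le' (C := L₂ * ‖y - x‖)
      (f := fun x : ℝ × ℝ × ℝ => h x.1 x.2.1 x.2.2)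
      (f' := fderivWithin ℝ (fun x : ℝ × ℝ × ℝ => h x.1 x.2.1 x.2.2) slab)
      (φ := fderivWithin ℝ (fun x : ℝ × ℝ × ℝ => h x.1 x.2.1 x.2.2) slab x)
      (fun z hz => (hh.hasFDerivWithinAt (box_subset_slab R (hseg hz))).mono
        (hseg.trans (box_subset_slab R)))
      (fun z hz => (h₂ _ hxb _ (hseg hz)).trans (by
        gcongr
        obtain ⟨t, ht, rfl⟩ := (segment_eq_image' ℝ x y) ▸ hz
        rw [add_sub_cancel_left, norm_smul, Real.norm_eq_abs, abs_of_nonneg ht.1]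
        exact mul_le_of_le_one_left (norm_nonneg _) ht.2))
      (left_mem_segment ℝ x y) (right_mem_segment ℝ x y)
    have e : y - x = (u' - u) • ((0, 1, 0) : ℝ × ℝ × ℝ) + (v' - v) • ((0, 0, 1) : ℝ × ℝ × ℝ) := by
      simp [hx, hy]
    have e2 : fderivWithin ℝ (fun x : ℝ × ℝ × ℝ => h x.1 x.2.1 x.2.2) slab x (y - x) =
        dU h θ u v * (u' - u) + dP h θ u v * (v' - v) := by
      rw [e, map_add, map_smul, map_smul, dU, dP, (hh.hasDerivAt_dU' hθ u v).deriv,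
        (hh.hasDerivAt_dP' hθ u v).deriv]
      simp only [smul_eq_mul]; ring
    rw [e2] at this
    have h3 := norm_sub_le_add θ u v u' v'
    calc _ ≤ L₂ * ‖y - x‖ * ‖y - x‖ := this
      _ = L₂ * ‖y - x‖ ^ 2 := by ring
      _ ≤ _ := by
        gcongr
        · exact le_max_right _ _

lemma C2.locLip {h : ℝ → ℝ → ℝ → ℝ} (hh : C2 h) : LocLip h := by
  intro θ₁ h₁ R
  obtain ⟨L, hL, H⟩ := hh.exists_taylor R
  exact ⟨L, hL, fun θ hθ u v u' v' a b c d => (H θ ⟨hθ.1, hθ.2.trans h₁.le⟩ u v u' v' a b c d).1⟩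

/-! ### The hypotheses -/

/-- The right-hand side `-f/a` of the equilibrium equation `u'' + cot θ u' = -f/a`. -/
def rhs (a f : ℝ → ℝ → ℝ → ℝ) (θ u p : ℝ) : ℝ := -(f θ u p / a θ u p)

/-- The standing assumptions on the coefficients. -/
structure Hyp (a f : ℝ → ℝ → ℝ → ℝ) : Prop where
  ha : C2 a
  hf : C2 f
  pos : ∃ ε > 0, ∀ θ ∈ Icc 0 Real.pi, ∀ u p, ε ≤ a θ u p
  growth : ∃ κ < (2 : ℝ), ∃ f₁ f₂ : ℝ → ℝ, Continuous f₁ ∧ Continuous f₂ ∧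
    ∀ θ ∈ Icc 0 Real.pi, ∀ u p, |f θ u p| < f₁ u + f₂ u * |p| ^ κ
  global : ∀ x : ℝ × ℝ × ℝ, x.1 ∈ Ioo 0 Real.pi → ∃ g, IsShootOrbit a f g ∧ g 0 = x

lemma Hyp.a_pos {a f : ℝ → ℝ → ℝ → ℝ} (H : Hyp a f) {θ : ℝ} (hθ : θ ∈ Icc 0 Real.pi) (u p : ℝ) :
    0 < a θ u p := let ⟨_, hε, h⟩ := H.pos; hε.trans_le (h θ hθ u p)

lemma Hyp.c2 {a f : ℝ → ℝ → ℝ → ℝ} (H : Hyp a f) : C2 (rhs a f) :=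
  (ContDiffOn.div H.hf H.ha fun x hx => (H.a_pos hx.1 x.2.1 x.2.2).ne').neg

lemma Hyp.rhs_growth {a f : ℝ → ℝ → ℝ → ℝ} (H : Hyp a f) : ∃ κ ∈ Ico (1 : ℝ) 2, ∀ R : ℝ,
    ∃ C ≥ 0, ∀ θ ∈ Icc 0 Real.pi, ∀ u p, |u| ≤ R → |rhs a f θ u p| ≤ C * (1 + |p| ^ κ) := by
  obtain ⟨ε, hε, hpos⟩ := H.pos
  obtain ⟨κ, hκ, f₁, f₂, hf₁, hf₂, hg⟩ := H.growth
  refine ⟨max κ 1, ⟨le_max_right _ _, max_lt hκ (by norm_num)⟩, fun R => ?_⟩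
  obtain ⟨C₁, hC₁, h₁⟩ := exists_abs_le_of_continuousOn (hf₁.continuousOn (s := Icc (-R) R))
  obtain ⟨C₂, hC₂, h₂⟩ := exists_abs_le_of_continuousOn (hf₂.continuousOn (s := Icc (-R) R))
  obtain ⟨C₃, h₃⟩ := (isCompact_box (max R 1)).exists_bound_of_continuousOn
    (H.c2.continuousOn.mono (box_subset_slab _))
  refine ⟨max C₃ ((C₁ + C₂) / ε), le_max_of_le_right (by positivity), fun θ hθ u p hu => ?_⟩
  have hpk : 0 ≤ |p| ^ (max κ 1) := by positivity
  have hC0 : 0 ≤ max C₃ ((C₁ + C₂) / ε) := le_max_of_le_right (by positivity)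
  -- For |p| ≤ 1 the power |p| ^ κ need not be bounded by |p| ^ max κ 1 (it blows up at 0 if κ < 0),
  -- so compactness replaces the growth condition there.
  rcases le_or_gt |p| 1 with hp | hp
  · have := h₃ _ (mem_box hθ (hu.trans (le_max_left R 1)) (hp.trans (le_max_right R 1)))
    simp only [Real.norm_eq_abs] at this
    calc _ ≤ C₃ := this
      _ ≤ max C₃ ((C₁ + C₂) / ε) := le_max_left _ _
      _ ≤ _ := by nlinarith
  · have h4 : |p| ^ κ ≤ |p| ^ (max κ 1) := Real.rpow_le_rpow_of_exponent_le hp.le (le_max_left _ _)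
    have h5 : |f θ u p| ≤ (C₁ + C₂) * (1 + |p| ^ (max κ 1)) := by
      have a1 := le_of_abs_le (h₁ u (abs_le.1 hu))
      have a2 := le_of_abs_le (h₂ u (abs_le.1 hu))
      have a3 : 0 ≤ |p| ^ κ := by positivity
      calc |f θ u p| ≤ f₁ u + f₂ u * |p| ^ κ := (hg θ hθ u p).le
        _ ≤ C₁ + C₂ * |p| ^ (max κ 1) := by
          gcongr
        _ ≤ _ := by nlinarith
    rw [rhs, abs_neg, abs_div, abs_of_pos (H.a_pos hθ u p), div_le_iff₀ (H.a_pos hθ u p)]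
    calc |f θ u p| ≤ (C₁ + C₂) / ε * (1 + |p| ^ (max κ 1)) * ε := by
          rw [div_mul_eq_mul_div, div_mul_cancel₀ _ hε.ne']; exact h5
      _ ≤ _ := by
        gcongr
        · exact le_max_right _ _
        · exact hpos θ hθ u p

/-! ### Orbits of the shooting system as functions of `θ` -/

/-- The solution `2 arctan e^τ` of `θ_τ = sin θ`. -/
def height (τ : ℝ) : ℝ := 2 * Real.arctan (Real.exp τ)

/-- The inverse `ln tan (θ/2)` of `height`. -/
def logTan (θ : ℝ) : ℝ := Real.log (Real.tan (θ / 2))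

lemma height_mem (τ : ℝ) : height τ ∈ Ioo 0 Real.pi := by
  have h1 := Real.arctan_pos.2 (Real.exp_pos τ)
  have h2 := Real.arctan_lt_pi_div_two (Real.exp τ)
  constructor <;> simp only [height] <;> linarith

lemma sin_height (τ : ℝ) : sin (height τ) = 2 * Real.exp τ / (1 + Real.exp τ ^ 2) := by
  have h : 0 < 1 + Real.exp τ ^ 2 := by positivity
  rw [height, Real.sin_two_mul, Real.sin_arctan, Real.cos_arctan]
  field_simp
  rw [Real.sq_sqrt h.le]

lemma hasDerivAt_height (τ : ℝ) : HasDerivAt height (sin (height τ)) τ := by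
  rw [sin_height]
  refine ((Real.hasDerivAt_exp τ).arctan.const_mul 2).congr_deriv ?_
  ring

lemma height_logTan {θ : ℝ} (h : θ ∈ Ioo 0 Real.pi) : height (logTan θ) = θ := by
  have : 0 < Real.tan (θ / 2) :=
    Real.tan_pos_of_pos_of_lt_pi_div_two (by linarith [h.1]) (by linarith [h.2])
  rw [height, logTan, Real.exp_log this, Real.arctan_tan (by linarith [h.1, Real.pi_pos])
    (by linarith [h.2])]
  ring

lemma logTan_height (τ : ℝ) : logTan (height τ) = τ := by
  rw [logTan, height, mul_div_cancel_left₀ _ (two_ne_zero), Real.tan_arctan, Real.log_exp]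

lemma hasDerivAt_logTan {θ : ℝ} (h : θ ∈ Ioo 0 Real.pi) : HasDerivAt logTan (1 / sin θ) θ := by
  have hc : 0 < cos (θ / 2) := Real.cos_pos_of_mem_Ioo
    ⟨by linarith [h.1, Real.pi_pos], by linarith [h.2]⟩
  have hs : 0 < sin (θ / 2) := Real.sin_pos_of_pos_of_lt_pi (by linarith [h.1])
    (by linarith [h.1, h.2])
  have ht : 0 < Real.tan (θ / 2) := by rw [Real.tan_eq_sin_div_cos]; positivity
  have h1 : HasDerivAt (fun θ : ℝ => Real.tan (θ / 2)) (1 / cos (θ / 2) ^ 2 * (1 / 2)) θ :=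
    (Real.hasDerivAt_tan hc.ne').comp (h := fun θ : ℝ => θ / 2) θ ((hasDerivAt_id θ).div_const 2)
  refine (h1.log ht.ne').congr_deriv ?_
  have : sin θ = 2 * sin (θ / 2) * cos (θ / 2) := by rw [← Real.sin_two_mul]; ring_nf
  rw [this, Real.tan_eq_sin_div_cos]
  field_simp

lemma height_tendsto_atTop : Tendsto height atTop (𝓝[<] Real.pi) := by
  refine tendsto_nhdsWithin_iff.2 ⟨?_, Eventually.of_forall fun τ => (height_mem τ).2⟩
  have := ((Real.tendsto_arctan_atTop.mono_right nhdsWithin_le_nhds).comp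
    Real.tendsto_exp_atTop).const_mul 2
  rw [mul_div_cancel₀ _ two_ne_zero] at this
  exact this

lemma logTan_tendsto_zero : Tendsto logTan (𝓝[>] 0) atBot := by
  refine Real.tendsto_log_nhdsGT_zero.comp (tendsto_nhdsWithin_iff.2 ⟨?_, ?_⟩)
  · have : ContinuousAt (fun θ : ℝ => Real.tan (θ / 2)) 0 :=
      ContinuousAt.comp (g := Real.tan) (by simp [Real.continuousAt_tan]) (by fun_prop)
    have := this.tendsto
    simp only [zero_div, Real.tan_zero] at this
    exact this.mono_left nhdsWithin_le_nhds
  · filter_upwards [Ioo_mem_nhdsGT Real.pi_pos] with θ h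
    exact Real.tan_pos_of_pos_of_lt_pi_div_two (by linarith [h.1]) (by linarith [h.2])

/-- The curve in phase space given by a profile `u` and its derivative `v`. -/
def orb (u v : ℝ → ℝ) (τ : ℝ) : ℝ × ℝ × ℝ :=
  (height τ, u (height τ), sin (height τ) * v (height τ))

/-- The equation for θ decouples from the others and the sine is Lipschitz, so one value determines
the height for all times. -/
lemma orbit_height {a f : ℝ → ℝ → ℝ → ℝ} {g : ℝ → ℝ × ℝ × ℝ} (hg : IsShootOrbit a f g)
    {y : ℝ → ℝ} (hy : ∀ τ, HasDerivAt y (sin (y τ)) τ) {τ₀ : ℝ} (h : (g τ₀).1 = y τ₀) :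
    ∀ τ, (g τ).1 = y τ := by
  have key := ODE_solution_unique_univ (E := ℝ) (K := 1) (s := fun _ => univ) (v := fun _ => sin)
    (f := fun τ => (g τ).1) (g := y) (t₀ := τ₀) (fun _ =>
      (LipschitzWith.of_dist_le_mul fun x y => by
        simpa [Real.dist_eq] using Real.abs_sin_sub_sin_le x y).lipschitzOnWith)
    (fun τ => ⟨(hg τ).2.fst, mem_univ _⟩) (fun τ => ⟨hy τ, mem_univ _⟩) h
  exact fun τ => congrFun key τ

lemma orbit_cases {a f : ℝ → ℝ → ℝ → ℝ} {g : ℝ → ℝ × ℝ × ℝ} (hg : IsShootOrbit a f g) :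
    (∀ τ, (g τ).1 = 0) ∨ (∀ τ, (g τ).1 = Real.pi) ∨ ∃ c, ∀ τ, (g τ).1 = height (τ + c) := by
  rcases (hg 0).1.1.eq_or_lt with h0 | h0
  · exact Or.inl (orbit_height hg (y := fun _ => 0)
      (fun τ => by simpa using hasDerivAt_const τ (0:ℝ))
      h0.symm)
  rcases (hg 0).1.2.eq_or_lt with h1 | h1
  · exact Or.inr (Or.inl (orbit_height hg (y := fun _ => Real.pi)
      (fun τ => by simpa using hasDerivAt_const τ Real.pi) h1))
  refine Or.inr (Or.inr ⟨logTan (g 0).1, orbit_height hg (τ₀ := 0)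
    (fun τ => (hasDerivAt_height _).comp_add_const τ _) ?_⟩)
  rw [zero_add, height_logTan ⟨h0, h1⟩]

/-- Away from the poles θ_τ = sin θ > 0, so θ serves as the independent variable: substitute τ =
`logTan θ - c` and put v = p / sin θ. -/
lemma orbit_eq_orb {a f : ℝ → ℝ → ℝ → ℝ} {g : ℝ → ℝ × ℝ × ℝ} (hg : IsShootOrbit a f g) {c : ℝ}
    (h : ∀ τ, (g τ).1 = height (τ + c)) :
    ∃ u v, Sol (rhs a f) Real.pi u v ∧ ∀ τ, g τ = orb u v (τ + c) := by
  refine ⟨fun θ => (g (logTan θ - c)).2.1, fun θ => (g (logTan θ - c)).2.2 / sin θ,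
    fun θ hθ => ?_, fun τ => ?_⟩
  · have hs := sin_pos_of_mem hθ
    have h1 : HasDerivAt (fun θ => logTan θ - c) (1 / sin θ) θ := (hasDerivAt_logTan hθ).sub_const c
    have h2 := (hg (logTan θ - c)).2
    have h3 : (g (logTan θ - c)).1 = θ := by rw [h, sub_add_cancel, height_logTan hθ]
    have h4' : HasDerivAt (fun τ => (g τ).2.1) _ (logTan θ - c) := h2.snd.fst
    have h5' : HasDerivAt (fun τ => (g τ).2.2) _ (logTan θ - c) := h2.snd.snd
    have h4 := h4'.comp θ h1
    have h5 := h5'.comp θ h1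
    constructor
    · refine h4.congr_deriv ?_
      simp only [shootField]; ring
    · refine (h5.div (Real.hasDerivAt_sin θ) hs.ne').congr_deriv ?_
      simp only [shootField, h3, rhs, Function.comp_def]
      field_simp
  · have hs := sin_pos_of_mem (height_mem (τ + c))
    simp only [orb, logTan_height, add_sub_cancel_right]
    rw [mul_div_cancel₀ _ hs.ne', ← h τ]

lemma isShootOrbit_orb {a f : ℝ → ℝ → ℝ → ℝ} {u v : ℝ → ℝ} (H : Sol (rhs a f) Real.pi u v) :
    IsShootOrbit a f (orb u v) := by
  intro τ
  have hm := height_mem τ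
  have hs := sin_pos_of_mem hm
  refine ⟨Ioo_subset_Icc_self hm, ?_⟩
  have h1 := hasDerivAt_height τ
  have h2 := (H _ hm).1.comp τ h1
  have h3 := (hasDerivAt_sin_mul hs.ne' (H _ hm).2).comp τ h1
  refine (h1.prodMk (h2.prodMk h3)).congr_deriv ?_
  simp only [shootField, orb, rhs, mul_div_cancel_left₀ _ hs.ne']
  ext <;> simp only <;> ring

/-! ### Regularity at the pole -/

lemma half_le_sin {θ : ℝ} (h0 : 0 ≤ θ) (h1 : θ ≤ 1) : θ / 2 ≤ sin θ := by
  have hpi := Real.pi_gt_three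
  have h := Real.mul_le_sin h0 (by linarith)
  have : 1 / 2 ≤ 2 / Real.pi := by
    rw [div_le_div_iff₀ (by norm_num) Real.pi_pos]; linarith [Real.pi_lt_four]
  nlinarith

/-- The critical term is sin θ |v|^κ = |P|^κ (sin θ)^(1-κ). Since |P| ≤ 1 and κ ≥ 1, |P|^κ ≤ |P|. So
the bound is linear in P with a coefficient of order θ^(1-κ), which is integrable at 0 because κ <
2. -/
lemma sin_mul_bound {κ C P s : ℝ} (hκ : κ ∈ Ico (1 : ℝ) 2) (hC : 0 ≤ C) {θ h v : ℝ}
    (h0 : 0 < θ) (h1 : θ ≤ 1) (hs : s = sin θ) (hP : P = s * v) (hP1 : |P| ≤ 1)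
    (hh : |h| ≤ C * (1 + |v| ^ κ)) : |s * h| ≤ C * θ + 2 * C * θ ^ (1 - κ) * |P| := by
  have hs1 : θ / 2 ≤ s := hs ▸ half_le_sin h0.le h1
  have hs2 : s ≤ θ := hs ▸ Real.sin_le h0.le
  have hs0 : 0 < s := by linarith
  have hv : |v| = |P| / s := by rw [hP, abs_mul, abs_of_pos hs0]; field_simp
  have e1 : s * |v| ^ κ ≤ 2 * θ ^ (1 - κ) * |P| := by
    rw [hv, Real.div_rpow (abs_nonneg _) hs0.le]
    have : s * (|P| ^ κ / s ^ κ) = |P| ^ κ * s ^ (1 - κ) := by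
      rw [Real.rpow_sub hs0, Real.rpow_one]; field_simp
    rw [this]
    have e2 : |P| ^ κ ≤ |P| := by
      have := Real.rpow_le_rpow_of_exponent_ge' (abs_nonneg P) hP1 zero_le_one hκ.1
      rwa [Real.rpow_one] at this
    have e3 : s ^ (1 - κ) ≤ 2 * θ ^ (1 - κ) := by
      calc s ^ (1 - κ) ≤ (θ / 2) ^ (1 - κ) :=
            Real.rpow_le_rpow_of_nonpos (by linarith) hs1 (by linarith [hκ.1])
        _ = 2 ^ (κ - 1) * θ ^ (1 - κ) := by
            rw [Real.div_rpow h0.le zero_le_two, div_eq_mul_inv, ← Real.rpow_neg zero_le_two,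
              neg_sub, mul_comm]
        _ ≤ 2 * θ ^ (1 - κ) := by
            gcongr
            have : (2:ℝ) ^ (κ - 1) ≤ 2 ^ (1:ℝ) :=
              Real.rpow_le_rpow_of_exponent_le one_le_two (by linarith [hκ.2])
            simpa using this
    calc _ ≤ |P| * (2 * θ ^ (1 - κ)) := by gcongr
      _ = _ := by ring
  rw [abs_mul, abs_of_pos hs0]
  calc s * |h| ≤ s * (C * (1 + |v| ^ κ)) := by gcongr
    _ = C * s + C * (s * |v| ^ κ) := by ring
    _ ≤ C * θ + C * (2 * θ ^ (1 - κ) * |P|) := by gcongr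
    _ = _ := by ring

/-- Subquadratic growth forces `u_θ → 0` at the pole as soon as `u` converges and
`sin θ u_θ → 0`. -/
theorem Sol.tendsto_zero {a f : ℝ → ℝ → ℝ → ℝ} (H : Hyp a f) {u v : ℝ → ℝ} {d b : ℝ} (hb0 : 0 < b)
    (hs : Sol (rhs a f) b u v) (hu : Tendsto u (𝓝[>] 0) (𝓝 d))
    (hv : Tendsto (fun θ => sin θ * v θ) (𝓝[>] 0) (𝓝 0)) : Tendsto v (𝓝[>] 0) (𝓝 0) := by
  obtain ⟨κ, hκ, hg⟩ := H.rhs_growth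
  obtain ⟨C, hC, hgr⟩ := hg (|d| + 1)
  have e1 : ∀ᶠ θ in 𝓝[>] 0, |u θ| ≤ |d| + 1 :=
    (hu.abs.eventually (gt_mem_nhds (by linarith))).mono fun θ h => h.le
  have e2 : ∀ᶠ θ in 𝓝[>] 0, |sin θ * v θ| ≤ 1 := by
    have := hv.abs
    rw [abs_zero] at this
    exact (this.eventually (gt_mem_nhds one_pos)).mono fun θ h => h.le
  obtain ⟨s₀, hs₀, hs₀'⟩ := (mem_nhdsGT_iff_exists_Ioo_subset).1 (e1.and e2)
  have hs₀ : 0 < s₀ := hs₀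
  set s₁ := min s₀ (min 1 b) with hs₁
  have hs1 : 0 < s₁ := lt_min hs₀ (lt_min one_pos hb0)
  have hκ2 : 0 < 2 - κ := by linarith [hκ.2]
  -- A primitive of the Gronwall coefficient 2 C θ^(1-κ), bounded near 0 because κ < 2.
  set G : ℝ → ℝ := fun θ => 2 * C * (θ ^ (2 - κ) / (2 - κ)) with hG
  have hG' : ∀ θ > 0, HasDerivAt G (2 * C * θ ^ (1 - κ)) θ := by
    intro θ hθ
    refine (((Real.hasDerivAt_rpow_const (p := 2 - κ) (Or.inl hθ.ne')).div_const (2 - κ)).const_mul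
      (2 * C)).congr_deriv ?_
    rw [mul_div_cancel_left₀ _ hκ2.ne']
    ring_nf
  have hG0 : ∀ θ > 0, 0 ≤ G θ := fun θ hθ => by simp only [hG]; positivity
  set P : ℝ → ℝ := fun θ => sin θ * v θ with hP
  have hpi := Real.pi_gt_three
  -- Gronwall for P = sin θ · v on [s, θ]; writing C + 1 instead of C makes the comparison strict.
  have key : ∀ s θ, 0 < s → s < θ → θ < s₁ →
      |P θ| ≤ (|P s| + (C + 1) * (θ ^ 2 / 2)) * Real.exp (G θ) := by
    intro s θ hs0 hsθ hθ
    have hI : ∀ t ∈ Icc s θ, 0 < t ∧ t < s₀ ∧ t ≤ 1 ∧ t < b := fun t ht =>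
      ⟨hs0.trans_le ht.1, (ht.2.trans_lt hθ).trans_le (min_le_left _ _),
        (ht.2.trans hθ.le).trans ((min_le_right _ _).trans (min_le_left _ _)),
        (ht.2.trans_lt hθ).trans_le ((min_le_right _ _).trans (min_le_right _ _))⟩
    have hPd : ∀ t ∈ Icc s θ, HasDerivAt P (sin t * rhs a f t (u t) (v t)) t := fun t ht =>
      hasDerivAt_sin_mul (sin_pos_of_mem ⟨(hI t ht).1, by linarith [(hI t ht).2.2.1]⟩).ne'
        (hs t ⟨(hI t ht).1, (hI t ht).2.2.2⟩).2
    have hBd : ∀ t ∈ Icc s θ, HasDerivAt (fun t => (|P s| + (C + 1) * (t ^ 2 / 2)) * Real.exp (G t))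
        ((C + 1) * t * Real.exp (G t) +
          (|P s| + (C + 1) * (t ^ 2 / 2)) * (Real.exp (G t) * (2 * C * t ^ (1 - κ)))) t := by
      intro t ht
      have h1 : HasDerivAt (fun t : ℝ => |P s| + (C + 1) * (t ^ 2 / 2)) ((C + 1) * t) t := by
        refine ((((hasDerivAt_id t).pow 2).div_const 2).const_mul (C + 1)).const_add (|P s|)
          |>.congr_deriv ?_
        simp
      exact h1.mul (hG' t (hI t ht).1).exp
    refine image_norm_le_of_norm_deriv_right_lt_deriv_boundary' (E := ℝ) (f := P)
      (fun t ht => (hPd t ht).continuousAt.continuousWithinAt)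
      (fun t ht => (hPd t (Ico_subset_Icc_self ht)).hasDerivWithinAt) ?_
      (fun t ht => (hBd t ht).continuousAt.continuousWithinAt)
      (fun t ht => (hBd t (Ico_subset_Icc_self ht)).hasDerivWithinAt) ?_ (right_mem_Icc.2 hsθ.le)
    · have h1 : 1 ≤ Real.exp (G s) := Real.one_le_exp (hG0 s hs0)
      have h2 : 0 ≤ (C + 1) * (s ^ 2 / 2) := by positivity
      have h3 := abs_nonneg (P s)
      simp only [Real.norm_eq_abs]
      nlinarith
    · intro t ht hPB
      obtain ⟨h0, hts, h1, h4⟩ := hI t (Ico_subset_Icc_self ht)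
      obtain ⟨q1, q2⟩ := hs₀' ⟨h0, hts⟩
      simp only [Real.norm_eq_abs] at hPB ⊢
      have := sin_mul_bound (P := P t) hκ hC h0 h1 rfl rfl q2
        (hgr t ⟨h0.le, by linarith⟩ (u t) (v t) q1)
      rw [hPB] at this
      refine this.trans_lt ?_
      have h5 : 1 ≤ Real.exp (G t) := Real.one_le_exp (hG0 t h0)
      have h6 : C * t < (C + 1) * t * Real.exp (G t) := by
        calc C * t < (C + 1) * t := by nlinarith
          _ ≤ _ := le_mul_of_one_le_right (by positivity) h5
      linarith
  -- Letting s → 0 removes |P s|. Hence P = O(θ²), and division by sin θ ≥ θ / 2 gives v = O(θ).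
  have key2 : ∀ θ, 0 < θ → θ < s₁ → |P θ| ≤ ((C + 1) * (θ ^ 2 / 2)) * Real.exp (G 1) := by
    intro θ h0 h1
    have hθ1 : θ ≤ 1 := h1.le.trans ((min_le_right _ _).trans (min_le_left _ _))
    have h2 : |P θ| ≤ (|0| + (C + 1) * (θ ^ 2 / 2)) * Real.exp (G θ) := by
      refine ge_of_tendsto (((hv.abs).add_const _).mul_const _) ?_
      filter_upwards [Ioo_mem_nhdsGT h0] with s hs using key s θ hs.1 hs.2 h1
    rw [abs_zero, zero_add] at h2
    refine h2.trans ?_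
    gcongr
    simp only [hG]
    gcongr
  have key3 : ∀ θ, 0 < θ → θ < s₁ → |v θ| ≤ ((C + 1) * Real.exp (G 1)) * θ := by
    intro θ h0 h1
    have hθ1 : θ ≤ 1 := h1.le.trans ((min_le_right _ _).trans (min_le_left _ _))
    have h2 := half_le_sin h0.le hθ1
    have h3 := key2 θ h0 h1
    simp only [hP] at h3
    rw [abs_mul, abs_of_pos (by linarith)] at h3
    have h4 : θ / 2 * |v θ| ≤ θ / 2 * (((C + 1) * Real.exp (G 1)) * θ) := by
      calc _ ≤ sin θ * |v θ| := by gcongr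
        _ ≤ _ := h3
        _ = _ := by ring
    exact le_of_mul_le_mul_left h4 (by linarith)
  refine squeeze_zero_norm' (a := fun θ => ((C + 1) * Real.exp (G 1)) * θ) ?_ ?_
  · filter_upwards [Ioo_mem_nhdsGT hs1] with θ hθ using key3 θ hθ.1 hθ.2
  · have : Tendsto (fun θ : ℝ => ((C + 1) * Real.exp (G 1)) * θ) (𝓝 0)
        (𝓝 (((C + 1) * Real.exp (G 1)) * 0)) :=
      tendsto_id.const_mul _
    rw [mul_zero] at this
    exact this.mono_left nhdsWithin_le_nhds

lemma update_zero_eventuallyEq {θ : ℝ} (h : θ ≠ 0) (u : ℝ → ℝ) (d : ℝ) :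
    Function.update u 0 d =ᶠ[𝓝 θ] u := by
  filter_upwards [isOpen_ne.mem_nhds h] with t ht using Function.update_of_ne ht _ _

lemma continuousOn_update_zero {u : ℝ → ℝ} {b d : ℝ} (hc : ContinuousOn u (Ioo 0 b))
    (hu : Tendsto u (𝓝[>] 0) (𝓝 d)) : ContinuousOn (Function.update u 0 d) (Ico 0 b) := by
  intro θ hθ
  rcases hθ.1.eq_or_lt with h0 | h0
  · rw [← h0, continuousWithinAt_update_same]
    refine hu.mono_left (nhdsWithin_mono _ ?_)
    rintro t ⟨ht, ht0⟩
    exact lt_of_le_of_ne ht.1 (Ne.symm ht0)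
  · apply ContinuousAt.continuousWithinAt
    exact ((hc.continuousAt (Ioo_mem_nhds h0 hθ.2))).congr
      ((update_zero_eventuallyEq h0.ne' u d).symm)

/-- `Sol` leaves the values at θ = 0 undetermined, so they may be overwritten by the limits. -/
lemma RegSol.of_tendsto {h : ℝ → ℝ → ℝ → ℝ} {b d : ℝ} {u v : ℝ → ℝ} (hs : Sol h b u v)
    (hu : Tendsto u (𝓝[>] 0) (𝓝 d)) (hv : Tendsto v (𝓝[>] 0) (𝓝 0)) :
    RegSol h b d (Function.update u 0 d) (Function.update v 0 0) := by
  refine ⟨fun θ hθ => ?_, continuousOn_update_zero hs.continuousOn.1 hu,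
    continuousOn_update_zero hs.continuousOn.2 hv, by simp, by simp⟩
  rw [Function.update_of_ne hθ.1.ne', Function.update_of_ne hθ.1.ne']
  exact ⟨(hs θ hθ).1.congr_of_eventuallyEq (update_zero_eventuallyEq hθ.1.ne' u d),
    (hs θ hθ).2.congr_of_eventuallyEq (update_zero_eventuallyEq hθ.1.ne' v 0)⟩

lemma orb_update (u v : ℝ → ℝ) (x y : ℝ) :
    orb (Function.update u 0 x) (Function.update v 0 y) = orb u v := by
  funext τ
  simp [orb, Function.update_of_ne (height_mem τ).1.ne']

/-! ### The strong unstable manifolds -/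

lemma abs_max_min_sub_le (R x y : ℝ) : |max (-R) (min R x) - max (-R) (min R y)| ≤ |x - y| := by
  grind

lemma clamp_mem {R : ℝ} (hR : 0 ≤ R) (x : ℝ) : |max (-R) (min R x)| ≤ R :=
  abs_le.2 ⟨le_max_left _ _, max_le (by linarith) (min_le_left _ _)⟩

lemma clamp_eq {R x : ℝ} (hx : |x| ≤ R) : max (-R) (min R x) = x := by
  rw [min_eq_right (abs_le.1 hx).2, max_eq_right (abs_le.1 hx).1]

/-- Every height-zero value is taken by a regular solution. -/
theorem Hyp.exists_regSol {a f : ℝ → ℝ → ℝ → ℝ} (H : Hyp a f) (d : ℝ) :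
    ∃ u v, RegSol (rhs a f) Real.pi d u v := by
  have hpi := Real.pi_pos
  -- Clamping u and v to [-R, R] makes the right-hand side globally Lipschitz. Near the pole the
  -- clamped solution stays within these bounds and solves the original equation.
  set R := |d| + 1 with hR
  have hR0 : 0 ≤ R := by positivity
  obtain ⟨L, hL, hlip⟩ := H.c2.exists_taylor R
  obtain ⟨u, v, hs⟩ := AxisymShooting.exists_regSol
    (h := fun θ x y => rhs a f θ (max (-R) (min R x)) (max (-R) (min R y)))
    (by
      refine H.c2.continuousOn.comp (f := fun x : ℝ × ℝ × ℝ =>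
        (x.1, max (-R) (min R x.2.1), max (-R) (min R x.2.2)))
        (by fun_prop) fun x hx => ?_
      exact ⟨⟨hx.1.1, hx.1.2.le⟩, mem_univ _⟩)
    (fun θ₁ h₁ => ⟨L, hL, fun θ hθ x y x' y' => by
      refine (hlip θ ⟨hθ.1, hθ.2.trans h₁.le⟩ _ _ _ _ (clamp_mem hR0 _) (clamp_mem hR0 _)
        (clamp_mem hR0 _) (clamp_mem hR0 _)).1.trans ?_
      exact mul_le_mul_of_nonneg_left
        (add_le_add (abs_max_min_sub_le _ _ _) (abs_max_min_sub_le _ _ _)) hL⟩) d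
  have h0 : (0:ℝ) ∈ Ico 0 Real.pi := ⟨le_rfl, hpi⟩
  have hm : 𝓝[>] (0:ℝ) ≤ 𝓝[Ico 0 Real.pi] 0 := by
    rw [← nhdsWithin_Ioo_eq_nhdsGT hpi]; exact nhdsWithin_mono _ Ioo_subset_Ico_self
  have tu : Tendsto u (𝓝[>] 0) (𝓝 d) := by
    have := (hs.cu 0 h0).mono_left hm
    rwa [hs.u0] at this
  have tv : Tendsto v (𝓝[>] 0) (𝓝 0) := by
    have := (hs.cv 0 h0).mono_left hm
    rwa [hs.v0] at this
  have e1 : ∀ᶠ θ in 𝓝[>] 0, |u θ| ≤ R :=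
    (tu.abs.eventually (gt_mem_nhds (by linarith))).mono fun θ h => le_of_lt h
  have e2 : ∀ᶠ θ in 𝓝[>] 0, |v θ| ≤ R := by
    have := tv.abs
    rw [abs_zero] at this
    exact (this.eventually (gt_mem_nhds (by positivity))).mono fun θ h => le_of_lt h
  obtain ⟨s, hs0, hs'⟩ := mem_nhdsGT_iff_exists_Ioo_subset.1 (e1.and e2)
  have hs0 : 0 < s := hs0
  set b := min s Real.pi with hb
  have hb0 : 0 < b := lt_min hs0 hpi
  have hsol : Sol (rhs a f) b u v := (hs.sol.mono (min_le_right _ _)).congr fun θ hθ => by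
    obtain ⟨q1, q2⟩ := hs' ⟨hθ.1, hθ.2.trans_le (min_le_left _ _)⟩
    rw [clamp_eq q1, clamp_eq q2]
  set θ₀ := b / 2 with hθ₀
  have hm0 : θ₀ ∈ Ioo 0 b := ⟨by positivity, by linarith⟩
  have hm1 : θ₀ ∈ Ioo 0 Real.pi := ⟨hm0.1, hm0.2.trans_le (min_le_right _ _)⟩
  -- The local solution is prolonged to all of (0, π) by the complete orbit through one of its
  -- points; both agree near the pole by uniqueness.
  obtain ⟨g, hg, hg0⟩ := H.global (θ₀, u θ₀, sin θ₀ * v θ₀) hm1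
  have hsn := sin_pos_of_mem hm1
  obtain ⟨c, hc⟩ : ∃ c, ∀ τ, (g τ).1 = height (τ + c) := by
    rcases orbit_cases hg with h | h | h
    · have := h 0; rw [hg0] at this; exact absurd this hm1.1.ne'
    · have := h 0; rw [hg0] at this; exact absurd this hm1.2.ne
    · exact h
  obtain ⟨u', v', hs2, hgo⟩ := orbit_eq_orb hg hc
  have h2 := hgo 0
  have h3 := hc 0
  rw [hg0] at h2 h3
  simp only [orb, ← h3, Prod.mk.injEq, true_and] at h2
  have heq := Sol.eq H.c2.locLip (b := b) (min_le_right _ _) hsol (hs2.mono (min_le_right _ _)) hm0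
    h2.1 (mul_left_cancel₀ hsn.ne' h2.2)
  refine ⟨_, _, RegSol.of_tendsto hs2 (tu.congr' ?_) (tv.congr' ?_)⟩
  · filter_upwards [Ioo_mem_nhdsGT hb0] with θ hθ using (heq θ hθ).1
  · filter_upwards [Ioo_mem_nhdsGT hb0] with θ hθ using (heq θ hθ).2

lemma height_le (τ : ℝ) : height τ ≤ 2 * Real.exp τ := by
  have h := Real.exp_pos τ
  have : Real.arctan (Real.exp τ) < Real.exp τ := by
    have := Real.lt_tan (Real.arctan_pos.2 h) (Real.arctan_lt_pi_div_two _)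
    rwa [Real.tan_arctan] at this
  simp only [height]; linarith

/-- The rate is 1 because u - d and sin θ · v are O(θ) at the pole and `height τ` ≤ 2 exp τ. -/
lemma RegSol.exp_bound {h : ℝ → ℝ → ℝ → ℝ} {d : ℝ} {u v : ℝ → ℝ} (hs : RegSol h Real.pi d u v) :
    ∃ C : ℝ, ∀ τ ≤ 0, ‖orb u v τ - (0, d, 0)‖ ≤ C * Real.exp (1 * τ) := by
  have hpi := Real.pi_gt_three
  have hsub : Icc (0:ℝ) 2 ⊆ Ico 0 Real.pi := fun t ht => ⟨ht.1, by linarith [ht.2]⟩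
  obtain ⟨C, hC, hv⟩ := exists_abs_le_of_continuousOn (hs.cv.mono hsub)
  refine ⟨2 * (C + 1), fun τ hτ => ?_⟩
  have hm := height_mem τ
  have hle := height_le τ
  have h2 : height τ ≤ 2 := hle.trans (by have := Real.exp_le_one_iff.2 hτ; linarith)
  have hu : |u (height τ) - u 0| ≤ C * height τ - C * 0 := by
    refine abs_sub_le_of_abs_deriv_le (f := u) (f' := v) (B := fun t => C * t)
      (B' := fun _ => C * 1) hm.1.le (hs.cu.mono ((Icc_subset_Icc_right h2).trans hsub))
      (fun t ht => (hs.sol t ⟨ht.1, ht.2.trans hm.2⟩).1) (by fun_prop)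
      (fun t _ => (hasDerivAt_id t).const_mul C) fun t ht => ?_
    rw [mul_one]
    exact hv t ⟨ht.1.le, ht.2.le.trans h2⟩
  rw [hs.u0] at hu
  have hsin : |sin (height τ)| ≤ height τ := by
    rw [abs_of_pos (sin_pos_of_mem hm)]; exact Real.sin_le hm.1.le
  have hvv : |sin (height τ) * v (height τ)| ≤ height τ * C := by
    rw [abs_mul]
    exact mul_le_mul hsin (hv _ ⟨hm.1.le, h2⟩) (abs_nonneg _) hm.1.le
  simp only [orb, Prod.mk_sub_mk, Prod.norm_mk, Real.norm_eq_abs, sub_zero, one_mul,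
    abs_of_pos hm.1]
  have hC1 : height τ * C ≤ 2 * Real.exp τ * C := by gcongr
  have := Real.exp_pos τ
  refine max_le (by nlinarith) (max_le (by nlinarith) (by nlinarith))

lemma tendsto_of_exp_bound {E : Type*} [NormedAddCommGroup E] {g : ℝ → E} {x : E} {r C : ℝ}
    (hr : 0 < r) (h : ∀ τ ≤ 0, ‖g τ - x‖ ≤ C * Real.exp (r * τ)) : Tendsto g atBot (𝓝 x) := by
  rw [tendsto_iff_norm_sub_tendsto_zero]
  refine squeeze_zero' (Eventually.of_forall fun _ => norm_nonneg _)
    ((eventually_le_atBot 0).mono h) ?_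
  have := (Real.tendsto_exp_atBot.comp (tendsto_id.const_mul_atBot hr)).const_mul C
  rwa [mul_zero] at this

/-- Orbits that converge to `(0, d, 0)` backwards are constant or come from regular solutions. -/
theorem orbit_of_tendsto {a f : ℝ → ℝ → ℝ → ℝ} (H : Hyp a f) {g : ℝ → ℝ × ℝ × ℝ}
    (hg : IsShootOrbit a f g) {d : ℝ} (ht : Tendsto g atBot (𝓝 (0, d, 0))) :
    (∀ τ, g τ = (0, d, 0)) ∨
      ∃ u v c, RegSol (rhs a f) Real.pi d u v ∧ ∀ τ, g τ = orb u v (τ + c) := by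
  have ht1 : Tendsto (fun τ => (g τ).1) atBot (𝓝 0) := (continuous_fst.tendsto _).comp ht
  have ht2 : Tendsto (fun τ => (g τ).2.1) atBot (𝓝 d) :=
    ((continuous_fst.comp continuous_snd).tendsto _).comp ht
  have ht3 : Tendsto (fun τ => (g τ).2.2) atBot (𝓝 0) :=
    ((continuous_snd.comp continuous_snd).tendsto _).comp ht
  rcases orbit_cases hg with h | h | ⟨c, hc⟩
  -- For θ = 0 the field is (0, p, 0): p is constant, hence equal to its limit 0, and then u is
  -- constant too.
  · left
    have h3' : ∀ τ, HasDerivAt (fun τ => (g τ).2.2) 0 τ := fun τ => by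
      have : HasDerivAt (fun τ => (g τ).2.2) (shootField a f (g τ)).2.2 τ := (hg τ).2.snd.snd
      simpa [shootField, h τ] using this
    have h3 : ∀ τ, (g τ).2.2 = 0 := fun τ => by
      have := is_const_of_deriv_eq_zero (fun t => (h3' t).differentiableAt) fun t => (h3' t).deriv
      exact tendsto_nhds_unique (tendsto_const_nhds.congr fun t => this τ t) ht3
    have h2' : ∀ τ, HasDerivAt (fun τ => (g τ).2.1) 0 τ := fun τ => by
      have : HasDerivAt (fun τ => (g τ).2.1) (shootField a f (g τ)).2.1 τ := (hg τ).2.snd.fst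
      simpa [shootField, h3 τ] using this
    have h2 : ∀ τ, (g τ).2.1 = d := fun τ => by
      have := is_const_of_deriv_eq_zero (fun t => (h2' t).differentiableAt) fun t => (h2' t).deriv
      exact tendsto_nhds_unique (tendsto_const_nhds.congr fun t => this τ t) ht2
    intro τ
    ext <;> simp [h τ, h2 τ, h3 τ]
  · have : Tendsto (fun τ => (g τ).1) atBot (𝓝 Real.pi) := by simp [h]
    exact absurd (tendsto_nhds_unique ht1 this) Real.pi_ne_zero.symm
  · right
    obtain ⟨u, v, hs, ho⟩ := orbit_eq_orb hg hc
    have hl : Tendsto (fun θ => logTan θ - c) (𝓝[>] 0) atBot :=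
      tendsto_atBot_add_const_right _ _ logTan_tendsto_zero
    have he : ∀ θ ∈ Ioo 0 Real.pi, g (logTan θ - c) = (θ, u θ, sin θ * v θ) := fun θ hθ => by
      rw [ho, sub_add_cancel, orb, height_logTan hθ]
    have hu : Tendsto u (𝓝[>] 0) (𝓝 d) := by
      refine (ht2.comp hl).congr' ?_
      filter_upwards [Ioo_mem_nhdsGT Real.pi_pos] with θ hθ
      simp [he θ hθ]
    have hv : Tendsto (fun θ => sin θ * v θ) (𝓝[>] 0) (𝓝 0) := by
      refine (ht3.comp hl).congr' ?_
      filter_upwards [Ioo_mem_nhdsGT Real.pi_pos] with θ hθ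
      simp [he θ hθ]
    -- Subquadratic growth enters here, through `Sol.tendsto_zero`, and nowhere else.
    refine ⟨_, _, c, RegSol.of_tendsto hs hu (hs.tendsto_zero H Real.pi_pos hu hv), fun τ => ?_⟩
    rw [orb_update]; exact ho τ

lemma orb_tendsto_fst_atTop (u v : ℝ → ℝ) (c : ℝ) :
    Tendsto (fun τ => (orb u v (τ + c)).1) atTop (𝓝 Real.pi) :=
  (height_tendsto_atTop.mono_right nhdsWithin_le_nhds).comp
    (tendsto_atTop_add_const_right _ c tendsto_id)

/-- The strong unstable manifold of `(0, d, 0)` at heights `θ ∈ (0, π)`. -/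
theorem mem_Wu_iff {a f : ℝ → ℝ → ℝ → ℝ} (H : Hyp a f) {θ d : ℝ} (hθ : θ ∈ Ioo 0 Real.pi)
    (q : ℝ × ℝ) : (θ, q) ∈ Wu a f d ↔
      ∃ u v, RegSol (rhs a f) Real.pi d u v ∧ q = (u θ, sin θ * v θ) := by
  constructor
  · rintro ⟨g, hg, ⟨r, hr, C, hC⟩, hx⟩
    rcases orbit_of_tendsto H hg (tendsto_of_exp_bound hr hC) with h | ⟨u, v, c, hs, ho⟩
    · exfalso
      rcases hx with ⟨τ, hτ⟩ | hx
      · rw [h τ] at hτ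
        exact hθ.1.ne (congrArg Prod.fst hτ)
      · have hx := hx.congr h
        exact hθ.1.ne (congrArg Prod.fst (tendsto_nhds_unique tendsto_const_nhds hx))
    · rcases hx with ⟨τ, hτ⟩ | hx
      · refine ⟨u, v, hs, ?_⟩
        rw [ho, orb, Prod.mk.injEq] at hτ
        rw [← hτ.2, hτ.1]
      · exfalso
        have h1 : Tendsto (fun τ => (g τ).1) atTop (𝓝 θ) := (continuous_fst.tendsto _).comp hx
        simp only [ho] at h1
        exact hθ.2.ne (tendsto_nhds_unique h1 (orb_tendsto_fst_atTop u v c))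
  · rintro ⟨u, v, hs, rfl⟩
    exact ⟨orb u v, isShootOrbit_orb hs.sol, ⟨1, one_pos, hs.exp_bound⟩,
      Or.inl ⟨logTan θ, by rw [orb, height_logTan hθ]⟩⟩

/-- The strong unstable manifold of `(0, d, 0)` at height `0`. -/
theorem mem_Wu_zero_iff {a f : ℝ → ℝ → ℝ → ℝ} (H : Hyp a f) {d : ℝ} (q : ℝ × ℝ) :
    (0, q) ∈ Wu a f d ↔ q = (d, 0) := by
  constructor
  · rintro ⟨g, hg, ⟨r, hr, C, hC⟩, hx⟩
    rcases orbit_of_tendsto H hg (tendsto_of_exp_bound hr hC) with h | ⟨u, v, c, hs, ho⟩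
    · rcases hx with ⟨τ, hτ⟩ | hx
      · rw [h τ] at hτ
        exact (congrArg Prod.snd hτ).symm
      · have hx := hx.congr h
        exact (congrArg Prod.snd (tendsto_nhds_unique tendsto_const_nhds hx)).symm
    · exfalso
      rcases hx with ⟨τ, hτ⟩ | hx
      · rw [ho, orb] at hτ
        exact (height_mem (τ + c)).1.ne' (congrArg Prod.fst hτ)
      · have h1 : Tendsto (fun τ => (g τ).1) atTop (𝓝 0) := (continuous_fst.tendsto _).comp hx
        simp only [ho] at h1
        exact Real.pi_ne_zero (tendsto_nhds_unique (orb_tendsto_fst_atTop u v c) h1)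
  · rintro rfl
    refine ⟨fun _ => (0, d, 0), fun τ => ⟨⟨le_rfl, Real.pi_pos.le⟩, ?_⟩, ⟨1, one_pos, 0, ?_⟩,
      Or.inl ⟨0, rfl⟩⟩
    · refine (hasDerivAt_const τ _).congr_deriv ?_
      simp [shootField, Prod.zero_eq_mk]
    · simp

/-- The points of height `π` in the strong unstable manifold of `(0, d, 0)`. -/
theorem mem_Wu_pi_iff {a f : ℝ → ℝ → ℝ → ℝ} (H : Hyp a f) {d : ℝ} (q : ℝ × ℝ) :
    (Real.pi, q) ∈ Wu a f d ↔
      ∃ u v, RegSol (rhs a f) Real.pi d u v ∧ Tendsto (orb u v) atTop (𝓝 (Real.pi, q)) := by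
  constructor
  · rintro ⟨g, hg, ⟨r, hr, C, hC⟩, hx⟩
    rcases orbit_of_tendsto H hg (tendsto_of_exp_bound hr hC) with h | ⟨u, v, c, hs, ho⟩
    · exfalso
      rcases hx with ⟨τ, hτ⟩ | hx
      · rw [h τ] at hτ
        exact Real.pi_ne_zero.symm (congrArg Prod.fst hτ)
      · have hx := hx.congr h
        exact Real.pi_ne_zero.symm (congrArg Prod.fst (tendsto_nhds_unique tendsto_const_nhds hx))
    · rcases hx with ⟨τ, hτ⟩ | hx
      · exfalso
        rw [ho, orb] at hτ
        exact (height_mem (τ + c)).2.ne (congrArg Prod.fst hτ)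
      · refine ⟨u, v, hs, ?_⟩
        have := hx.comp (tendsto_atTop_add_const_right _ (-c) tendsto_id)
        refine this.congr fun τ => ?_
        simp [ho]
  · rintro ⟨u, v, hs, ht⟩
    exact ⟨orb u v, isShootOrbit_orb hs.sol, ⟨1, one_pos, hs.exp_bound⟩, Or.inr ht⟩

/-! ### Linear equations and differentiability with respect to the initial value -/

/-- A linear right-hand side. -/
def lin (q c : ℝ → ℝ) (θ x y : ℝ) : ℝ := q θ * x + c θ * y

lemma globLip_lin {q c : ℝ → ℝ} (hq : ContinuousOn q (Ico 0 Real.pi))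
    (hc : ContinuousOn c (Ico 0 Real.pi)) : GlobLip (lin q c) := by
  intro θ₁ h₁
  have hsub : Icc 0 θ₁ ⊆ Ico 0 Real.pi := fun t ht => ⟨ht.1, ht.2.trans_lt h₁⟩
  obtain ⟨L₁, hL₁, b₁⟩ := exists_abs_le_of_continuousOn (hq.mono hsub)
  obtain ⟨L₂, hL₂, b₂⟩ := exists_abs_le_of_continuousOn (hc.mono hsub)
  refine ⟨max L₁ L₂, le_max_of_le_left hL₁, fun θ hθ x y x' y' => ?_⟩
  have : lin q c θ x' y' - lin q c θ x y = q θ * (x' - x) + c θ * (y' - y) := by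
    simp only [lin]; ring
  rw [this, mul_add]
  refine (abs_add_le _ _).trans ?_
  rw [abs_mul, abs_mul]
  gcongr
  · exact (b₁ θ hθ).trans (le_max_left _ _)
  · exact (b₂ θ hθ).trans (le_max_right _ _)

theorem exists_regSol_lin {q c : ℝ → ℝ} (hq : ContinuousOn q (Ico 0 Real.pi))
    (hc : ContinuousOn c (Ico 0 Real.pi)) (d : ℝ) : ∃ U V, RegSol (lin q c) Real.pi d U V := by
  refine exists_regSol ?_ (globLip_lin hq hc) d
  have h1 : ContinuousOn (fun x : ℝ × ℝ × ℝ => q x.1) (Ico 0 Real.pi ×ˢ univ) :=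
    hq.comp continuousOn_fst fun x hx => hx.1
  have h2 : ContinuousOn (fun x : ℝ × ℝ × ℝ => c x.1) (Ico 0 Real.pi ×ˢ univ) :=
    hc.comp continuousOn_fst fun x hx => hx.1
  exact (h1.mul (by fun_prop)).add (h2.mul (by fun_prop))

/-- A continuation principle: a quantity that is small whenever it is at most one stays small. -/
lemma lt_one_of_bootstrap {D : ℝ → ℝ} {b : ℝ} (hD : ContinuousOn D (Icc 0 b)) (h0 : D 0 < 1)
    (h : ∀ s ∈ Icc 0 b, (∀ t ∈ Icc 0 s, D t ≤ 1) → D s < 1) : ∀ t ∈ Icc 0 b, D t < 1 := by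
  by_contra hcon
  push Not at hcon
  obtain ⟨t, ht, hDt⟩ := hcon
  have hcl : IsCompact (Icc 0 b ∩ D ⁻¹' Ici 1) :=
    isCompact_Icc.of_isClosed_subset
      (hD.preimage_isClosed_of_isClosed isClosed_Icc isClosed_Ici) inter_subset_left
  obtain ⟨s, hs, hmin⟩ := hcl.exists_isLeast ⟨t, ht, hDt⟩
  -- s is the first point with D s ≥ 1. By continuity D ≤ 1 on [0, s], and then `h` gives D s < 1.
  refine absurd (h s hs.1 fun r hr => ?_) (not_lt.2 hs.2)
  rcases hr.2.eq_or_lt with e | e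
  · have hlim : D r ≤ 1 := by
      rw [e]
      have h0s : 0 < s := by
        rcases hs.1.1.eq_or_lt with h' | h'
        · exfalso; have : 1 ≤ D s := hs.2
          rw [← h'] at this; linarith
        · exact h'
      have hc : Tendsto D (𝓝[<] s) (𝓝 (D s)) :=
        (hD s hs.1).mono_left (by
          rw [← nhdsWithin_Ioo_eq_nhdsLT h0s]
          exact nhdsWithin_mono _ fun x hx => ⟨hx.1.le, hx.2.le.trans hs.1.2⟩)
      refine le_of_tendsto hc ?_
      filter_upwards [Ioo_mem_nhdsLT h0s] with x hx
      by_contra hx'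
      exact absurd (hmin ⟨⟨hx.1.le, hx.2.le.trans hs.1.2⟩, (not_le.1 hx').le⟩) (not_le.2 hx.2)
    exact hlim
  · by_contra hx'
    exact absurd (hmin ⟨⟨hr.1, e.le.trans hs.1.2⟩, (not_le.1 hx').le⟩) (not_le.2 e)

lemma Icc_subset_Ico_pi {θ : ℝ} (hθ : θ < Real.pi) : Icc 0 θ ⊆ Ico 0 Real.pi :=
  fun _ ht => ⟨ht.1, ht.2.trans_lt hθ⟩

/-- Local Lipschitz dependence on the initial value. -/
lemma exists_lipschitz_family {h : ℝ → ℝ → ℝ → ℝ} (hh : C2 h) {u v : ℝ → ℝ → ℝ}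
    (hs : ∀ d, RegSol h Real.pi d (u d) (v d)) (d : ℝ) {θ₁ : ℝ} (h₁ : θ₁ ∈ Ioo 0 Real.pi) :
    ∃ C ≥ 0, ∃ δ > 0, ∃ R, ∀ d', |d' - d| < δ → ∀ t ∈ Icc 0 θ₁,
      |u d' t - u d t| + |v d' t - v d t| ≤ C * |d' - d| ∧
      |u d t| ≤ R ∧ |v d t| ≤ R ∧ |u d' t| ≤ R ∧ |v d' t| ≤ R := by
  have hsub := Icc_subset_Ico_pi h₁.2
  obtain ⟨R₁, hR₁, b₁⟩ := exists_abs_le_of_continuousOn ((hs d).cu.mono hsub)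
  obtain ⟨R₂, hR₂, b₂⟩ := exists_abs_le_of_continuousOn ((hs d).cv.mono hsub)
  -- The margin 1 leaves room for differences of size at most 1. The bootstrap secures these once C
  -- |d' - d| < 1, hence δ = 1 / C below.
  set R := max R₁ R₂ + 1 with hR
  have hR1 : R₁ + 1 ≤ R := by rw [hR]; linarith [le_max_left R₁ R₂]
  have hR2 : R₂ + 1 ≤ R := by rw [hR]; linarith [le_max_right R₁ R₂]
  obtain ⟨L, hL, hlip⟩ := hh.exists_taylor R
  obtain ⟨C, hC, hgr⟩ := singular_gronwall h₁ hL
  have hbox : ∀ d' t, t ∈ Icc 0 θ₁ → |u d' t - u d t| + |v d' t - v d t| ≤ 1 →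
      |u d t| ≤ R ∧ |v d t| ≤ R ∧ |u d' t| ≤ R ∧ |v d' t| ≤ R := by
    intro d' t ht h1
    have e1 := b₁ t ht
    have e2 := b₂ t ht
    have e3 := abs_sub_abs_le_abs_sub (u d' t) (u d t)
    have e4 := abs_sub_abs_le_abs_sub (v d' t) (v d t)
    have e5 := abs_nonneg (u d' t - u d t)
    have e6 := abs_nonneg (v d' t - v d t)
    refine ⟨by linarith, by linarith, by linarith, by linarith⟩
  have hest : ∀ d', ∀ s ∈ Icc 0 θ₁, (∀ t ∈ Icc 0 s, |u d' t - u d t| + |v d' t - v d t| ≤ 1) →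
      ∀ t ∈ Icc 0 s, |u d' t - u d t| + |v d' t - v d t| ≤ C * |d' - d| := by
    intro d' s hss h1 t ht
    have hsub' : Icc 0 s ⊆ Ico 0 Real.pi := (Icc_subset_Icc_right hss.2).trans hsub
    have := hgr s hss (fun t => u d' t - u d t) (fun t => v d' t - v d t)
      (fun t => h t (u d' t) (v d' t) - h t (u d t) (v d t)) 0 le_rfl
      (((hs d').cu.mono hsub').sub ((hs d).cu.mono hsub'))
      (((hs d').cv.mono hsub').sub ((hs d).cv.mono hsub')) (by simp [(hs d).v0, (hs d').v0])
      (fun t ht => by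
        have ht' : t ∈ Ioo 0 Real.pi := ⟨ht.1, (hsub' (Ioo_subset_Icc_self ht)).2⟩
        refine ⟨((hs d').sol t ht').1.sub ((hs d).sol t ht').1,
          (((hs d').sol t ht').2.sub ((hs d).sol t ht').2).congr_deriv ?_⟩
        ring)
      (fun t ht => by
        have ht' := Ioo_subset_Icc_self ht
        obtain ⟨q1, q2, q3, q4⟩ := hbox d' t ⟨ht'.1, ht'.2.trans hss.2⟩ (h1 t ht')
        rw [add_zero]
        exact (hlip t ⟨ht'.1, (hsub' ht').2.le⟩ _ _ _ _ q1 q2 q3 q4).1) t ht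
    simpa [(hs d).u0, (hs d').u0] using this
  have hC0 : 0 < C := by linarith
  refine ⟨C, hC0.le, 1 / C, by positivity, R, fun d' hd' t ht => ?_⟩
  have hd1 : C * |d' - d| < 1 := by
    rwa [lt_div_iff₀ hC0, mul_comm] at hd'
  have hlt := lt_one_of_bootstrap (D := fun t => |u d' t - u d t| + |v d' t - v d t|) (b := θ₁)
    ((((hs d').cu.mono hsub).sub ((hs d).cu.mono hsub)).abs.add
      (((hs d').cv.mono hsub).sub ((hs d).cv.mono hsub)).abs)
    (by
      simp only [(hs d).u0, (hs d').u0, (hs d).v0, (hs d').v0, sub_self, abs_zero, add_zero]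
      have := abs_nonneg (d' - d)
      nlinarith)
    (fun s hss h1 => (hest d' s hss h1 s ⟨hss.1, le_rfl⟩).trans_lt hd1)
  exact ⟨hest d' θ₁ ⟨h₁.1.le, le_rfl⟩ (fun t ht => (hlt t ht).le) t ht,
    hbox d' t ht (hlt t ht).le⟩

lemma hasDerivAt_of_quadratic {g : ℝ → ℝ} {x g' C δ : ℝ} (hδ : 0 < δ)
    (h : ∀ y, |y - x| < δ → |g y - g x - (y - x) * g'| ≤ C * |y - x| ^ 2) : HasDerivAt g g' x := by
  rw [hasDerivAt_iff_isLittleO]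
  refine Asymptotics.IsBigO.trans_isLittleO (g := fun y => ‖y - x‖ ^ 2) ?_
    (Asymptotics.isLittleO_pow_sub_sub x one_lt_two)
  refine Asymptotics.IsBigO.of_bound C ?_
  filter_upwards [Metric.ball_mem_nhds x hδ] with y hy
  have := h y (by rwa [Metric.mem_ball, Real.dist_eq] at hy)
  simpa [smul_eq_mul] using this

/-- The coefficient of the linearization along `(u, v)` multiplying the function. -/
def coefU (h : ℝ → ℝ → ℝ → ℝ) (u v : ℝ → ℝ) (θ : ℝ) : ℝ := dU h θ (u θ) (v θ)

/-- The coefficient of the linearization along `(u, v)` multiplying the derivative. -/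
def coefP (h : ℝ → ℝ → ℝ → ℝ) (u v : ℝ → ℝ) (θ : ℝ) : ℝ := dP h θ (u θ) (v θ)

lemma C2.continuousOn_coefU {h : ℝ → ℝ → ℝ → ℝ} (hh : C2 h) {u v : ℝ → ℝ} {s : Set ℝ}
    (hs : s ⊆ Icc 0 Real.pi) (hu : ContinuousOn u s) (hv : ContinuousOn v s) :
    ContinuousOn (coefU h u v) s :=
  hh.continuousOn_dU.comp (f := fun θ => (θ, u θ, v θ)) (continuousOn_id.prodMk (hu.prodMk hv))
    fun _ ht => ⟨hs ht, mem_univ _⟩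

lemma C2.continuousOn_coefP {h : ℝ → ℝ → ℝ → ℝ} (hh : C2 h) {u v : ℝ → ℝ} {s : Set ℝ}
    (hs : s ⊆ Icc 0 Real.pi) (hu : ContinuousOn u s) (hv : ContinuousOn v s) :
    ContinuousOn (coefP h u v) s :=
  hh.continuousOn_dP.comp (f := fun θ => (θ, u θ, v θ)) (continuousOn_id.prodMk (hu.prodMk hv))
    fun _ ht => ⟨hs ht, mem_univ _⟩

/-- Solutions are differentiable in the initial value; the derivative solves the linearized
equation. -/
theorem hasDerivAt_family {h : ℝ → ℝ → ℝ → ℝ} (hh : C2 h) {u v : ℝ → ℝ → ℝ}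
    (hs : ∀ d, RegSol h Real.pi d (u d) (v d)) {d : ℝ} {U V : ℝ → ℝ}
    (hU : RegSol (lin (coefU h (u d) (v d)) (coefP h (u d) (v d))) Real.pi 1 U V)
    {θ : ℝ} (hθ : θ ∈ Ioo 0 Real.pi) :
    HasDerivAt (fun d' => u d' θ) (U θ) d ∧ HasDerivAt (fun d' => v d' θ) (V θ) d := by
  have hsub := Icc_subset_Ico_pi hθ.2
  obtain ⟨C, hC, δ, hδ, R, hlip⟩ := exists_lipschitz_family hh hs d hθ
  obtain ⟨L, hL, htay⟩ := hh.exists_taylor R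
  obtain ⟨L₁, hL₁, b₁⟩ := exists_abs_le_of_continuousOn ((hh.continuousOn_coefU
    Ico_subset_Icc_self (hs d).cu (hs d).cv).mono hsub)
  obtain ⟨L₂, hL₂, b₂⟩ := exists_abs_le_of_continuousOn ((hh.continuousOn_coefP
    Ico_subset_Icc_self (hs d).cu (hs d).cv).mono hsub)
  obtain ⟨C', hC', hgr⟩ := singular_gronwall hθ (L := max L₁ L₂) (le_max_of_le_left hL₁)
  have key : ∀ d', |d' - d| < δ → |u d' θ - u d θ - (d' - d) * U θ| +
      |v d' θ - v d θ - (d' - d) * V θ| ≤ C' * (L * C ^ 2) * |d' - d| ^ 2 := by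
    intro d' hd'
    have := hgr θ ⟨hθ.1.le, le_rfl⟩ (fun t => u d' t - u d t - (d' - d) * U t)
      (fun t => v d' t - v d t - (d' - d) * V t)
      (fun t => h t (u d' t) (v d' t) - h t (u d t) (v d t) - (d' - d) *
        lin (coefU h (u d) (v d)) (coefP h (u d) (v d)) t (U t) (V t))
      (L * (C * |d' - d|) ^ 2) (by positivity)
      ((((hs d').cu.mono hsub).sub ((hs d).cu.mono hsub)).sub
        (continuousOn_const.mul (hU.cu.mono hsub)))
      ((((hs d').cv.mono hsub).sub ((hs d).cv.mono hsub)).sub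
        (continuousOn_const.mul (hU.cv.mono hsub)))
      (by simp [(hs d).v0, (hs d').v0, hU.v0])
      (fun t ht => by
        have ht' : t ∈ Ioo 0 Real.pi := ⟨ht.1, ht.2.trans hθ.2⟩
        refine ⟨(((hs d').sol t ht').1.sub ((hs d).sol t ht').1).sub
          ((hU.sol t ht').1.const_mul (d' - d)),
          ((((hs d').sol t ht').2.sub ((hs d).sol t ht').2).sub
          ((hU.sol t ht').2.const_mul (d' - d))).congr_deriv ?_⟩
        ring)
      (fun t ht => by
        have ht' := Ioo_subset_Icc_self ht
        obtain ⟨q0, q1, q2, q3, q4⟩ := hlip d' hd' t ht'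
        have hT := (htay t ⟨ht'.1, (hsub ht').2.le⟩ _ _ _ _ q1 q2 q3 q4).2
        -- The remainder splits into the linearized coefficients acting on the error and the Taylor
        -- remainder of h, which is quadratic in d' - d by Lipschitz dependence.
        have e : h t (u d' t) (v d' t) - h t (u d t) (v d t) - (d' - d) *
            lin (coefU h (u d) (v d)) (coefP h (u d) (v d)) t (U t) (V t) =
          (coefU h (u d) (v d) t * (u d' t - u d t - (d' - d) * U t) +
            coefP h (u d) (v d) t * (v d' t - v d t - (d' - d) * V t)) +
          (h t (u d' t) (v d' t) - h t (u d t) (v d t) - (dU h t (u d t) (v d t) *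
            (u d' t - u d t) + dP h t (u d t) (v d t) * (v d' t - v d t))) := by
          simp only [lin, coefU, coefP]; ring
        rw [e]
        refine (abs_add_le _ _).trans (add_le_add ?_ (hT.trans ?_))
        · rw [mul_add]
          refine (abs_add_le _ _).trans ?_
          rw [abs_mul, abs_mul]
          gcongr
          · exact (b₁ t ht').trans (le_max_left _ _)
          · exact (b₂ t ht').trans (le_max_right _ _)
        · gcongr)
      θ ⟨hθ.1.le, le_rfl⟩
    simp only [(hs d).u0, (hs d').u0, hU.u0, mul_one, sub_self, abs_zero, zero_add] at this
    refine this.trans_eq ?_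
    ring
  refine ⟨hasDerivAt_of_quadratic hδ (C := C' * (L * C ^ 2)) fun d' hd' => ?_,
    hasDerivAt_of_quadratic hδ (C := C' * (L * C ^ 2)) fun d' hd' => ?_⟩
  · linarith [key d' hd', abs_nonneg (v d' θ - v d θ - (d' - d) * V θ)]
  · linarith [key d' hd', abs_nonneg (u d' θ - u d θ - (d' - d) * U θ)]

/-- A nontrivial solution of a linear equation does not vanish together with its derivative. -/
lemma RegSol.ne_zero {q c : ℝ → ℝ} (hl : LocLip (lin q c)) {U V : ℝ → ℝ} {d : ℝ} (hd : d ≠ 0)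
    (hU : RegSol (lin q c) Real.pi d U V) {θ : ℝ} (hθ : θ ∈ Ico 0 Real.pi) :
    ¬ (U θ = 0 ∧ V θ = 0) := by
  rintro ⟨h1, h2⟩
  rcases hθ.1.eq_or_lt with h0 | h0
  · rw [← h0, hU.u0] at h1; exact hd h1
  have hz : Sol (lin q c) Real.pi (fun _ => 0) (fun _ => 0) := fun t _ => by
    constructor <;> simpa [lin] using hasDerivAt_const t (0:ℝ)
  have he := Sol.eq hl le_rfl hU.sol hz ⟨h0, hθ.2⟩ h1 h2
  have hc := hU.cu 0 ⟨le_rfl, Real.pi_pos⟩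
  rw [ContinuousWithinAt, hU.u0] at hc
  have hc' := hc.mono_left (nhdsWithin_mono _ (Ioo_subset_Ico_self (a := 0) (b := Real.pi)))
  rw [nhdsWithin_Ioo_eq_nhdsGT Real.pi_pos] at hc'
  refine hd (tendsto_nhds_unique (hc'.congr' ?_) tendsto_const_nhds)
  filter_upwards [Ioo_mem_nhdsGT Real.pi_pos] with t ht using (he t ht).1

/-! ### Continuous choice of the angle -/

/-- A nonvanishing curve is the exponential of the primitive of its logarithmic derivative. -/
lemma exp_integral_logDeriv {Z Z' : ℝ → ℂ} {b : ℝ} (hZ : ContinuousOn Z (Ico 0 b))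
    (hZ' : ContinuousOn Z' (Ico 0 b)) (hd : ∀ θ ∈ Ioo 0 b, HasDerivAt Z (Z' θ) θ)
    (hne : ∀ θ ∈ Ico 0 b, Z θ ≠ 0) (h0 : Z 0 = 1) :
    ContinuousOn (fun θ => ∫ φ in (0)..θ, Z' φ / Z φ) (Ico 0 b) ∧
      ∀ θ ∈ Ico 0 b, Complex.exp (∫ φ in (0)..θ, Z' φ / Z φ) = Z θ := by
  have hN : ContinuousOn (fun φ => Z' φ / Z φ) (Ico 0 b) := hZ'.div hZ hne
  have hint : ∀ θ ∈ Ico 0 b, IntervalIntegrable (fun φ => Z' φ / Z φ) MeasureTheory.volume 0 θ :=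
    fun θ hθ => (hN.mono fun t ht => by
      rw [uIcc_of_le hθ.1] at ht
      exact ⟨ht.1, ht.2.trans_lt hθ.2⟩).intervalIntegrable
  have hder : ∀ θ ∈ Ioo 0 b, HasDerivAt (fun θ => ∫ φ in (0)..θ, Z' φ / Z φ) (Z' θ / Z θ) θ := by
    intro θ hθ
    have hN' := hN.mono Ioo_subset_Ico_self
    exact intervalIntegral.integral_hasDerivAt_right (hint θ (Ioo_subset_Ico_self hθ))
      (hN'.stronglyMeasurableAtFilter isOpen_Ioo θ hθ)
      (hN'.continuousAt (Ioo_mem_nhds hθ.1 hθ.2))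
  have hcont : ContinuousOn (fun θ => ∫ φ in (0)..θ, Z' φ / Z φ) (Ico 0 b) := by
    intro θ hθ
    obtain ⟨s, hs1, hs2⟩ := exists_between hθ.2
    have hsub : Icc 0 s ⊆ Ico 0 b := fun t ht => ⟨ht.1, ht.2.trans_lt hs2⟩
    have h := intervalIntegral.continuousOn_primitive_interval (μ := MeasureTheory.volume)
      (f := fun φ => Z' φ / Z φ) (a := 0) (b := s) (by
        rw [uIcc_of_le (hθ.1.trans hs1.le)]
        exact (hN.mono hsub).integrableOn_Icc)
    rw [uIcc_of_le (hθ.1.trans hs1.le)] at h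
    refine (h θ ⟨hθ.1, hs1.le⟩).mono_of_mem_nhdsWithin ?_
    filter_upwards [self_mem_nhdsWithin, mem_nhdsWithin_of_mem_nhds (Iio_mem_nhds hs1)]
      with t ht ht' using ⟨ht.1, le_of_lt ht'⟩
  refine ⟨hcont, fun θ hθ => ?_⟩
  rcases hθ.1.eq_or_lt with he | he
  · rw [← he]; simp [h0]
  -- Z exp (-∫ Z' / Z) has derivative zero and the value 1 at 0.
  set G : ℝ → ℂ := fun θ => Z θ * Complex.exp (-∫ φ in (0)..θ, Z' φ / Z φ)
  have hsub : Icc 0 θ ⊆ Ico 0 b := fun t ht => ⟨ht.1, ht.2.trans_lt hθ.2⟩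
  have hG : ContinuousOn G (Icc 0 θ) :=
    (hZ.mono hsub).mul (Complex.continuous_exp.comp_continuousOn (hcont.mono hsub).neg)
  have hG' : ∀ t ∈ Ioo 0 θ, HasDerivAt G 0 t := by
    intro t ht
    have ht' : t ∈ Ioo 0 b := ⟨ht.1, ht.2.trans hθ.2⟩
    have hz := hne t (Ioo_subset_Ico_self ht')
    refine ((hd t ht').mul ((hder t ht').neg.cexp)).congr_deriv ?_
    field_simp
    simp
  have hconst : G θ = G 0 := by
    rw [← sub_eq_zero, ← norm_le_zero_iff]
    -- Differentiability is available in the open interval only, so constancy is obtained on [s, θ]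
    -- and carried to 0 by s → 0.
    have key : ∀ s ∈ Ioo 0 θ, G θ = G s := by
      intro s hs
      refine constant_of_has_deriv_right_zero (f := G) (a := s) (b := θ)
        (hG.mono (Icc_subset_Icc_left hs.1.le)) (fun t ht => ?_) θ ⟨hs.2.le, le_rfl⟩
      exact (hG' t ⟨hs.1.trans_le ht.1, ht.2⟩).hasDerivWithinAt
    have h1 : Tendsto G (𝓝[>] 0) (𝓝 (G 0)) := by
      rw [← nhdsWithin_Ioo_eq_nhdsGT he]
      exact (hG 0 ⟨le_rfl, he.le⟩).mono_left (nhdsWithin_mono _ Ioo_subset_Icc_self)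
    have h2 : Tendsto G (𝓝[>] 0) (𝓝 (G θ)) := by
      refine tendsto_const_nhds.congr' ?_
      filter_upwards [Ioo_mem_nhdsGT he] with s hs using key s hs
    rw [tendsto_nhds_unique h1 h2]; simp
  have : Z θ * Complex.exp (-∫ φ in (0)..θ, Z' φ / Z φ) = 1 := by
    have h2 : G 0 = 1 := by simp [G, h0]
    rw [← h2, ← hconst]
  rw [Complex.exp_neg, mul_inv_eq_one₀ (Complex.exp_ne_zero _)] at this
  exact this.symm

/-- The complex number `U - i sin θ V` that represents the tangent vector clockwise. -/
def zvec (U V : ℝ → ℝ) (θ : ℝ) : ℂ := ⟨U θ, -(sin θ * V θ)⟩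

/-- The derivative of `zvec` along solutions of the linear equation. -/
def zvec' (q c U V : ℝ → ℝ) (θ : ℝ) : ℂ := ⟨V θ, -(sin θ * lin q c θ (U θ) (V θ))⟩

/-- The clockwise angle of a solution, measured continuously from the pole. -/
def angle (q c U V : ℝ → ℝ) (θ : ℝ) : ℝ :=
  (∫ φ in (0)..θ, zvec' q c U V φ / zvec U V φ).im

lemma continuousOn_complex_mk {x y : ℝ → ℝ} {s : Set ℝ} (hx : ContinuousOn x s)
    (hy : ContinuousOn y s) : ContinuousOn (fun t => (⟨x t, y t⟩ : ℂ)) s :=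
  Complex.equivRealProdCLM.symm.continuous.comp_continuousOn (hx.prodMk hy)

lemma hasDerivAt_complex_mk {x y : ℝ → ℝ} {x' y' t : ℝ} (hx : HasDerivAt x x' t)
    (hy : HasDerivAt y y' t) : HasDerivAt (fun t => (⟨x t, y t⟩ : ℂ)) ⟨x', y'⟩ t := by
  have := Complex.equivRealProdCLM.symm.hasFDerivAt.comp_hasDerivAt t (hx.prodMk hy)
  exact this

section
variable {q c U V : ℝ → ℝ}

lemma zvec_ne_zero (hl : LocLip (lin q c)) (hU : RegSol (lin q c) Real.pi 1 U V) :
    ∀ θ ∈ Ico 0 Real.pi, zvec U V θ ≠ 0 := by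
  intro θ hθ hz
  have h1 : U θ = 0 := congrArg Complex.re hz
  have h2 : -(sin θ * V θ) = 0 := congrArg Complex.im hz
  rcases hθ.1.eq_or_lt with h0 | h0
  · rw [← h0, hU.u0] at h1; exact one_ne_zero h1
  · refine hU.ne_zero hl one_ne_zero hθ ⟨h1, ?_⟩
    have := (sin_pos_of_mem ⟨h0, hθ.2⟩).ne'
    simpa [this] using h2

/-- The complex number U - i sin θ V starts at 1 and never vanishes, so its logarithmic derivative
can be integrated from the pole. The imaginary part of the integral is the clockwise angle, and the
exponential of the real part is the radius. -/
lemma angle_spec (hq : ContinuousOn q (Ico 0 Real.pi)) (hc : ContinuousOn c (Ico 0 Real.pi))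
    (hU : RegSol (lin q c) Real.pi 1 U V) :
    ContinuousOn (angle q c U V) (Ico 0 Real.pi) ∧ angle q c U V 0 = 0 ∧
      ∀ θ ∈ Ico 0 Real.pi, ∃ r > 0, U θ = r * cos (angle q c U V θ) ∧
        sin θ * V θ = -(r * sin (angle q c U V θ)) := by
  have hZ' : ContinuousOn (zvec' q c U V) (Ico 0 Real.pi) :=
    continuousOn_complex_mk hU.cv
      ((Real.continuous_sin.continuousOn.mul ((hq.mul hU.cu).add (hc.mul hU.cv))).neg)
  obtain ⟨h1, h2⟩ := exp_integral_logDeriv (Z := zvec U V) (Z' := zvec' q c U V)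
    (continuousOn_complex_mk hU.cu (Real.continuous_sin.continuousOn.mul hU.cv).neg) hZ'
    (fun θ hθ => hasDerivAt_complex_mk (hU.sol θ hθ).1
      (hasDerivAt_sin_mul (sin_pos_of_mem hθ).ne' (hU.sol θ hθ).2).neg)
    (zvec_ne_zero (globLip_lin hq hc).locLip hU)
    (by apply Complex.ext <;> simp [zvec, hU.u0])
  refine ⟨Complex.continuous_im.comp_continuousOn h1, by simp [angle], fun θ hθ => ?_⟩
  have h3 := h2 θ hθ
  refine ⟨Real.exp (∫ φ in (0)..θ, zvec' q c U V φ / zvec U V φ).re, Real.exp_pos _, ?_, ?_⟩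
  · rw [angle, ← Complex.exp_re, h3]; rfl
  · rw [angle, ← Complex.exp_im, h3]; simp [zvec]

end

/-! ### Dependence on the spectral parameter -/

/-- Continuous dependence on a parameter which is locally Lipschitz, uniformly on an interval. -/
lemma continuous_uncurry_projIcc {F : ℝ → ℝ → ℝ} {b : ℝ} (hb : 0 ≤ b)
    (hF : ∀ l, ContinuousOn (F l) (Icc 0 b))
    (hL : ∀ l₀, ∃ C, ∀ l, |l - l₀| ≤ 1 → ∀ t ∈ Icc 0 b, |F l t - F l₀ t| ≤ C * |l - l₀|) :
    Continuous fun x : ℝ × ℝ => F x.1 (projIcc 0 b hb x.2) := by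
  rw [continuous_iff_continuousAt]
  rintro ⟨l₀, t₀⟩
  obtain ⟨C, hC⟩ := hL l₀
  have h1 : Continuous fun x : ℝ × ℝ => F l₀ (projIcc 0 b hb x.2) :=
    (hF l₀).comp_continuous (continuous_subtype_val.comp (continuous_projIcc.comp continuous_snd))
      fun x => (projIcc 0 b hb x.2).2
  have h2 : Tendsto (fun x : ℝ × ℝ => F x.1 (projIcc 0 b hb x.2) - F l₀ (projIcc 0 b hb x.2))
      (𝓝 (l₀, t₀)) (𝓝 0) := by
    refine squeeze_zero_norm' (a := fun x : ℝ × ℝ => C * |x.1 - l₀|) ?_ ?_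
    · have : ∀ᶠ x : ℝ × ℝ in 𝓝 (l₀, t₀), |x.1 - l₀| < 1 := by
        refine ContinuousAt.eventually_lt (by fun_prop) (by fun_prop) ?_
        simp
      filter_upwards [this] with x hx using hC x.1 hx.le _ (projIcc 0 b hb x.2).2
    · have : Continuous fun x : ℝ × ℝ => C * |x.1 - l₀| := by fun_prop
      simpa using this.tendsto (l₀, t₀)
  have h3 := h2.add (h1.tendsto (l₀, t₀))
  simpa [ContinuousAt] using h3

/-- On [x, y] no point left of y can be a minimum, because smaller values occur just to its right.
So the minimum is attained only at y. -/
lemma strictAnti_of_right {f : ℝ → ℝ} (hf : Continuous f)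
    (h : ∀ x, ∀ᶠ y in 𝓝[>] x, f y < f x) : StrictAnti f := by
  intro x y hxy
  obtain ⟨m, hm, hmin⟩ := isCompact_Icc.exists_isMinOn (nonempty_Icc.2 hxy.le)
    (hf.continuousOn (s := Icc x y))
  have hlt : ∀ z ∈ Ico x y, f m < f z := by
    intro z hz
    obtain ⟨w, hw, hw'⟩ := ((h z).and (Ioo_mem_nhdsGT hz.2)).exists
    exact (hmin ⟨hz.1.trans hw'.1.le, hw'.2.le⟩ : f m ≤ f w).trans_lt hw
  have : m = y := by
    by_contra hne
    exact lt_irrefl _ (hlt m ⟨hm.1, lt_of_le_of_ne hm.2 hne⟩)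
  rw [← this]
  exact hlt x ⟨le_rfl, hxy⟩

section
variable {q c k : ℝ → ℝ} {U V : ℝ → ℝ → ℝ}

/-- The solutions depend on the spectral parameter in a locally Lipschitz way. -/
lemma exists_lipschitz_param (hq : Continuous q) (hc : Continuous c) (hk : Continuous k)
    (hU : ∀ l, RegSol (lin (fun θ => q θ + l * k θ) c) Real.pi 1 (U l) (V l)) {b : ℝ}
    (hb : b ∈ Ioo 0 Real.pi) (l₀ : ℝ) : ∃ C, ∀ l, |l - l₀| ≤ 1 → ∀ t ∈ Icc 0 b,
      |U l t - U l₀ t| + |V l t - V l₀ t| ≤ C * |l - l₀| := by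
  have hsub := Icc_subset_Ico_pi hb.2
  obtain ⟨Q, hQ, bQ⟩ := exists_abs_le_of_continuousOn (hq.continuousOn (s := Icc 0 b))
  obtain ⟨C, hC, bC⟩ := exists_abs_le_of_continuousOn (hc.continuousOn (s := Icc 0 b))
  obtain ⟨K, hK, bK⟩ := exists_abs_le_of_continuousOn (hk.continuousOn (s := Icc 0 b))
  obtain ⟨M, hM, bM⟩ := exists_abs_le_of_continuousOn ((hU l₀).cu.mono hsub)
  obtain ⟨G, hG, hgr⟩ := singular_gronwall hb (L := Q + (|l₀| + 1) * K + C) (by positivity)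
  refine ⟨G * (K * M), fun l hl t ht => ?_⟩
  have := hgr b ⟨hb.1.le, le_rfl⟩ (fun t => U l t - U l₀ t) (fun t => V l t - V l₀ t)
    (fun t => lin (fun θ => q θ + l * k θ) c t (U l t) (V l t) -
      lin (fun θ => q θ + l₀ * k θ) c t (U l₀ t) (V l₀ t)) (K * M * |l - l₀|) (by positivity)
    (((hU l).cu.mono hsub).sub ((hU l₀).cu.mono hsub))
    (((hU l).cv.mono hsub).sub ((hU l₀).cv.mono hsub)) (by simp [(hU l).v0, (hU l₀).v0])
    (fun t ht => by
      have ht' : t ∈ Ioo 0 Real.pi := ⟨ht.1, ht.2.trans hb.2⟩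
      refine ⟨((hU l).sol t ht').1.sub ((hU l₀).sol t ht').1,
        (((hU l).sol t ht').2.sub ((hU l₀).sol t ht').2).congr_deriv ?_⟩
      ring)
    (fun t ht => by
      have ht' := Ioo_subset_Icc_self ht
      have e : lin (fun θ => q θ + l * k θ) c t (U l t) (V l t) -
          lin (fun θ => q θ + l₀ * k θ) c t (U l₀ t) (V l₀ t) =
          (q t + l * k t) * (U l t - U l₀ t) + c t * (V l t - V l₀ t) +
            k t * U l₀ t * (l - l₀) := by simp only [lin]; ring
      have hl' : |l| ≤ |l₀| + 1 := by linarith [abs_sub_abs_le_abs_sub l l₀]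
      have h1 : |q t + l * k t| ≤ Q + (|l₀| + 1) * K := by
        refine (abs_add_le _ _).trans (add_le_add (bQ t ht') ?_)
        rw [abs_mul]
        exact mul_le_mul hl' (bK t ht') (abs_nonneg _) (by positivity)
      rw [e]
      refine (abs_add_le _ _).trans (add_le_add ((abs_add_le _ _).trans ?_) ?_)
      · rw [abs_mul, abs_mul]
        have h2 := abs_nonneg (U l t - U l₀ t)
        have h3 := abs_nonneg (V l t - V l₀ t)
        have h4 := mul_le_mul_of_nonneg_right h1 h2
        have h5 := mul_le_mul_of_nonneg_right (bC t ht') h3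
        have h6 : 0 ≤ (Q + (|l₀| + 1) * K) * |V l t - V l₀ t| := by positivity
        have h7 : 0 ≤ C * |U l t - U l₀ t| := by positivity
        linarith
      · rw [abs_mul, abs_mul]
        gcongr
        · exact bK t ht'
        · exact bM t ht') t ht
  simp only [(hU l).u0, (hU l₀).u0, sub_self, abs_zero, zero_add] at this
  linarith

lemma continuous_param (hq : Continuous q) (hc : Continuous c) (hk : Continuous k)
    (hU : ∀ l, RegSol (lin (fun θ => q θ + l * k θ) c) Real.pi 1 (U l) (V l)) {b : ℝ}
    (hb : b ∈ Ioo 0 Real.pi) :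
    Continuous (fun x : ℝ × ℝ => U x.1 (projIcc 0 b hb.1.le x.2)) ∧
    Continuous (fun x : ℝ × ℝ => V x.1 (projIcc 0 b hb.1.le x.2)) := by
  have hsub := Icc_subset_Ico_pi hb.2
  constructor
  · refine continuous_uncurry_projIcc hb.1.le (fun l => (hU l).cu.mono hsub) fun l₀ => ?_
    obtain ⟨C, h⟩ := exists_lipschitz_param hq hc hk hU hb l₀
    exact ⟨C, fun l hl t ht => by linarith [h l hl t ht, abs_nonneg (V l t - V l₀ t)]⟩
  · refine continuous_uncurry_projIcc hb.1.le (fun l => (hU l).cv.mono hsub) fun l₀ => ?_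
    obtain ⟨C, h⟩ := exists_lipschitz_param hq hc hk hU hb l₀
    exact ⟨C, fun l hl t ht => by linarith [h l hl t ht, abs_nonneg (U l t - U l₀ t)]⟩

/-- The angle depends continuously on the spectral parameter. -/
theorem continuous_angle (hq : Continuous q) (hc : Continuous c) (hk : Continuous k)
    (hU : ∀ l, RegSol (lin (fun θ => q θ + l * k θ) c) Real.pi 1 (U l) (V l)) {b : ℝ}
    (hb : b ∈ Ioo 0 Real.pi) :
    Continuous fun l => angle (fun θ => q θ + l * k θ) c (U l) (V l) b := by
  obtain ⟨cU, cV⟩ := continuous_param hq hc hk hU hb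
  set p : ℝ → ℝ := fun t => projIcc 0 b hb.1.le t with hp
  have hpc : Continuous p := continuous_subtype_val.comp continuous_projIcc
  have hpm : ∀ t, p t ∈ Icc 0 b := fun t => (projIcc 0 b hb.1.le t).2
  have hpc2 : Continuous fun x : ℝ × ℝ => p x.2 := hpc.comp continuous_snd
  have hZ : Continuous fun x : ℝ × ℝ => zvec (U x.1) (V x.1) (p x.2) :=
    Complex.equivRealProdCLM.symm.continuous.comp
      (cU.prodMk ((Real.continuous_sin.comp hpc2).mul cV).neg)
  have hZ' : Continuous fun x : ℝ × ℝ =>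
      zvec' (fun θ => q θ + x.1 * k θ) c (U x.1) (V x.1) (p x.2) := by
    refine Complex.equivRealProdCLM.symm.continuous.comp
      (cV.prodMk ((Real.continuous_sin.comp hpc2).mul ?_).neg)
    exact (((hq.comp hpc2).add (continuous_fst.mul (hk.comp hpc2))).mul cU).add
      ((hc.comp hpc2).mul cV)
  have hN := hZ'.div hZ fun x => zvec_ne_zero (globLip_lin (by fun_prop) (by fun_prop)).locLip
    (hU x.1) _ (Icc_subset_Ico_pi hb.2 (hpm x.2))
  have hI := intervalIntegral.continuous_parametric_intervalIntegral_of_continuous'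
    (μ := MeasureTheory.volume)
    (f := fun l t => zvec' (fun θ => q θ + l * k θ) c (U l) (V l) (p t) / zvec (U l) (V l) (p t))
    hN 0 b
  refine (Complex.continuous_im.comp hI).congr fun l => ?_
  simp only [Function.comp_apply, angle]
  congr 1
  refine intervalIntegral.integral_congr fun t ht => ?_
  rw [uIcc_of_le hb.1.le] at ht
  simp only [hp, projIcc_of_mem hb.1.le ht]

/-! ### Lagrange's identity and the monotonicity of the angle -/

/-- The integrating factor `exp (-∫ c)`. -/
def weight (c : ℝ → ℝ) (θ : ℝ) : ℝ := Real.exp (-∫ φ in (0)..θ, c φ)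

lemma weight_pos (c : ℝ → ℝ) (θ : ℝ) : 0 < weight c θ := Real.exp_pos _

lemma hasDerivAt_weight (hc : Continuous c) (θ : ℝ) :
    HasDerivAt (weight c) (-(c θ) * weight c θ) θ := by
  refine ((hc.integral_hasStrictDerivAt 0 θ).hasDerivAt.neg.exp).congr_deriv ?_
  simp only [weight, Pi.neg_apply]; ring

lemma continuous_weight (hc : Continuous c) : Continuous (weight c) :=
  continuous_iff_continuousAt.2 fun θ => (hasDerivAt_weight hc θ).continuousAt

/-- The weighted derivative of a solution. -/
lemma hasDerivAt_weight_mul (hc : Continuous c) {y : ℝ → ℝ} {θ r : ℝ} (hs : sin θ ≠ 0)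
    (hy : HasDerivAt y (r - cos θ / sin θ * y θ) θ) :
    HasDerivAt (fun θ => weight c θ * (sin θ * y θ)) (weight c θ * sin θ * (r - c θ * y θ)) θ := by
  refine ((hasDerivAt_weight hc θ).mul (hasDerivAt_sin_mul hs hy)).congr_deriv ?_
  ring

/-- The angle decreases strictly in the spectral parameter. -/
theorem strictAnti_angle (hq : Continuous q) (hc : Continuous c) (hk : Continuous k)
    (hkp : ∀ θ, 0 < k θ)
    (hU : ∀ l, RegSol (lin (fun θ => q θ + l * k θ) c) Real.pi 1 (U l) (V l)) {b : ℝ}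
    (hb : b ∈ Ioo 0 Real.pi) :
    StrictAnti fun l => angle (fun θ => q θ + l * k θ) c (U l) (V l) b := by
  have hca := continuous_angle hq hc hk hU hb
  refine strictAnti_of_right hca fun l => ?_
  obtain ⟨cU, cV⟩ := continuous_param hq hc hk hU hb
  set p : ℝ → ℝ := fun t => projIcc 0 b hb.1.le t with hp
  have hpc : Continuous p := continuous_subtype_val.comp continuous_projIcc
  have hpe : ∀ t ∈ Icc 0 b, p t = t := fun t ht => by simp only [hp, projIcc_of_mem hb.1.le ht]
  have hUl : Continuous fun t => U l (p t) := cU.comp (Continuous.prodMk_right l)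
  have hsub := Icc_subset_Ico_pi hb.2
  -- Lagrange's identity: the derivative of weight · sin θ · (U l · V m - U m · V l) is (m - l) N m.
  -- For m near l the integral of N m is close to that of N l, which is positive.
  set N : ℝ → ℝ → ℝ := fun m t => weight c t * sin t * k t * (U l (p t) * U m (p t)) with hN
  have hNc : Continuous fun x : ℝ × ℝ => N x.1 x.2 := by
    have := continuous_weight hc
    have h2 : Continuous fun x : ℝ × ℝ => U l (p x.2) := hUl.comp continuous_snd
    exact (((this.comp continuous_snd).mul (Real.continuous_sin.comp continuous_snd)).mul
      (hk.comp continuous_snd)).mul (h2.mul cU)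
  have hI : Continuous fun m => ∫ t in (0)..b, N m t :=
    intervalIntegral.continuous_parametric_intervalIntegral_of_continuous' hNc 0 b
  have hpos : 0 < ∫ t in (0)..b, N l t := by
    refine intervalIntegral.integral_pos hb.1
      (hNc.comp (Continuous.prodMk_right l)).continuousOn ?_ ?_
    · intro t ht
      have hs := sin_pos_of_mem ⟨ht.1, ht.2.trans_lt hb.2⟩
      have := weight_pos c t
      have := hkp t
      have := mul_self_nonneg (U l (p t))
      simp only [hN]; positivity
    · have h0 : ∀ᶠ t in 𝓝[>] 0, 0 < U l (p t) := by
        have : U l (p 0) = 1 := by rw [hpe 0 ⟨le_rfl, hb.1.le⟩, (hU l).u0]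
        exact ((hUl.tendsto 0).eventually (lt_mem_nhds (by rw [this]; exact one_pos))).filter_mono
          nhdsWithin_le_nhds
      obtain ⟨t, ht, ht'⟩ := (h0.and (Ioo_mem_nhdsGT hb.1)).exists
      refine ⟨t, Ioo_subset_Icc_self ht', ?_⟩
      have hs := sin_pos_of_mem ⟨ht'.1, ht'.2.trans hb.2⟩
      have := weight_pos c t
      have := hkp t
      simp only [hN]; positivity
  have hev : ∀ᶠ m in 𝓝[>] l, 0 < ∫ t in (0)..b, N m t :=
    ((hI.tendsto l).eventually (lt_mem_nhds hpos)).filter_mono nhdsWithin_le_nhds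
  -- By continuity the angle at m does not exceed the one at l by π or more, so the sign of sin (α -
  -- β) decides which is larger.
  have hev2 : ∀ᶠ m in 𝓝[>] l, angle (fun θ => q θ + m * k θ) c (U m) (V m) b <
      angle (fun θ => q θ + l * k θ) c (U l) (V l) b + Real.pi :=
    ((hca.tendsto l).eventually (gt_mem_nhds (by linarith [Real.pi_pos]))).filter_mono
      nhdsWithin_le_nhds
  filter_upwards [hev, hev2, self_mem_nhdsWithin] with m hm1 hm2 hm3
  have hlm : l < m := hm3
  have hcv : ∀ m, ContinuousOn (fun t => weight c t * (sin t * V m t)) (Icc 0 b) := fun m =>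
    (continuous_weight hc).continuousOn.mul
      (Real.continuous_sin.continuousOn.mul ((hU m).cv.mono hsub))
  have hW := intervalIntegral.integral_eq_sub_of_hasDerivAt_of_le hb.1.le
    (f := fun t => U l t * (weight c t * (sin t * V m t)) - U m t * (weight c t * (sin t * V l t)))
    (f' := fun t => (m - l) * N m t)
    ((((hU l).cu.mono hsub).mul (hcv m)).sub (((hU m).cu.mono hsub).mul (hcv l)))
    (fun t ht => by
      have ht' : t ∈ Ioo 0 Real.pi := ⟨ht.1, ht.2.trans hb.2⟩
      have hs := (sin_pos_of_mem ht').ne'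
      refine ((((hU l).sol t ht').1.mul (hasDerivAt_weight_mul hc hs ((hU m).sol t ht').2)).sub
        (((hU m).sol t ht').1.mul (hasDerivAt_weight_mul hc hs ((hU l).sol t
          ht').2))).congr_deriv ?_
      simp only [hN, hpe t (Ioo_subset_Icc_self ht), lin]
      ring)
    (((hNc.comp (Continuous.prodMk_right m)).const_mul (m - l)).intervalIntegrable _ _)
  rw [intervalIntegral.integral_const_mul] at hW
  have hWp : 0 < (m - l) * ∫ t in (0)..b, N m t := mul_pos (sub_pos.2 hlm) hm1
  rw [hW] at hWp
  simp only [Real.sin_zero, zero_mul, mul_zero, sub_zero] at hWp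
  have hspec := fun m => (angle_spec (q := fun θ => q θ + m * k θ) (c := c)
    (by fun_prop) (by fun_prop) (hU m)).2.2 b ⟨hb.1.le, hb.2⟩
  obtain ⟨r, hr, e1, e2⟩ := hspec l
  obtain ⟨r', hr', e3, e4⟩ := hspec m
  rw [e2, e4, e1, e3] at hWp
  set α := angle (fun θ => q θ + l * k θ) c (U l) (V l) b
  set β := angle (fun θ => q θ + m * k θ) c (U m) (V m) b
  have hw := weight_pos c b
  -- In polar coordinates the Lagrange bracket at b is weight · r · r' · sin (α - β).
  have hsin : 0 < weight c b * r * r' * sin (α - β) := by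
    rw [Real.sin_sub]; nlinarith
  have hsin' : 0 < sin (α - β) := by
    by_contra h
    have : weight c b * r * r' * sin (α - β) ≤ 0 :=
      mul_nonpos_of_nonneg_of_nonpos (by positivity) (not_lt.1 h)
    linarith
  by_contra h
  have := Real.sin_nonpos_of_nonpos_of_neg_pi_le (x := α - β) (by linarith) (by linarith)
  linarith

/-- For large spectral parameters the angle lies in `(-π/2, 0)`. -/
theorem eventually_angle_mem (hq : Continuous q) (hc : Continuous c) (hk : Continuous k)
    (hkp : ∀ θ, 0 < k θ)
    (hU : ∀ l, RegSol (lin (fun θ => q θ + l * k θ) c) Real.pi 1 (U l) (V l)) {b : ℝ}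
    (hb : b ∈ Ioo 0 Real.pi) :
    ∀ᶠ l in atTop, angle (fun θ => q θ + l * k θ) c (U l) (V l) b ∈ Ioo (-(Real.pi / 2)) 0 := by
  obtain ⟨Q, hQ, bQ⟩ := exists_abs_le_of_continuousOn (hq.continuousOn (s := Icc 0 b))
  obtain ⟨t₀, -, ht₀⟩ := isCompact_Icc.exists_isMinOn (nonempty_Icc.2 hb.1.le)
    (hk.continuousOn (s := Icc 0 b))
  -- Such l make q + l k positive on [0, b], so the solution that starts at (1, 0) keeps growing.
  filter_upwards [eventually_ge_atTop ((Q + 1) / k t₀)] with l hl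
  have hk0 := hkp t₀
  have hl0 : 0 ≤ l := le_trans (by positivity) hl
  have hpos : ∀ t ∈ Icc 0 b, 0 < q t + l * k t := by
    intro t ht
    have h1 := (abs_le.1 (bQ t ht)).1
    have h2 : k t₀ ≤ k t := ht₀ ht
    rw [div_le_iff₀ hk0] at hl
    nlinarith
  have hsub := Icc_subset_Ico_pi hb.2
  have hcv : ContinuousOn (fun t => weight c t * (sin t * V l t)) (Icc 0 b) :=
    (continuous_weight hc).continuousOn.mul
      (Real.continuous_sin.continuousOn.mul ((hU l).cv.mono hsub))
  have hder : ∀ t ∈ Ioo 0 b, HasDerivAt (fun t => weight c t * (sin t * V l t))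
      (weight c t * sin t * ((q t + l * k t) * U l t)) t := fun t ht => by
    have ht' : t ∈ Ioo 0 Real.pi := ⟨ht.1, ht.2.trans hb.2⟩
    refine (hasDerivAt_weight_mul hc (sin_pos_of_mem ht').ne' ((hU l).sol t ht').2).congr_deriv ?_
    simp only [lin]; ring
  have hVnn : ∀ s ∈ Icc 0 b, (∀ t ∈ Icc 0 s, 0 ≤ U l t) → ∀ t ∈ Ioo 0 s, 0 ≤ V l t := by
    intro s hs hUn t ht
    have htb : Icc 0 t ⊆ Icc 0 b := Icc_subset_Icc_right (ht.2.le.trans hs.2)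
    have hmono : MonotoneOn (fun t => weight c t * (sin t * V l t)) (Icc 0 t) := by
      refine monotoneOn_of_hasDerivWithinAt_nonneg (convex_Icc 0 t) (hcv.mono htb)
        (f' := fun t => weight c t * sin t * ((q t + l * k t) * U l t)) ?_ ?_
      · intro x hx; rw [interior_Icc] at hx
        exact (hder x ⟨hx.1, hx.2.trans_le (ht.2.le.trans hs.2)⟩).hasDerivWithinAt
      · intro x hx; rw [interior_Icc] at hx
        have hx' := Ioo_subset_Icc_self hx
        have h1 := weight_pos c x
        have h2 := sin_pos_of_mem ⟨hx.1, (htb hx').2.trans_lt hb.2⟩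
        have h3 := hpos x (htb hx')
        have h4 := hUn x ⟨hx'.1, hx'.2.trans ht.2.le⟩
        positivity
    have := hmono ⟨le_rfl, ht.1.le⟩ ⟨ht.1.le, le_rfl⟩ ht.1.le
    simp only [Real.sin_zero, zero_mul, mul_zero] at this
    have h1 := weight_pos c t
    have h2 := sin_pos_of_mem ⟨ht.1, (ht.2.trans_le hs.2).trans hb.2⟩
    by_contra hneg
    have : weight c t * (sin t * V l t) < 0 :=
      mul_neg_of_pos_of_neg h1 (mul_neg_of_pos_of_neg h2 (not_le.1 hneg))
    linarith
  have hU1 : ∀ t ∈ Icc 0 b, 0 < U l t := by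
    -- With D = 1 - U the bootstrap conclusion D < 1 says U > 0. As long as U ≥ 0, the weighted flux
    -- increases from 0, so V ≥ 0 and U does not fall below 1.
    have := lt_one_of_bootstrap (D := fun t => 1 - U l t)
      (continuousOn_const.sub ((hU l).cu.mono hsub)) (by simp [(hU l).u0]) (fun s hs h => by
        have hm : MonotoneOn (U l) (Icc 0 s) := by
          refine monotoneOn_of_hasDerivWithinAt_nonneg (convex_Icc 0 s)
            ((hU l).cu.mono ((Icc_subset_Icc_right hs.2).trans hsub)) (f' := V l) ?_ ?_
          · intro x hx; rw [interior_Icc] at hx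
            exact ((hU l).sol x ⟨hx.1, hx.2.trans_le (hs.2.trans hb.2.le)⟩).1.hasDerivWithinAt
          · intro x hx; rw [interior_Icc] at hx
            exact hVnn s hs (fun t ht => by linarith [h t ht]) x hx
        have := hm ⟨le_rfl, hs.1⟩ ⟨hs.1, le_rfl⟩ hs.1
        rw [(hU l).u0] at this
        linarith)
    intro t ht
    linarith [this t ht]
  have hV1 : 0 < sin b * V l b := by
    have hmono : StrictMonoOn (fun t => weight c t * (sin t * V l t)) (Icc 0 b) := by
      refine strictMonoOn_of_hasDerivWithinAt_pos (convex_Icc 0 b) hcv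
        (f' := fun t => weight c t * sin t * ((q t + l * k t) * U l t)) ?_ ?_
      · intro x hx; rw [interior_Icc] at hx
        exact (hder x hx).hasDerivWithinAt
      · intro x hx; rw [interior_Icc] at hx
        have hx' := Ioo_subset_Icc_self hx
        have h1 := weight_pos c x
        have h2 := sin_pos_of_mem ⟨hx.1, hx.2.trans hb.2⟩
        have h3 := hpos x hx'
        have h4 := hU1 x hx'
        positivity
    have := hmono ⟨le_rfl, hb.1.le⟩ ⟨hb.1.le, le_rfl⟩ hb.1
    simp only [Real.sin_zero, zero_mul, mul_zero] at this
    exact (mul_pos_iff_of_pos_left (weight_pos c b)).1 this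
  obtain ⟨hac, ha0, hpol⟩ := angle_spec (q := fun θ => q θ + l * k θ) (c := c)
    (by fun_prop) (by fun_prop) (hU l)
  set ν := angle (fun θ => q θ + l * k θ) c (U l) (V l)
  -- U > 0 means cos ν > 0 throughout, so the angle, starting at 0, never reaches ±π / 2.
  have hsmall : |ν b| < Real.pi / 2 := by
    by_contra hge
    obtain ⟨t, ht, hνt⟩ := intermediate_value_Icc hb.1.le (hac.mono hsub).abs
      (show Real.pi / 2 ∈ Icc |ν 0| |ν b| from
        ⟨by rw [ha0, abs_zero]; exact (half_pos Real.pi_pos).le, not_lt.1 hge⟩)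
    obtain ⟨r, hr, e1, -⟩ := hpol t (hsub ht)
    have hνt' : |ν t| = Real.pi / 2 := hνt
    have := hU1 t ht
    rw [e1, ← Real.cos_abs, hνt', Real.cos_pi_div_two, mul_zero] at this
    exact lt_irrefl _ this
  refine ⟨(abs_lt.1 hsmall).1, ?_⟩
  by_contra hnn
  obtain ⟨r, hr, -, e2⟩ := hpol b ⟨hb.1.le, hb.2⟩
  have := Real.sin_nonneg_of_nonneg_of_le_pi (not_lt.1 hnn)
    (by linarith [(abs_lt.1 hsmall).2, Real.pi_pos])
  rw [e2] at hV1
  nlinarith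

end

/-! ### From the decreasing angle to the number of eigenvalues -/

/-- Counting the parameters at which a decreasing angle is a multiple of `π`. -/
theorem encard_multiples {f : ℝ → ℝ} (hf : Continuous f) (ha : StrictAnti f)
    (hev : ∀ᶠ l in atTop, f l ∈ Ioo (-Real.pi) 0) (h0 : ∀ m : ℤ, f 0 ≠ m * Real.pi) :
    ∃ n : ℕ, {l : ℝ | 0 < l ∧ ∃ m : ℤ, f l = m * Real.pi}.encard = n ∧
      (n : ℤ) = 1 + ⌊f 0 / Real.pi⌋ := by
  have hpi := Real.pi_pos
  have hlow : ∀ l, -Real.pi < f l := by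
    intro l
    obtain ⟨l', h1, h2⟩ := (hev.and (eventually_ge_atTop l)).exists
    exact h1.1.trans_le (ha.antitone h2)
  obtain ⟨L, hL, hL0⟩ := (hev.and (eventually_ge_atTop 0)).exists
  have hfl : -1 ≤ ⌊f 0 / Real.pi⌋ := by
    rw [Int.le_floor, le_div_iff₀ hpi]
    push_cast
    linarith [hlow 0]
  -- If f 0 lies in (-π, 0), the floor is -1 and n = 0. Otherwise the multiples attained at positive
  -- parameters are m π with 0 ≤ m < n, each exactly once.
  obtain ⟨n, hn⟩ := Int.eq_ofNat_of_zero_le (show 0 ≤ 1 + ⌊f 0 / Real.pi⌋ by linarith)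
  refine ⟨n, ?_, hn.symm⟩
  have hex : ∀ m : ℕ, m < n → ∃ l, 0 < l ∧ f l = m * Real.pi := by
    intro m hm
    have h1 : (m : ℤ) ≤ ⌊f 0 / Real.pi⌋ := by omega
    rw [Int.le_floor, le_div_iff₀ hpi] at h1
    push_cast at h1
    have h2 : (m : ℝ) * Real.pi < f 0 := lt_of_le_of_ne h1 fun e => h0 m (by rw [← e]; simp)
    obtain ⟨l, hl, hl'⟩ := intermediate_value_Icc' hL0 hf.continuousOn
      (show (m : ℝ) * Real.pi ∈ Icc (f L) (f 0) from
        ⟨hL.2.le.trans (by positivity), h2.le⟩)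
    refine ⟨l, lt_of_le_of_ne hl.1 fun e => ?_, hl'⟩
    rw [← e] at hl'; linarith
  choose! g hg0 hg using hex
  have hset : {l : ℝ | 0 < l ∧ ∃ m : ℤ, f l = m * Real.pi} = g '' (Finset.range n : Set ℕ) := by
    ext l
    simp only [mem_ofPred_eq, mem_image, Finset.coe_range, mem_Iio]
    constructor
    · rintro ⟨hl, m, hm⟩
      have h1 : -1 < m := by
        have := hlow l
        rw [hm] at this
        have h2 : (-1 : ℝ) < m := by nlinarith
        exact_mod_cast h2
      have h2 : m ≤ ⌊f 0 / Real.pi⌋ := by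
        rw [Int.le_floor, le_div_iff₀ hpi, ← hm]
        exact (ha hl).le
      obtain ⟨j, rfl⟩ := Int.eq_ofNat_of_zero_le (show 0 ≤ m by omega)
      have hj : j < n := by omega
      refine ⟨j, hj, ha.injective ?_⟩
      rw [hg j hj, hm]; simp
    · rintro ⟨j, hj, rfl⟩
      exact ⟨hg0 j hj, j, by rw [hg j hj]; simp⟩
  rw [hset, InjOn.encard_image, Set.encard_coe_eq_coe_finsetCard, Finset.card_range]
  intro i hi j hj hij
  have hi' : i < n := by simpa using hi
  have hj' : j < n := by simpa using hj
  have := hg i hi'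
  rw [hij, hg j hj'] at this
  exact_mod_cast (mul_right_cancel₀ hpi.ne' this).symm

/-! ### Solutions that are regular at both poles -/

/-- Solutions on `(0, π)` that are regular at both poles. -/
structure FullSol (h : ℝ → ℝ → ℝ → ℝ) (u v : ℝ → ℝ) : Prop where
  sol : Sol h Real.pi u v
  cu : ContinuousOn u (Icc 0 Real.pi)
  cv : ContinuousOn v (Icc 0 Real.pi)
  v0 : v 0 = 0
  vpi : v Real.pi = 0

lemma FullSol.regSol {h : ℝ → ℝ → ℝ → ℝ} {u v : ℝ → ℝ} (H : FullSol h u v) :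
    RegSol h Real.pi (u 0) u v :=
  ⟨H.sol, H.cu.mono Ico_subset_Icc_self, H.cv.mono Ico_subset_Icc_self, rfl, H.v0⟩

/-- Reflection `θ ↦ π - θ` of a coefficient function. -/
def mirror (h : ℝ → ℝ → ℝ → ℝ) (θ u p : ℝ) : ℝ := h (Real.pi - θ) u (-p)

lemma pi_sub_mem_Ioo {θ : ℝ} (h : θ ∈ Ioo 0 Real.pi) : Real.pi - θ ∈ Ioo 0 Real.pi :=
  ⟨by linarith [h.2], by linarith [h.1]⟩

lemma pi_sub_mem_Icc {θ : ℝ} (h : θ ∈ Icc 0 Real.pi) : Real.pi - θ ∈ Icc 0 Real.pi :=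
  ⟨by linarith [h.2], by linarith [h.1]⟩

lemma Sol.mirror {h : ℝ → ℝ → ℝ → ℝ} {u v : ℝ → ℝ} (H : Sol h Real.pi u v) :
    Sol (mirror h) Real.pi (fun θ => u (Real.pi - θ)) (fun θ => -v (Real.pi - θ)) := by
  intro θ hθ
  obtain ⟨h1, h2⟩ := H _ (pi_sub_mem_Ioo hθ)
  have hl : HasDerivAt (fun θ : ℝ => Real.pi - θ) (-1) θ := (hasDerivAt_id θ).const_sub _
  refine ⟨(h1.comp θ hl).congr_deriv (by ring), ((h2.comp θ hl).neg).congr_deriv ?_⟩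
  simp only [AxisymShooting.mirror, neg_neg, Real.cos_pi_sub, Real.sin_pi_sub]
  ring

lemma FullSol.mirror {h : ℝ → ℝ → ℝ → ℝ} {u v : ℝ → ℝ} (H : FullSol h u v) :
    FullSol (mirror h) (fun θ => u (Real.pi - θ)) (fun θ => -v (Real.pi - θ)) :=
  ⟨H.sol.mirror, H.cu.comp (by fun_prop) fun _ h => pi_sub_mem_Icc h,
    (H.cv.comp (by fun_prop) fun _ h => pi_sub_mem_Icc h).neg, by simp [H.vpi], by simp [H.v0]⟩

lemma mirror_mirror (h : ℝ → ℝ → ℝ → ℝ) : mirror (mirror h) = h := by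
  funext θ u p; simp [mirror]

/-- Gluing solutions regular at `0` and at `π`. -/
theorem exists_fullSol {h : ℝ → ℝ → ℝ → ℝ} (hl : LocLip h) {u v u' v' : ℝ → ℝ} {d e : ℝ}
    (H : RegSol h Real.pi d u v) (H' : RegSol (mirror h) Real.pi e u' v') {θ₀ : ℝ}
    (h₀ : θ₀ ∈ Ioo 0 Real.pi) (eu : u θ₀ = u' (Real.pi - θ₀)) (ev : v θ₀ = -v' (Real.pi - θ₀)) :
    FullSol h (Function.update u Real.pi e) (Function.update v Real.pi 0) := by
  have hs' := H'.sol.mirror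
  rw [mirror_mirror] at hs'
  have heq := Sol.eq hl le_rfl H.sol hs' h₀ eu ev
  have hupd : ∀ (w : ℝ → ℝ) (x θ : ℝ), θ ∈ Ioo 0 Real.pi →
      Function.update w Real.pi x =ᶠ[𝓝 θ] w := fun w x θ hθ => by
    filter_upwards [isOpen_ne.mem_nhds hθ.2.ne] with t ht using Function.update_of_ne ht _ _
  have hlim : ∀ (w w' : ℝ → ℝ) (x : ℝ), ContinuousOn w (Ico 0 Real.pi) →
      ContinuousWithinAt w' (Ico 0 Real.pi) 0 → w' 0 = x →
      (∀ θ ∈ Ioo 0 Real.pi, w θ = w' (Real.pi - θ)) →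
      ContinuousOn (Function.update w Real.pi x) (Icc 0 Real.pi) := by
    intro w w' x hw hw' hx hww θ hθ
    rcases hθ.2.eq_or_lt with he | he
    · rw [he, continuousWithinAt_update_same]
      have h1 : Tendsto (fun θ => Real.pi - θ) (𝓝[Icc 0 Real.pi \ {Real.pi}] Real.pi)
          (𝓝[Ico 0 Real.pi] 0) := by
        refine tendsto_nhdsWithin_iff.2 ⟨?_, ?_⟩
        · have : Continuous fun θ : ℝ => Real.pi - θ := by fun_prop
          have := this.tendsto Real.pi
          rw [sub_self] at this
          exact this.mono_left nhdsWithin_le_nhds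
        · filter_upwards [self_mem_nhdsWithin,
            mem_nhdsWithin_of_mem_nhds (Ioi_mem_nhds Real.pi_pos)] with t ht ht'
          have ht' : 0 < t := ht'
          exact ⟨by linarith [ht.1.2], by linarith⟩
      rw [← hx]
      refine (hw'.tendsto.comp h1).congr' ?_
      filter_upwards [self_mem_nhdsWithin,
        mem_nhdsWithin_of_mem_nhds (Ioi_mem_nhds Real.pi_pos)] with t ht ht'
      exact (hww t ⟨ht', lt_of_le_of_ne ht.1.2 ht.2⟩).symm
    · have h1 := hw θ ⟨hθ.1, he⟩
      have h2 : Function.update w Real.pi x =ᶠ[𝓝 θ] w := by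
        filter_upwards [isOpen_ne.mem_nhds he.ne] with t ht using Function.update_of_ne ht _ _
      have h3 : ContinuousWithinAt w (Icc 0 Real.pi) θ := by
        refine h1.mono_of_mem_nhdsWithin ?_
        filter_upwards [self_mem_nhdsWithin, mem_nhdsWithin_of_mem_nhds (Iio_mem_nhds he)]
          with t ht ht' using ⟨ht.1, ht'⟩
      exact h3.congr_of_eventuallyEq (h2.filter_mono nhdsWithin_le_nhds)
        (Function.update_of_ne he.ne _ _)
  have h0 : (0:ℝ) ∈ Ico 0 Real.pi := ⟨le_rfl, Real.pi_pos⟩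
  refine ⟨fun θ hθ => ?_, hlim u u' e H.cu (H'.cu 0 h0) H'.u0 fun θ hθ => (heq θ hθ).1,
    hlim v (fun t => -v' t) 0 H.cv (H'.cv 0 h0).neg (by simp [H'.v0]) fun θ hθ => (heq θ hθ).2,
    ?_, by simp⟩
  · rw [Function.update_of_ne hθ.2.ne, Function.update_of_ne hθ.2.ne]
    exact ⟨(H.sol θ hθ).1.congr_of_eventuallyEq (hupd u e θ hθ),
      (H.sol θ hθ).2.congr_of_eventuallyEq (hupd v 0 θ hθ)⟩
  · rw [Function.update_of_ne Real.pi_pos.ne, H.v0]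

/-! ### C² regularity up to the poles -/

/-- The second derivative has a limit at the pole. -/
lemma tendsto_second_deriv {v r : ℝ → ℝ} {b : ℝ} (hb : 0 < b) (hbpi : b ≤ Real.pi)
    (hv : Tendsto v (𝓝[>] 0) (𝓝 0)) {r₀ : ℝ} (hr : Tendsto r (𝓝[>] 0) (𝓝 r₀))
    (hd : ∀ θ ∈ Ioo 0 b, HasDerivAt v (r θ - cos θ / sin θ * v θ) θ) :
    Tendsto (fun θ => r θ - cos θ / sin θ * v θ) (𝓝[>] 0) (𝓝 (r₀ / 2)) := by
  have hsin : Tendsto sin (𝓝[>] 0) (𝓝 0) := by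
    have := Real.continuous_sin.tendsto 0
    rw [Real.sin_zero] at this
    exact this.mono_left nhdsWithin_le_nhds
  have hcos : Tendsto cos (𝓝[>] 0) (𝓝 1) := by
    have := Real.continuous_cos.tendsto 0
    rw [Real.cos_zero] at this
    exact this.mono_left nhdsWithin_le_nhds
  have hcos0 : ∀ᶠ θ in 𝓝[>] 0, 0 < cos θ := hcos.eventually (lt_mem_nhds one_pos)
  -- l'Hôpital: the derivatives sin θ · r and 2 sin θ cos θ have quotient tending to r₀ / 2. Thus
  -- cot θ · v takes away half of r₀.
  have h1 : Tendsto (fun θ => (sin θ * v θ) / (sin θ ^ 2)) (𝓝[>] 0) (𝓝 (r₀ / 2)) := by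
    refine HasDerivAt.lhopital_zero_nhdsGT (f' := fun θ => sin θ * r θ)
      (g' := fun θ => 2 * sin θ * cos θ) ?_ ?_ ?_ ?_ ?_ ?_
    · filter_upwards [Ioo_mem_nhdsGT hb] with θ hθ
      exact hasDerivAt_sin_mul (sin_pos_of_mem ⟨hθ.1, hθ.2.trans_le hbpi⟩).ne' (hd θ hθ)
    · filter_upwards with θ
      refine ((Real.hasDerivAt_sin θ).pow 2).congr_deriv ?_
      simp
    · filter_upwards [hcos0, Ioo_mem_nhdsGT hb] with θ hc hθ
      have := sin_pos_of_mem ⟨hθ.1, hθ.2.trans_le hbpi⟩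
      positivity
    · have := hsin.mul hv
      rwa [zero_mul] at this
    · have := hsin.pow 2
      rwa [zero_pow two_ne_zero] at this
    · have h2 : Tendsto (fun θ => r θ / (2 * cos θ)) (𝓝[>] 0) (𝓝 (r₀ / (2 * 1))) :=
        hr.div (hcos.const_mul 2) (by norm_num)
      rw [mul_one] at h2
      refine h2.congr' ?_
      filter_upwards [Ioo_mem_nhdsGT hb] with θ hθ
      have := (sin_pos_of_mem ⟨hθ.1, hθ.2.trans_le hbpi⟩).ne'
      rw [mul_comm 2 (sin θ), mul_assoc, mul_div_mul_left _ _ this]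
  have h3 := hr.sub (hcos.mul h1)
  rw [one_mul, show r₀ - r₀ / 2 = r₀ / 2 by ring] at h3
  refine h3.congr' ?_
  filter_upwards [Ioo_mem_nhdsGT hb] with θ hθ
  have := (sin_pos_of_mem ⟨hθ.1, hθ.2.trans_le hbpi⟩).ne'
  field_simp

lemma contDiffOn_two_of_hasDerivWithinAt {u v w : ℝ → ℝ} {a b : ℝ} (hab : a < b)
    (hu : ∀ t ∈ Icc a b, HasDerivWithinAt u (v t) (Icc a b) t)
    (hv : ∀ t ∈ Icc a b, HasDerivWithinAt v (w t) (Icc a b) t)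
    (hw : ContinuousOn w (Icc a b)) : ContDiffOn ℝ 2 u (Icc a b) := by
  have hun := uniqueDiffOn_Icc hab
  have h1 : ContDiffOn ℝ 1 v (Icc a b) := by
    rw [show (1 : WithTop ℕ∞) = 0 + 1 from (zero_add 1).symm, contDiffOn_succ_iff_derivWithin hun]
    refine ⟨fun t ht => (hv t ht).differentiableWithinAt, by simp, ?_⟩
    rw [contDiffOn_zero]
    exact hw.congr fun t ht => (hv t ht).derivWithin (hun t ht)
  rw [show (2 : WithTop ℕ∞) = 1 + 1 from one_add_one_eq_two.symm,
    contDiffOn_succ_iff_derivWithin hun]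
  exact ⟨fun t ht => (hu t ht).differentiableWithinAt, by simp,
    h1.congr fun t ht => (hu t ht).derivWithin (hun t ht)⟩

lemma hasDerivWithinAt_Icc_of_tendsto {x y : ℝ → ℝ} {a b l₁ l₂ : ℝ} (hab : a < b)
    (hx : ContinuousOn x (Icc a b)) (hd : ∀ t ∈ Ioo a b, HasDerivAt x (y t) t)
    (h₁ : Tendsto y (𝓝[>] a) (𝓝 l₁)) (h₂ : Tendsto y (𝓝[<] b) (𝓝 l₂)) :
    HasDerivWithinAt x l₁ (Icc a b) a ∧ HasDerivWithinAt x l₂ (Icc a b) b := by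
  have hdiff : DifferentiableOn ℝ x (Ioo a b) := fun t ht =>
    (hd t ht).differentiableAt.differentiableWithinAt
  constructor
  · refine (hasDerivWithinAt_Ici_of_tendsto_deriv hdiff
      ((hx a ⟨le_rfl, hab.le⟩).mono Ioo_subset_Icc_self) (Ioo_mem_nhdsGT hab)
      (h₁.congr' ?_)).mono Icc_subset_Ici_self
    filter_upwards [Ioo_mem_nhdsGT hab] with t ht using (hd t ht).deriv.symm
  · refine (hasDerivWithinAt_Iic_of_tendsto_deriv hdiff
      ((hx b ⟨hab.le, le_rfl⟩).mono Ioo_subset_Icc_self) (Ioo_mem_nhdsLT hab)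
      (h₂.congr' ?_)).mono Icc_subset_Iic_self
    filter_upwards [Ioo_mem_nhdsLT hab] with t ht using (hd t ht).deriv.symm

lemma tendsto_nhdsGT_of_continuousOn {f : ℝ → ℝ} {a b : ℝ} (hab : a < b)
    (hf : ContinuousOn f (Icc a b)) : Tendsto f (𝓝[>] a) (𝓝 (f a)) := by
  rw [← nhdsWithin_Ioo_eq_nhdsGT hab]
  exact (hf a ⟨le_rfl, hab.le⟩).mono_left (nhdsWithin_mono _ Ioo_subset_Icc_self)

lemma tendsto_nhdsLT_of_continuousOn {f : ℝ → ℝ} {a b : ℝ} (hab : a < b)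
    (hf : ContinuousOn f (Icc a b)) : Tendsto f (𝓝[<] b) (𝓝 (f b)) := by
  rw [← nhdsWithin_Ioo_eq_nhdsLT hab]
  exact (hf b ⟨hab.le, le_rfl⟩).mono_left (nhdsWithin_mono _ Ioo_subset_Icc_self)

lemma tendsto_pi_sub : Tendsto (fun θ => Real.pi - θ) (𝓝[<] Real.pi) (𝓝[>] 0) := by
  refine tendsto_nhdsWithin_iff.2 ⟨?_, ?_⟩
  · have : Continuous fun θ : ℝ => Real.pi - θ := by fun_prop
    have := this.tendsto Real.pi
    rw [sub_self] at this
    exact this.mono_left nhdsWithin_le_nhds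
  · filter_upwards [self_mem_nhdsWithin] with t ht
    exact sub_pos.2 (mem_Iio.1 ht)

/-- Solutions regular at both poles are twice continuously differentiable. -/
theorem FullSol.contDiffOn {h : ℝ → ℝ → ℝ → ℝ} {u v : ℝ → ℝ} (H : FullSol h u v)
    (hr : ContinuousOn (fun θ => h θ (u θ) (v θ)) (Icc 0 Real.pi)) :
    ContDiffOn ℝ 2 u (Icc 0 Real.pi) ∧
      ∀ θ ∈ Icc 0 Real.pi, HasDerivWithinAt u (v θ) (Icc 0 Real.pi) θ := by
  have hpi := Real.pi_pos
  have hu : ∀ θ ∈ Icc 0 Real.pi, HasDerivWithinAt u (v θ) (Icc 0 Real.pi) θ := by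
    intro θ hθ
    obtain ⟨e1, e2⟩ := hasDerivWithinAt_Icc_of_tendsto hpi H.cu (fun t ht => (H.sol t ht).1)
      (tendsto_nhdsGT_of_continuousOn hpi H.cv) (tendsto_nhdsLT_of_continuousOn hpi H.cv)
    rcases hθ.1.eq_or_lt with h0 | h0
    · rw [← h0]; exact e1
    rcases hθ.2.eq_or_lt with h1 | h1
    · rw [h1]; exact e2
    exact (H.sol θ ⟨h0, h1⟩).1.hasDerivWithinAt
  have hv0 : Tendsto v (𝓝[>] 0) (𝓝 0) := by
    have := tendsto_nhdsGT_of_continuousOn hpi H.cv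
    rwa [H.v0] at this
  have t0 := tendsto_second_deriv hpi le_rfl hv0 (tendsto_nhdsGT_of_continuousOn hpi hr)
    fun θ hθ => (H.sol θ hθ).2
  have hv1 : Tendsto (fun θ => -v (Real.pi - θ)) (𝓝[>] 0) (𝓝 0) := by
    have := tendsto_nhdsGT_of_continuousOn hpi H.mirror.cv
    simpa [H.vpi] using this
  have hr1 : Tendsto (fun θ => AxisymShooting.mirror h θ (u (Real.pi - θ)) (-v (Real.pi - θ)))
      (𝓝[>] 0)
      (𝓝 (h Real.pi (u Real.pi) (v Real.pi))) := by
    have := tendsto_nhdsGT_of_continuousOn hpi (hr.comp (f := fun θ => Real.pi - θ) (by fun_prop)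
      fun _ h => pi_sub_mem_Icc h)
    simpa [AxisymShooting.mirror, Function.comp_def] using this
  have t1 := tendsto_second_deriv hpi le_rfl hv1 hr1 fun θ hθ => (H.mirror.sol θ hθ).2
  have t2 : Tendsto (fun θ => h θ (u θ) (v θ) - cos θ / sin θ * v θ) (𝓝[<] Real.pi)
      (𝓝 (h Real.pi (u Real.pi) (v Real.pi) / 2)) := by
    refine (t1.comp tendsto_pi_sub).congr fun θ => ?_
    simp only [Function.comp_apply, AxisymShooting.mirror, sub_sub_cancel, neg_neg, Real.cos_pi_sub,
      Real.sin_pi_sub]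
    ring
  refine ⟨?_, hu⟩
  set w₀ : ℝ → ℝ := fun θ => h θ (u θ) (v θ) - cos θ / sin θ * v θ with hw₀
  obtain ⟨e1, e2⟩ := hasDerivWithinAt_Icc_of_tendsto hpi H.cv (fun t ht => (H.sol t ht).2) t0 t2
  have hw₀c : ContinuousOn w₀ (Ioo 0 Real.pi) := by
    refine (hr.mono Ioo_subset_Icc_self).sub (ContinuousOn.mul (ContinuousOn.div (by fun_prop)
      (by fun_prop) fun t ht => (sin_pos_of_mem ht).ne') (H.cv.mono Ioo_subset_Icc_self))
  refine contDiffOn_two_of_hasDerivWithinAt (w := extendFrom (Ioo 0 Real.pi) w₀) hpi hu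
    (fun θ hθ => ?_) (continuousOn_Icc_extendFrom_Ioo hw₀c t0 t2)
  rcases hθ.1.eq_or_lt with h0 | h0
  · rw [← h0, eq_lim_at_left_extendFrom_Ioo hpi t0]; exact e1
  rcases hθ.2.eq_or_lt with h1 | h1
  · rw [h1, eq_lim_at_right_extendFrom_Ioo hpi t2]; exact e2
  rw [extendFrom_extends hw₀c θ ⟨h0, h1⟩]
  exact (H.sol θ ⟨h0, h1⟩).2.hasDerivWithinAt

/-! ### Equilibria as regular solutions -/

lemma hasDerivAt_of_contDiffOn_two {E : Type*} [NormedAddCommGroup E] [NormedSpace ℝ E]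
    {u : ℝ → E} {a b : ℝ} (hab : a < b) (hu : ContDiffOn ℝ 2 u (Icc a b)) :
    ContinuousOn (derivWithin u (Icc a b)) (Icc a b) ∧
    ∀ t ∈ Ioo a b, derivWithin u (Icc a b) t = deriv u t ∧
      HasDerivAt u (derivWithin u (Icc a b) t) t ∧
      HasDerivAt (derivWithin u (Icc a b)) (deriv (deriv u) t) t := by
  have hun := uniqueDiffOn_Icc hab
  rw [show (2 : WithTop ℕ∞) = 1 + 1 from one_add_one_eq_two.symm,
    contDiffOn_succ_iff_derivWithin hun] at hu
  obtain ⟨h1, -, h2⟩ := hu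
  refine ⟨h2.continuousOn, fun t ht => ?_⟩
  have hn : ∀ t ∈ Ioo a b, Icc a b ∈ 𝓝 t := fun t ht => Icc_mem_nhds ht.1 ht.2
  have he : ∀ t ∈ Ioo a b, derivWithin u (Icc a b) t = deriv u t := fun t ht =>
    derivWithin_of_mem_nhds (hn t ht)
  have hev : derivWithin u (Icc a b) =ᶠ[𝓝 t] deriv u := by
    filter_upwards [Ioo_mem_nhds ht.1 ht.2] with s hs using he s hs
  refine ⟨he t ht, ?_, ?_⟩
  · rw [he t ht]
    exact ((h1 t (Ioo_subset_Icc_self ht)).differentiableAt (hn t ht)).hasDerivAt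
  · rw [← hev.deriv_eq]
    exact (((h2.differentiableOn one_ne_zero) t (Ioo_subset_Icc_self ht)).differentiableAt
      (hn t ht)).hasDerivAt

/-- With v = `derivWithin u` the Neumann conditions become values of v at the poles, and v is
continuous up to them. -/
lemma IsEquilibrium.fullSol {a f : ℝ → ℝ → ℝ → ℝ} (H : Hyp a f) {u : ℝ → ℝ}
    (hu : IsEquilibrium a f u) : ∃ v, FullSol (rhs a f) u v ∧ ∀ θ ∈ Ioo 0 Real.pi,
      deriv u θ = v θ := by
  obtain ⟨hc, hd⟩ := hasDerivAt_of_contDiffOn_two Real.pi_pos hu.contDiffOn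
  refine ⟨derivWithin u (Icc 0 Real.pi), ⟨fun θ hθ => ?_, hu.contDiffOn.continuousOn, hc,
    hu.neumann_zero, hu.neumann_pi⟩, fun θ hθ => (hd θ hθ).1.symm⟩
  obtain ⟨h1, h2, h3⟩ := hd θ hθ
  refine ⟨h2, h3.congr_deriv ?_⟩
  have he := hu.equation θ hθ
  have ha := H.a_pos (Ioo_subset_Icc_self hθ) (u θ) (deriv u θ)
  simp only [sphLap, smul_eq_mul] at he
  rw [h1, rhs, eq_neg_of_add_eq_zero_right he]
  field_simp
  ring

lemma FullSol.continuousOn_rhs {h : ℝ → ℝ → ℝ → ℝ} (hh : C2 h) {u v : ℝ → ℝ} (hs : FullSol h u v) :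
    ContinuousOn (fun θ => h θ (u θ) (v θ)) (Icc 0 Real.pi) :=
  hh.continuousOn.comp (f := fun θ => (θ, u θ, v θ)) (continuousOn_id.prodMk (hs.cu.prodMk hs.cv))
    fun _ ht => ⟨ht, mem_univ _⟩

lemma Sol.deriv_eq {h : ℝ → ℝ → ℝ → ℝ} {b : ℝ} {u v : ℝ → ℝ} (hs : Sol h b u v) {θ : ℝ}
    (hθ : θ ∈ Ioo 0 b) : deriv u θ = v θ ∧
      deriv (deriv u) θ = h θ (u θ) (v θ) - cos θ / sin θ * v θ := by
  have h1 : deriv u =ᶠ[𝓝 θ] v := by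
    filter_upwards [Ioo_mem_nhds hθ.1 hθ.2] with t ht using (hs t ht).1.deriv
  exact ⟨(hs θ hθ).1.deriv, by rw [h1.deriv_eq, (hs θ hθ).2.deriv]⟩

lemma FullSol.isEquilibrium {a f : ℝ → ℝ → ℝ → ℝ} (H : Hyp a f) {u v : ℝ → ℝ}
    (hs : FullSol (rhs a f) u v) : IsEquilibrium a f u := by
  obtain ⟨h1, h2⟩ := hs.contDiffOn (hs.continuousOn_rhs H.c2)
  have hun := uniqueDiffOn_Icc Real.pi_pos
  have m0 : (0:ℝ) ∈ Icc 0 Real.pi := ⟨le_rfl, Real.pi_pos.le⟩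
  have m1 : Real.pi ∈ Icc 0 Real.pi := ⟨Real.pi_pos.le, le_rfl⟩
  refine ⟨h1, by rw [(h2 0 m0).derivWithin (hun 0 m0), hs.v0],
    by rw [(h2 _ m1).derivWithin (hun _ m1), hs.vpi], fun θ hθ => ?_⟩
  obtain ⟨e1, e2⟩ := hs.sol.deriv_eq hθ
  have ha := H.a_pos (Ioo_subset_Icc_self hθ) (u θ) (v θ)
  rw [sphLap, e1, e2, rhs, smul_eq_mul]
  field_simp
  ring

lemma FullSol.congr {h : ℝ → ℝ → ℝ → ℝ} {u v u' : ℝ → ℝ} (hs : FullSol h u v)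
    (he : EqOn u' u (Icc 0 Real.pi)) : FullSol h u' v := by
  refine ⟨fun θ hθ => ?_, hs.cu.congr he, hs.cv, hs.v0, hs.vpi⟩
  have : u' =ᶠ[𝓝 θ] u := by
    filter_upwards [Icc_mem_nhds hθ.1 hθ.2] with t ht using he ht
  rw [he (Ioo_subset_Icc_self hθ)]
  exact ⟨(hs.sol θ hθ).1.congr_of_eventuallyEq this, (hs.sol θ hθ).2⟩

/-- At the poles the two-sided `deriv u` carries no information about u on [0, π], but the factor
sin θ removes it. -/
lemma phasePoint_eq {u v : ℝ → ℝ} (hd : ∀ θ ∈ Ioo 0 Real.pi, deriv u θ = v θ) {θ : ℝ}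
    (hθ : θ ∈ Icc 0 Real.pi) : phasePoint u θ = (u θ, sin θ * v θ) := by
  rcases hθ.1.eq_or_lt with h0 | h0
  · simp [phasePoint, ← h0]
  rcases hθ.2.eq_or_lt with h1 | h1
  · simp [phasePoint, h1]
  rw [phasePoint, hd θ ⟨h0, h1⟩]

/-! ### Reflection -/

/-- The reflection `(θ, u, p) ↦ (π - θ, u, -p)` of phase space. -/
def flip (x : ℝ × ℝ × ℝ) : ℝ × ℝ × ℝ := (Real.pi - x.1, x.2.1, -x.2.2)

lemma flip_flip (x : ℝ × ℝ × ℝ) : flip (flip x) = x := by simp [flip]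

lemma continuous_flip : Continuous flip := by unfold flip; fun_prop

lemma norm_flip_sub (x y : ℝ × ℝ × ℝ) : ‖flip x - flip y‖ = ‖x - y‖ := by
  have h1 : ‖Real.pi - x.1 - (Real.pi - y.1)‖ = ‖x.1 - y.1‖ := by
    rw [sub_sub_sub_cancel_left, norm_sub_rev]
  have h2 : ‖-x.2.2 - -y.2.2‖ = ‖x.2.2 - y.2.2‖ := by
    rw [neg_sub_neg, norm_sub_rev]
  simp only [flip, Prod.norm_def, Prod.fst_sub, Prod.snd_sub, h1, h2]

/-- Replacing θ by π - θ reverses θ_τ = sin θ, so time has to be reversed as well, and then p = u_τ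
changes sign. -/
lemma IsShootOrbit.mirror {a f : ℝ → ℝ → ℝ → ℝ} {g : ℝ → ℝ × ℝ × ℝ} (hg : IsShootOrbit a f g) :
    IsShootOrbit (mirror a) (mirror f) fun τ => flip (g (-τ)) := by
  intro τ
  obtain ⟨h1, h2⟩ := hg (-τ)
  refine ⟨pi_sub_mem_Icc h1, ?_⟩
  have hn : HasDerivAt (fun τ : ℝ => -τ) (-1) τ := hasDerivAt_neg τ
  have d1 : HasDerivAt (fun τ => (g τ).1) _ (-τ) := h2.fst
  have d2 : HasDerivAt (fun τ => (g τ).2.1) _ (-τ) := h2.snd.fst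
  have d3 : HasDerivAt (fun τ => (g τ).2.2) _ (-τ) := h2.snd.snd
  have := ((d1.comp τ hn).const_sub Real.pi).prodMk ((d2.comp τ hn).prodMk (d3.comp τ hn).neg)
  refine this.congr_deriv ?_
  simp only [shootField, flip, AxisymShooting.mirror, Real.sin_pi_sub, sub_sub_cancel, neg_div,
    neg_neg]
  ext <;> simp only <;> ring

lemma C2.mirror {h : ℝ → ℝ → ℝ → ℝ} (hh : C2 h) : C2 (mirror h) := by
  have : ContDiff ℝ 2 flip := by unfold flip; fun_prop
  exact ContDiffOn.comp hh this.contDiffOn fun x hx => ⟨pi_sub_mem_Icc hx.1, mem_univ _⟩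

lemma Hyp.mirror {a f : ℝ → ℝ → ℝ → ℝ} (H : Hyp a f) : Hyp (mirror a) (mirror f) := by
  refine ⟨H.ha.mirror, H.hf.mirror, ?_, ?_, fun x hx => ?_⟩
  · obtain ⟨ε, hε, h⟩ := H.pos
    exact ⟨ε, hε, fun θ hθ u p => h _ (pi_sub_mem_Icc hθ) _ _⟩
  · obtain ⟨κ, hκ, f₁, f₂, h1, h2, h⟩ := H.growth
    refine ⟨κ, hκ, f₁, f₂, h1, h2, fun θ hθ u p => ?_⟩
    have := h _ (pi_sub_mem_Icc hθ) u (-p)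
    rwa [abs_neg] at this
  · obtain ⟨g, hg, hg0⟩ := H.global (flip x) (pi_sub_mem_Ioo hx)
    exact ⟨_, hg.mirror, by simp only [neg_zero, hg0, flip_flip]⟩

/-- `flip` is an isometry and time reversal exchanges the ends of an orbit, so the exponential
estimate keeps its constants. Through this equivalence the results on stable manifolds are inherited
from those on unstable ones. -/
lemma mem_Ws_iff {a f : ℝ → ℝ → ℝ → ℝ} {e : ℝ} {x : ℝ × ℝ × ℝ} :
    x ∈ Ws a f e ↔ flip x ∈ Wu (mirror a) (mirror f) e := by
  have hf : flip (Real.pi, e, 0) = (0, e, 0) := by simp [flip]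
  have hf' : flip (0, e, 0) = (Real.pi, e, 0) := by simp [flip]
  constructor
  · rintro ⟨g, hg, ⟨r, hr, C, hC⟩, hx⟩
    refine ⟨_, hg.mirror, ⟨r, hr, C, fun τ hτ => ?_⟩, ?_⟩
    · rw [← hf, norm_flip_sub]
      have := hC (-τ) (neg_nonneg.2 hτ)
      rwa [neg_mul_neg] at this
    · rcases hx with ⟨τ, hτ⟩ | hx
      · exact Or.inl ⟨-τ, by simp [hτ]⟩
      · exact Or.inr ((continuous_flip.tendsto x).comp (hx.comp tendsto_neg_atTop_atBot))
  · rintro ⟨g, hg, ⟨r, hr, C, hC⟩, hx⟩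
    have hg' := hg.mirror
    rw [mirror_mirror, mirror_mirror] at hg'
    refine ⟨_, hg', ⟨r, hr, C, fun τ hτ => ?_⟩, ?_⟩
    · rw [← hf', norm_flip_sub]
      have := hC (-τ) (neg_nonpos.2 hτ)
      rwa [mul_neg, ← neg_mul] at this
    · rcases hx with ⟨τ, hτ⟩ | hx
      · exact Or.inl ⟨-τ, by simp [hτ, flip_flip]⟩
      · refine Or.inr ?_
        have := (continuous_flip.tendsto _).comp (hx.comp tendsto_neg_atBot_atTop)
        rwa [flip_flip] at this

/-! ### Intersections of the shooting manifolds -/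

lemma FullSol.mem_Wu {a f : ℝ → ℝ → ℝ → ℝ} (H : Hyp a f) {u v : ℝ → ℝ}
    (hs : FullSol (rhs a f) u v) {θ : ℝ} (hθ : θ ∈ Icc 0 Real.pi) :
    (θ, u θ, sin θ * v θ) ∈ Wu a f (u 0) := by
  rcases hθ.1.eq_or_lt with h0 | h0
  · rw [← h0, mem_Wu_zero_iff H]; simp
  rcases hθ.2.eq_or_lt with h1 | h1
  · rw [h1, mem_Wu_pi_iff H]
    refine ⟨u, v, hs.regSol, ?_⟩
    have hpi := Real.pi_pos
    have t := ((tendsto_nhdsLT_of_continuousOn hpi continuousOn_id).prodMk_nhds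
      ((tendsto_nhdsLT_of_continuousOn hpi hs.cu).prodMk_nhds
      (tendsto_nhdsLT_of_continuousOn hpi
        (Real.continuous_sin.continuousOn.mul hs.cv)))).comp height_tendsto_atTop
    exact t
  · exact (mem_Wu_iff H ⟨h0, h1⟩ _).2 ⟨u, v, hs.regSol, rfl⟩

lemma FullSol.mem_Ws {a f : ℝ → ℝ → ℝ → ℝ} (H : Hyp a f) {u v : ℝ → ℝ}
    (hs : FullSol (rhs a f) u v) {θ : ℝ} (hθ : θ ∈ Icc 0 Real.pi) :
    (θ, u θ, sin θ * v θ) ∈ Ws a f (u Real.pi) := by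
  have := FullSol.mem_Wu H.mirror (u := fun θ => u (Real.pi - θ))
    (v := fun θ => -v (Real.pi - θ)) hs.mirror (pi_sub_mem_Icc hθ)
  rw [mem_Ws_iff, flip]
  simpa using this

/-- An orbit that runs from one pole to the other is regular at both. -/
lemma exists_fullSol_of_tendsto {a f : ℝ → ℝ → ℝ → ℝ} (H : Hyp a f) {u v : ℝ → ℝ} {d e : ℝ}
    (hs : RegSol (rhs a f) Real.pi d u v) (ht : Tendsto (orb u v) atTop (𝓝 (Real.pi, e, 0))) :
    ∃ u v, FullSol (rhs a f) u v ∧ u 0 = d ∧ u Real.pi = e := by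
  have ho := (isShootOrbit_orb hs.sol).mirror
  have ht' : Tendsto (fun τ => flip (orb u v (-τ))) atBot (𝓝 (0, e, 0)) := by
    have := (continuous_flip.tendsto _).comp (ht.comp tendsto_neg_atBot_atTop)
    rwa [show flip (Real.pi, e, 0) = (0, e, 0) by simp [flip]] at this
  -- Reflected and reversed, the orbit converges backwards to (0, e, 0); so the regularity theorem
  -- at the pole 0 also covers the pole π.
  rcases orbit_of_tendsto H.mirror ho ht' with h | ⟨u', v', c, hs', ho'⟩
  · have := congrArg Prod.fst (h 0)
    simp only [flip, orb] at this
    linarith [(height_mem (-0)).2]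
  · have h0 := ho' 0
    simp only [flip, orb, neg_zero, zero_add, Prod.mk.injEq] at h0
    obtain ⟨e1, e2, e3⟩ := h0
    rw [← e1] at e2 e3
    have hm := height_mem 0
    have hsin := (sin_pos_of_mem hm).ne'
    rw [Real.sin_pi_sub, ← mul_neg] at e3
    have h4 := exists_fullSol H.c2.locLip hs hs' hm e2
      (by rw [← mul_left_cancel₀ hsin e3, neg_neg])
    exact ⟨_, _, h4, by rw [Function.update_of_ne Real.pi_pos.ne, hs.u0], by simp⟩

/-- Points in the intersection of the shooting manifolds come from equilibria. -/
theorem exists_fullSol_of_mem {a f : ℝ → ℝ → ℝ → ℝ} (H : Hyp a f) {θ d e : ℝ}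
    (hθ : θ ∈ Icc 0 Real.pi) {q : ℝ × ℝ} (h1 : (θ, q) ∈ Wu a f d) (h2 : (θ, q) ∈ Ws a f e) :
    ∃ u v, FullSol (rhs a f) u v ∧ u 0 = d ∧ u Real.pi = e ∧ q = (u θ, sin θ * v θ) := by
  rw [mem_Ws_iff] at h2
  rcases hθ.1.eq_or_lt with e0 | e0
  · rw [← e0] at h1 h2
    -- At height 0 the point must be (d, 0), and it lies in the stable manifold only as the backward
    -- limit of an orbit.
    rw [mem_Wu_zero_iff H] at h1
    rw [h1] at h2
    simp only [flip, sub_zero, neg_zero] at h2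
    obtain ⟨u', v', hs', ht'⟩ := (mem_Wu_pi_iff H.mirror _).1 h2
    obtain ⟨u, v, hs, k1, k2⟩ := exists_fullSol_of_tendsto H.mirror hs' ht'
    have hs2 : FullSol (rhs a f) (fun θ => u (Real.pi - θ)) fun θ => -v (Real.pi - θ) := by
      have := hs.mirror
      -- `rhs (mirror a) (mirror f)` and `mirror (rhs a f)` agree by definition.
      rwa [show mirror (rhs (mirror a) (mirror f)) = rhs a f from mirror_mirror (rhs a f)] at this
    refine ⟨_, _, hs2, by simp [k2], by simp [k1], ?_⟩
    · rw [h1, ← e0]; simp [k2]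
  rcases hθ.2.eq_or_lt with e1 | e1
  · rw [e1] at h1 h2
    simp only [flip, sub_self] at h2
    rw [mem_Wu_zero_iff H.mirror, Prod.mk.injEq, neg_eq_zero] at h2
    have hq : q = (e, 0) := Prod.ext h2.1 h2.2
    rw [hq] at h1
    obtain ⟨u', v', hs', ht'⟩ := (mem_Wu_pi_iff H _).1 h1
    obtain ⟨u, v, hs, k1, k2⟩ := exists_fullSol_of_tendsto H hs' ht'
    exact ⟨u, v, hs, k1, k2, by rw [hq, e1]; simp [k2]⟩
  · obtain ⟨u, v, hs, hq⟩ := (mem_Wu_iff H ⟨e0, e1⟩ _).1 h1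
    obtain ⟨u', v', hs', hq'⟩ := (mem_Wu_iff H.mirror (pi_sub_mem_Ioo ⟨e0, e1⟩) _).1 h2
    rw [hq, Prod.mk.injEq, Real.sin_pi_sub, ← mul_neg] at hq'
    have hsin := (sin_pos_of_mem ⟨e0, e1⟩).ne'
    have h4 := exists_fullSol H.c2.locLip hs hs' ⟨e0, e1⟩ hq'.1
      (by rw [← mul_left_cancel₀ hsin hq'.2, neg_neg])
    refine ⟨_, _, h4, by rw [Function.update_of_ne Real.pi_pos.ne, hs.u0], by simp, ?_⟩
    rw [Function.update_of_ne e1.ne, Function.update_of_ne e1.ne, hq]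

/-- Regular solutions are determined by their phase point at any height. -/
theorem FullSol.eq {a f : ℝ → ℝ → ℝ → ℝ} (H : Hyp a f) {u v u' v' : ℝ → ℝ}
    (hs : FullSol (rhs a f) u v) (hs' : FullSol (rhs a f) u' v') {θ : ℝ} (hθ : θ ∈ Icc 0 Real.pi)
    (h : (u θ, sin θ * v θ) = (u' θ, sin θ * v' θ)) : EqOn u u' (Icc 0 Real.pi) := by
  have hpi := Real.pi_pos
  rw [Prod.mk.injEq] at h
  have key : ∀ t ∈ Ioo 0 Real.pi, u t = u' t := by
    rcases hθ.1.eq_or_lt with h0 | h0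
    · rw [← h0] at h
      have h1 := hs'.regSol
      rw [← h.1] at h1
      exact fun t ht => (RegSol.eq H.c2.locLip le_rfl hs.regSol h1 t (Ioo_subset_Ico_self ht)).1
    rcases hθ.2.eq_or_lt with h1 | h1
    · rw [h1] at h
      have h2 := hs.mirror.regSol
      have h3 := hs'.mirror.regSol
      simp only [sub_zero] at h2 h3
      rw [← h.1] at h3
      intro t ht
      have := (RegSol.eq H.mirror.c2.locLip le_rfl h2 h3 (Real.pi - t)
        (Ioo_subset_Ico_self (pi_sub_mem_Ioo ht))).1
      simpa using this
    · exact fun t ht => (Sol.eq H.c2.locLip le_rfl hs.sol hs'.sol ⟨h0, h1⟩ h.1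
        (mul_left_cancel₀ (sin_pos_of_mem ⟨h0, h1⟩).ne' h.2) t ht).1
  exact EqOn.of_subset_closure key hs.cu hs'.cu Ioo_subset_Icc_self
    (by rw [closure_Ioo hpi.ne])

/-! ### The shooting curves -/

lemma mem_Wu_iff_eq {a f : ℝ → ℝ → ℝ → ℝ} (H : Hyp a f) {d : ℝ} {u v : ℝ → ℝ}
    (hs : RegSol (rhs a f) Real.pi d u v) {θ : ℝ} (hθ : θ ∈ Ioo 0 Real.pi) (q : ℝ × ℝ) :
    (θ, q) ∈ Wu a f d ↔ q = (u θ, sin θ * v θ) := by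
  rw [mem_Wu_iff H hθ]
  refine ⟨fun ⟨u', v', hs', hq⟩ => ?_, fun hq => ⟨u, v, hs, hq⟩⟩
  obtain ⟨h1, h2⟩ := RegSol.eq H.c2.locLip le_rfl hs hs' θ (Ioo_subset_Ico_self hθ)
  rw [hq, h1, h2]

lemma existsUnique_mem_Wu {a f : ℝ → ℝ → ℝ → ℝ} (H : Hyp a f) {θ : ℝ} (hθ : θ ∈ Ioo 0 Real.pi)
    (d : ℝ) : ∃! q : ℝ × ℝ, (θ, q) ∈ Wu a f d := by
  obtain ⟨u, v, hs⟩ := H.exists_regSol d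
  simp only [mem_Wu_iff_eq H hs hθ]
  exact ⟨_, rfl, fun _ h => h⟩

lemma unstableCurve_eq {a f : ℝ → ℝ → ℝ → ℝ} (H : Hyp a f) {d : ℝ} {u v : ℝ → ℝ}
    (hs : RegSol (rhs a f) Real.pi d u v) {θ : ℝ} (hθ : θ ∈ Ioo 0 Real.pi) :
    unstableCurve a f θ d = (u θ, sin θ * v θ) :=
  (mem_Wu_iff_eq H hs hθ _).1 (Classical.epsilon_spec (existsUnique_mem_Wu H hθ d).exists)

lemma mem_Ws_iff_mem_Wu {a f : ℝ → ℝ → ℝ → ℝ} {e θ : ℝ} {q : ℝ × ℝ} :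
    (θ, q) ∈ Ws a f e ↔ (Real.pi - θ, (q.1, -q.2)) ∈ Wu (mirror a) (mirror f) e := mem_Ws_iff

lemma existsUnique_mem_Ws {a f : ℝ → ℝ → ℝ → ℝ} (H : Hyp a f) {θ : ℝ} (hθ : θ ∈ Ioo 0 Real.pi)
    (e : ℝ) : ∃! q : ℝ × ℝ, (θ, q) ∈ Ws a f e := by
  obtain ⟨q, h1, h2⟩ := existsUnique_mem_Wu H.mirror (pi_sub_mem_Ioo hθ) e
  refine ⟨(q.1, -q.2), mem_Ws_iff_mem_Wu.2 (by simpa using h1), fun q' hq' => ?_⟩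
  have := h2 _ (mem_Ws_iff_mem_Wu.1 hq')
  rw [← this]
  simp

lemma stableCurve_eq {a f : ℝ → ℝ → ℝ → ℝ} (H : Hyp a f) {θ : ℝ} (hθ : θ ∈ Ioo 0 Real.pi)
    (e : ℝ) : stableCurve a f θ e = ((unstableCurve (mirror a) (mirror f) (Real.pi - θ) e).1,
      -(unstableCurve (mirror a) (mirror f) (Real.pi - θ) e).2) := by
  refine (existsUnique_mem_Ws H hθ e).unique
    (Classical.epsilon_spec (existsUnique_mem_Ws H hθ e).exists) (mem_Ws_iff_mem_Wu.2 ?_)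
  rw [neg_neg]
  exact Classical.epsilon_spec (existsUnique_mem_Wu H.mirror (pi_sub_mem_Ioo hθ) e).exists

/-! ### Tangent vectors -/

/-- By uniqueness the curve is given by any choice of a family of regular solutions, and
`hasDerivAt_family` applies to such a family. -/
lemma hasDerivAt_unstableCurve {a f : ℝ → ℝ → ℝ → ℝ} (H : Hyp a f) {d : ℝ} {u v : ℝ → ℝ}
    (hs : RegSol (rhs a f) Real.pi d u v) {U V : ℝ → ℝ}
    (hU : RegSol (lin (coefU (rhs a f) u v) (coefP (rhs a f) u v)) Real.pi 1 U V) {θ : ℝ}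
    (hθ : θ ∈ Ioo 0 Real.pi) : HasDerivAt (unstableCurve a f θ) (U θ, sin θ * V θ) d := by
  choose u' v' hs' using H.exists_regSol
  have he := RegSol.eq H.c2.locLip le_rfl hs (hs' d)
  have hU' : RegSol (lin (coefU (rhs a f) (u' d) (v' d)) (coefP (rhs a f) (u' d) (v' d)))
      Real.pi 1 U V := hU.congr fun t ht => by
    obtain ⟨h1, h2⟩ := he t (Ioo_subset_Ico_self ht)
    simp only [lin, coefU, coefP, h1, h2]
  obtain ⟨h1, h2⟩ := hasDerivAt_family H.c2 hs' hU' hθ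
  have : unstableCurve a f θ = fun d => (u' d θ, sin θ * v' d θ) :=
    funext fun d => unstableCurve_eq H (hs' d) hθ
  rw [this]
  exact h1.prodMk (h2.const_mul _)

lemma hasDerivAt_stableCurve {a f : ℝ → ℝ → ℝ → ℝ} (H : Hyp a f) {e : ℝ} {u v : ℝ → ℝ}
    (hs : RegSol (mirror (rhs a f)) Real.pi e u v) {U V : ℝ → ℝ}
    (hU : RegSol (lin (coefU (mirror (rhs a f)) u v) (coefP (mirror (rhs a f)) u v)) Real.pi 1 U V)
    {θ : ℝ} (hθ : θ ∈ Ioo 0 Real.pi) :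
    HasDerivAt (stableCurve a f θ) (U (Real.pi - θ), -(sin θ * V (Real.pi - θ))) e := by
  have h := hasDerivAt_unstableCurve H.mirror hs hU (pi_sub_mem_Ioo hθ)
  have h1 : HasDerivAt (fun e => (unstableCurve (mirror a) (mirror f) (Real.pi - θ) e).1) _ e :=
    h.fst
  have h2 : HasDerivAt (fun e => (unstableCurve (mirror a) (mirror f) (Real.pi - θ) e).2) _ e :=
    h.snd
  rw [show stableCurve a f θ = _ from funext fun e => stableCurve_eq H hθ e]
  rw [Real.sin_pi_sub] at h2
  exact h1.prodMk h2.neg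

lemma RegSol.continuousOn_coef {h : ℝ → ℝ → ℝ → ℝ} (hh : C2 h) {d : ℝ} {u v : ℝ → ℝ}
    (hs : RegSol h Real.pi d u v) : ContinuousOn (coefU h u v) (Ico 0 Real.pi) ∧
      ContinuousOn (coefP h u v) (Ico 0 Real.pi) :=
  ⟨hh.continuousOn_coefU Ico_subset_Icc_self hs.cu hs.cv,
    hh.continuousOn_coefP Ico_subset_Icc_self hs.cu hs.cv⟩

lemma RegSol.tangent_ne_zero {q c : ℝ → ℝ} (hq : ContinuousOn q (Ico 0 Real.pi))
    (hc : ContinuousOn c (Ico 0 Real.pi)) {U V : ℝ → ℝ} (hU : RegSol (lin q c) Real.pi 1 U V)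
    {θ : ℝ} (hθ : θ ∈ Ioo 0 Real.pi) : (U θ, sin θ * V θ) ≠ 0 := by
  intro h
  rw [Prod.mk_eq_zero] at h
  exact hU.ne_zero (globLip_lin hq hc).locLip one_ne_zero (Ioo_subset_Ico_self hθ)
    ⟨h.1, (mul_eq_zero.1 h.2).resolve_left (sin_pos_of_mem hθ).ne'⟩

lemma regular_unstableCurve {a f : ℝ → ℝ → ℝ → ℝ} (H : Hyp a f) {θ : ℝ} (hθ : θ ∈ Ioo 0 Real.pi)
    (d : ℝ) : DifferentiableAt ℝ (unstableCurve a f θ) d ∧ unstableTangent a f θ d ≠ 0 := by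
  obtain ⟨u, v, hs⟩ := H.exists_regSol d
  obtain ⟨hq, hc⟩ := hs.continuousOn_coef H.c2
  obtain ⟨U, V, hU⟩ := exists_regSol_lin hq hc 1
  have h := hasDerivAt_unstableCurve H hs hU hθ
  refine ⟨h.differentiableAt, ?_⟩
  rw [unstableTangent, h.deriv]
  exact hU.tangent_ne_zero hq hc hθ

lemma regular_stableCurve {a f : ℝ → ℝ → ℝ → ℝ} (H : Hyp a f) {θ : ℝ} (hθ : θ ∈ Ioo 0 Real.pi)
    (e : ℝ) : DifferentiableAt ℝ (stableCurve a f θ) e ∧ stableTangent a f θ e ≠ 0 := by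
  obtain ⟨u, v, hs⟩ := H.mirror.exists_regSol e
  obtain ⟨hq, hc⟩ := hs.continuousOn_coef H.mirror.c2
  obtain ⟨U, V, hU⟩ := exists_regSol_lin hq hc 1
  have h := hasDerivAt_stableCurve H hs hU hθ
  refine ⟨h.differentiableAt, ?_⟩
  rw [stableTangent, h.deriv]
  intro h0
  rw [Prod.mk_eq_zero, neg_eq_zero] at h0
  refine hU.tangent_ne_zero hq hc (pi_sub_mem_Ioo hθ) ?_
  rw [Prod.mk_eq_zero, Real.sin_pi_sub]
  exact h0

/-! ### Equilibria and intersection points -/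

/-- Injectivity is unique continuation from one height, where at the poles the singular initial
value problem takes over. Surjectivity is the gluing of the two regular halves. -/
theorem bijOn_equilibria {a f : ℝ → ℝ → ℝ → ℝ} (H : Hyp a f) {θ : ℝ} (hθ : θ ∈ Icc 0 Real.pi) :
    BijOn (fun u : Icc (0 : ℝ) Real.pi → ℝ => phasePoint (IccExtend Real.pi_pos.le u) θ)
      (equilibria a f) (crossSection (Mu a f) θ ∩ crossSection (Ms a f) θ) := by
  refine ⟨fun u hu => ?_, fun u hu u' hu' h => ?_, fun q hq => ?_⟩
  · obtain ⟨v, hs, hd⟩ := IsEquilibrium.fullSol H hu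
    simp only [phasePoint_eq hd hθ]
    exact ⟨mem_iUnion.2 ⟨_, hs.mem_Wu H hθ⟩, mem_iUnion.2 ⟨_, hs.mem_Ws H hθ⟩⟩
  · obtain ⟨v, hs, hd⟩ := IsEquilibrium.fullSol H hu
    obtain ⟨v', hs', hd'⟩ := IsEquilibrium.fullSol H hu'
    simp only [phasePoint_eq hd hθ, phasePoint_eq hd' hθ] at h
    funext t
    have := hs.eq H hs' hθ h t.2
    simpa only [IccExtend_val] using this
  · obtain ⟨d, h1⟩ := mem_iUnion.1 hq.1
    obtain ⟨e, h2⟩ := mem_iUnion.1 hq.2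
    obtain ⟨u, v, hs, -, -, hq'⟩ := exists_fullSol_of_mem H hθ h1 h2
    have hE : EqOn (IccExtend Real.pi_pos.le fun t : Icc 0 Real.pi => u t) u (Icc 0 Real.pi) :=
      fun t ht => IccExtend_of_mem _ _ ht
    have hs' := hs.congr hE
    refine ⟨fun t => u t, hs'.isEquilibrium H, ?_⟩
    simp only
    rw [phasePoint_eq (fun t ht => (hs'.sol.deriv_eq ht).1) hθ, hq', hE hθ]

/-! ### Eigenfunctions of the singular Sturm–Liouville problem -/

/-- `w` is an eigenfunction of `k⁻¹ (w'' + w' / tan θ - q w - c w')` with eigenvalue `z` and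
Neumann boundary conditions. -/
structure IsMode (q c k : ℝ → ℝ) (z : ℂ) (w : ℝ → ℂ) : Prop where
  contDiffOn : ContDiffOn ℝ 2 w (Icc 0 Real.pi)
  neumann_zero : derivWithin w (Icc 0 Real.pi) 0 = 0
  neumann_pi : derivWithin w (Icc 0 Real.pi) Real.pi = 0
  ne_zero : ∃ θ ∈ Icc 0 Real.pi, w θ ≠ 0
  equation : ∀ θ ∈ Ioo 0 Real.pi, sphLap w θ = q θ * w θ + c θ * deriv w θ + z * (k θ * w θ)

lemma IsMode.congr {q c k q' c' k' : ℝ → ℝ} {z : ℂ} {w : ℝ → ℂ} (H : IsMode q c k z w)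
    (hq : EqOn q q' (Icc 0 Real.pi)) (hc : EqOn c c' (Icc 0 Real.pi))
    (hk : EqOn k k' (Icc 0 Real.pi)) : IsMode q' c' k' z w :=
  ⟨H.contDiffOn, H.neumann_zero, H.neumann_pi, H.ne_zero, fun θ hθ => by
    have hm := Ioo_subset_Icc_self hθ
    rw [← hq hm, ← hc hm, ← hk hm, H.equation θ hθ]⟩

lemma hasDerivAt_re {w : ℝ → ℂ} {w' : ℂ} {t : ℝ} (h : HasDerivAt w w' t) :
    HasDerivAt (fun t => (w t).re) w'.re t :=
  Complex.reCLM.hasFDerivAt.comp_hasDerivAt t h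

lemma hasDerivAt_im {w : ℝ → ℂ} {w' : ℂ} {t : ℝ} (h : HasDerivAt w w' t) :
    HasDerivAt (fun t => (w t).im) w'.im t :=
  Complex.imCLM.hasFDerivAt.comp_hasDerivAt t h

/-- Real and imaginary parts of an eigenfunction. -/
lemma IsMode.exists_derivs {q c k : ℝ → ℝ} {z : ℂ} {w : ℝ → ℂ} (H : IsMode q c k z w) :
    ∃ E : ℝ → ℂ, ContinuousOn E (Icc 0 Real.pi) ∧ E 0 = 0 ∧ E Real.pi = 0 ∧
      ∀ θ ∈ Ioo 0 Real.pi, HasDerivAt w (E θ) θ ∧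
        HasDerivAt (fun t => (E t).re) (q θ * (w θ).re + c θ * (E θ).re
          + k θ * (z.re * (w θ).re - z.im * (w θ).im) - cos θ / sin θ * (E θ).re) θ ∧
        HasDerivAt (fun t => (E t).im) (q θ * (w θ).im + c θ * (E θ).im
          + k θ * (z.re * (w θ).im + z.im * (w θ).re) - cos θ / sin θ * (E θ).im) θ := by
  obtain ⟨h1, h2⟩ := hasDerivAt_of_contDiffOn_two Real.pi_pos H.contDiffOn
  refine ⟨_, h1, H.neumann_zero, H.neumann_pi, fun θ hθ => ?_⟩
  obtain ⟨e1, e2, e3⟩ := h2 θ hθ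
  have he := H.equation θ hθ
  rw [sphLap, ← e1] at he
  have h4 := eq_sub_of_add_eq he
  generalize cos θ / sin θ = κ at h4 ⊢
  refine ⟨e2, (hasDerivAt_re e3).congr_deriv ?_, (hasDerivAt_im e3).congr_deriv ?_⟩ <;>
  · rw [h4]
    simp
    ring

lemma deriv_eq_zero_of_nonneg {F F' : ℝ → ℝ} {a b : ℝ} (hF : ContinuousOn F (Icc a b))
    (hd : ∀ t ∈ Ioo a b, HasDerivAt F (F' t) t) (h0 : ∀ t ∈ Ioo a b, 0 ≤ F' t)
    (hab : F a = F b) : ∀ t ∈ Ioo a b, F' t = 0 := by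
  intro t ht
  have hm : MonotoneOn F (Icc a b) := by
    refine monotoneOn_of_hasDerivWithinAt_nonneg (f' := F') (convex_Icc a b) hF ?_ ?_ <;>
    · rw [interior_Icc]
      first
        | exact fun s hs => (hd s hs).hasDerivWithinAt
        | exact h0
  have hlt := ht.1.trans ht.2
  have hc : ∀ s ∈ Icc a b, F s = F a := fun s hs => le_antisymm
    ((hm hs ⟨hlt.le, le_rfl⟩ hs.2).trans hab.ge) (hm ⟨le_rfl, hlt.le⟩ hs hs.1)
  have : F =ᶠ[𝓝 t] fun _ => F a := by
    filter_upwards [Icc_mem_nhds ht.1 ht.2] with s hs using hc s hs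
  exact (hd t ht).unique ((hasDerivAt_const t (F a)).congr_of_eventuallyEq this)

/-- Eigenvalues are real. -/
theorem IsMode.im_eq_zero {q c k : ℝ → ℝ} (hc : Continuous c) (hk : ∀ θ ∈ Ioo 0 Real.pi, 0 < k θ)
    {z : ℂ} {w : ℝ → ℂ} (H : IsMode q c k z w) : z.im = 0 := by
  obtain ⟨E, hE, -, -, hd⟩ := H.exists_derivs
  by_contra hz
  have hwc := H.contDiffOn.continuousOn
  -- Lagrange's identity for w and its conjugate. F vanishes at both poles because sin θ does, while
  -- F' is a positive multiple of (Im z)² |w|² in between.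
  set F : ℝ → ℝ := fun θ => z.im * ((w θ).re * (weight c θ * (sin θ * (E θ).im))
    - (w θ).im * (weight c θ * (sin θ * (E θ).re))) with hF
  have hre := Complex.continuous_re
  have him := Complex.continuous_im
  have hFc : ContinuousOn F (Icc 0 Real.pi) := by
    have hwt := (continuous_weight hc).continuousOn (s := Icc 0 Real.pi)
    have hsn := Real.continuous_sin.continuousOn (s := Icc 0 Real.pi)
    exact continuousOn_const.mul
      (((hre.comp_continuousOn hwc).mul (hwt.mul (hsn.mul (him.comp_continuousOn hE)))).sub
      ((him.comp_continuousOn hwc).mul (hwt.mul (hsn.mul (hre.comp_continuousOn hE)))))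
  have hFd : ∀ θ ∈ Ioo 0 Real.pi, HasDerivAt F
      (weight c θ * sin θ * k θ * (z.im ^ 2 * ((w θ).re ^ 2 + (w θ).im ^ 2))) θ := by
    intro θ hθ
    obtain ⟨d1, d2, d3⟩ := hd θ hθ
    have hs := (sin_pos_of_mem hθ).ne'
    have a1 := hasDerivAt_weight_mul hc hs d2
    have a2 := hasDerivAt_weight_mul hc hs d3
    refine ((((hasDerivAt_re d1).mul a2).sub ((hasDerivAt_im d1).mul a1)).const_mul
      z.im).congr_deriv ?_
    ring
  have h0 := deriv_eq_zero_of_nonneg hFc hFd (fun θ hθ => by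
    have := (weight_pos c θ).le
    have := (sin_pos_of_mem hθ).le
    have := (hk θ hθ).le
    positivity) (by simp [hF])
  have hw0 : EqOn w 0 (Ioo 0 Real.pi) := by
    intro θ hθ
    have h1 := h0 θ hθ
    have h2 := (mul_eq_zero.1 h1).resolve_left (mul_ne_zero (mul_ne_zero (weight_pos c θ).ne'
      (sin_pos_of_mem hθ).ne') (hk θ hθ).ne')
    have h3 := (mul_eq_zero.1 h2).resolve_left (pow_ne_zero 2 hz)
    have h4 : (w θ).re = 0 := by nlinarith [sq_nonneg (w θ).re, sq_nonneg (w θ).im]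
    have h5 : (w θ).im = 0 := by nlinarith [sq_nonneg (w θ).re, sq_nonneg (w θ).im]
    exact Complex.ext h4 h5
  obtain ⟨θ, hθ, hne⟩ := H.ne_zero
  exact hne (EqOn.of_subset_closure hw0 hwc continuousOn_const Ioo_subset_Icc_self
    (by rw [closure_Ioo Real.pi_pos.ne]) hθ)

/-- For real eigenvalues there are real eigenfunctions. -/
theorem exists_isMode_iff {q c k : ℝ → ℝ} (hq : ContinuousOn q (Icc 0 Real.pi))
    (hc : ContinuousOn c (Icc 0 Real.pi)) (hk : ContinuousOn k (Icc 0 Real.pi)) (l : ℝ) :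
    (∃ w, IsMode q c k (l : ℂ) w) ↔ ∃ x y, FullSol (lin (fun θ => q θ + l * k θ) c) x y ∧
      ∃ θ ∈ Icc 0 Real.pi, x θ ≠ 0 := by
  constructor
  · rintro ⟨w, H⟩
    obtain ⟨E, hE, hE0, hEpi, hd⟩ := H.exists_derivs
    have hwc := H.contDiffOn.continuousOn
    obtain ⟨θ, hθ, hne⟩ := H.ne_zero
    have key : (w θ).re ≠ 0 ∨ (w θ).im ≠ 0 := by
      by_contra! h
      exact hne (Complex.ext h.1 h.2)
    have hre := Complex.continuous_re
    have him := Complex.continuous_im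
    rcases key with h | h
    · refine ⟨fun θ => (w θ).re, fun θ => (E θ).re, ⟨fun t ht => ?_, hre.comp_continuousOn hwc,
        hre.comp_continuousOn hE, by simp [hE0], by simp [hEpi]⟩, θ, hθ, h⟩
      obtain ⟨d1, d2, d3⟩ := hd t ht
      refine ⟨hasDerivAt_re d1, d2.congr_deriv ?_⟩
      simp only [lin, Complex.ofReal_re, Complex.ofReal_im]; ring
    · refine ⟨fun θ => (w θ).im, fun θ => (E θ).im, ⟨fun t ht => ?_, him.comp_continuousOn hwc,
        him.comp_continuousOn hE, by simp [hE0], by simp [hEpi]⟩, θ, hθ, h⟩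
      obtain ⟨d1, d2, d3⟩ := hd t ht
      refine ⟨hasDerivAt_im d1, d3.congr_deriv ?_⟩
      simp only [lin, Complex.ofReal_re, Complex.ofReal_im]; ring
  · rintro ⟨x, y, hs, θ, hθ, hne⟩
    obtain ⟨h1, h2⟩ := hs.contDiffOn (((hq.add (continuousOn_const.mul hk)).mul hs.cu).add
      (hc.mul hs.cv))
    have hun := uniqueDiffOn_Icc Real.pi_pos
    have m0 : (0:ℝ) ∈ Icc 0 Real.pi := ⟨le_rfl, Real.pi_pos.le⟩
    have m1 : Real.pi ∈ Icc 0 Real.pi := ⟨Real.pi_pos.le, le_rfl⟩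
    have h3 : ∀ t ∈ Icc 0 Real.pi,
        HasDerivWithinAt (fun t => (x t : ℂ)) (y t : ℂ) (Icc 0 Real.pi) t := fun t ht =>
      Complex.ofRealCLM.hasFDerivAt.comp_hasDerivWithinAt t (h2 t ht)
    refine ⟨fun t => (x t : ℂ), Complex.ofRealCLM.contDiff.comp_contDiffOn h1,
      by rw [(h3 0 m0).derivWithin (hun 0 m0), hs.v0, Complex.ofReal_zero],
      by rw [(h3 _ m1).derivWithin (hun _ m1), hs.vpi, Complex.ofReal_zero],
      ⟨θ, hθ, Complex.ofReal_ne_zero.2 hne⟩, fun t ht => ?_⟩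
    have h4 : ∀ t ∈ Ioo 0 Real.pi, deriv (fun t => (x t : ℂ)) t = (y t : ℂ) := fun t ht =>
      (hs.sol t ht).1.ofReal_comp.deriv
    have h5 : deriv (fun t => (x t : ℂ)) =ᶠ[𝓝 t] fun t => (y t : ℂ) := by
      filter_upwards [Ioo_mem_nhds ht.1 ht.2] with s hs using h4 s hs
    rw [sphLap, h4 t ht, h5.deriv_eq, (hs.sol t ht).2.ofReal_comp.deriv, Complex.real_smul]
    simp only [lin]
    push_cast
    ring

/-! ### The linearization at an equilibrium -/

/-- Equivalent to the product rule for f = -a · `rhs`; in this form the derivatives of a cancel in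
the linearization. -/
lemma Hyp.dU_rhs {a f : ℝ → ℝ → ℝ → ℝ} (H : Hyp a f) {θ : ℝ} (hθ : θ ∈ Icc 0 Real.pi) (u p : ℝ) :
    dU f θ u p = -(a θ u p * dU (rhs a f) θ u p + dU a θ u p * rhs a f θ u p) := by
  have ha := (H.a_pos hθ u p).ne'
  have h := ((H.hf.hasDerivAt_dU hθ u p).div (H.ha.hasDerivAt_dU hθ u p) ha).neg
  have h2 : dU (rhs a f) θ u p = _ := h.deriv
  rw [h2, rhs]
  field_simp
  ring

lemma Hyp.dP_rhs {a f : ℝ → ℝ → ℝ → ℝ} (H : Hyp a f) {θ : ℝ} (hθ : θ ∈ Icc 0 Real.pi) (u p : ℝ) :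
    dP f θ u p = -(a θ u p * dP (rhs a f) θ u p + dP a θ u p * rhs a f θ u p) := by
  have ha := (H.a_pos hθ u p).ne'
  have h := ((H.hf.hasDerivAt_dP hθ u p).div (H.ha.hasDerivAt_dP hθ u p) ha).neg
  have h2 : dP (rhs a f) θ u p = _ := h.deriv
  rw [h2, rhs]
  field_simp
  ring

/-- Along a solution `sphLap u` equals `rhs`, so the derivatives of a are multiplied by `sphLap u -
rhs` = 0. -/
lemma linearization_eq {a f : ℝ → ℝ → ℝ → ℝ} (H : Hyp a f) {u v : ℝ → ℝ}
    (hs : Sol (rhs a f) Real.pi u v) (w : ℝ → ℂ) {θ : ℝ} (hθ : θ ∈ Ioo 0 Real.pi) :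
    linearization a f u w θ = a θ (u θ) (v θ) * (sphLap w θ - (coefU (rhs a f) u v θ * w θ
      + coefP (rhs a f) u v θ * deriv w θ)) := by
  obtain ⟨e1, e2⟩ := hs.deriv_eq hθ
  have hm := Ioo_subset_Icc_self hθ
  have h1 : deriv (fun s => f θ s (v θ)) (u θ) = _ := H.dU_rhs hm (u θ) (v θ)
  have h2 : deriv (fun q => f θ (u θ) q) (v θ) = _ := H.dP_rhs hm (u θ) (v θ)
  have h3 : sphLap u θ = rhs a f θ (u θ) (v θ) := by
    rw [sphLap, e1, e2, smul_eq_mul, sub_add_cancel]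
  rw [linearization, h3, e1, h1, h2]
  simp only [Complex.real_smul, coefU, coefP, dU, dP]
  push_cast
  ring

/-- The reciprocal diffusion coefficient along `(u, v)`. -/
def coefW (a : ℝ → ℝ → ℝ → ℝ) (u v : ℝ → ℝ) (θ : ℝ) : ℝ := (a θ (u θ) (v θ))⁻¹

/-- Division by a > 0 turns the eigenvalue equation into a Sturm–Liouville problem in which z
multiplies a positive weight. -/
lemma isEigenvalue_iff {a f : ℝ → ℝ → ℝ → ℝ} (H : Hyp a f) {u v : ℝ → ℝ}
    (hs : Sol (rhs a f) Real.pi u v) (z : ℂ) : IsEigenvalue a f u z ↔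
      ∃ w, IsMode (coefU (rhs a f) u v) (coefP (rhs a f) u v) (coefW a u v) z w := by
  have key : ∀ (w : ℝ → ℂ), ∀ θ ∈ Ioo 0 Real.pi, linearization a f u w θ = z * w θ ↔
      sphLap w θ = coefU (rhs a f) u v θ * w θ + coefP (rhs a f) u v θ * deriv w θ
        + z * (coefW a u v θ * w θ) := fun w θ hθ => by
    have ha : (a θ (u θ) (v θ) : ℂ) ≠ 0 :=
      Complex.ofReal_ne_zero.2 (H.a_pos (Ioo_subset_Icc_self hθ) (u θ) (v θ)).ne'
    rw [linearization_eq H hs w hθ, coefW, ← sub_eq_iff_eq_add', Complex.ofReal_inv]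
    constructor
    · intro h
      refine mul_left_cancel₀ ha (h.trans ?_)
      field_simp
    · intro h
      rw [h]; field_simp
  constructor
  · rintro ⟨w, h1, h2, h3, h4, h5⟩
    exact ⟨w, h1, h2, h3, h4, fun θ hθ => (key w θ hθ).1 (h5 θ hθ)⟩
  · rintro ⟨w, h1, h2, h3, h4, h5⟩
    exact ⟨w, h1, h2, h3, h4, fun θ hθ => (key w θ hθ).2 (h5 θ hθ)⟩

/-! ### Matching solutions of the linear equation from both poles -/

lemma mirror_lin (q c : ℝ → ℝ) :
    mirror (lin q c) = lin (fun θ => q (Real.pi - θ)) fun θ => -c (Real.pi - θ) := by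
  funext θ x y
  simp only [mirror, lin]
  ring

lemma RegSol.smul {q c : ℝ → ℝ} {b d : ℝ} {U V : ℝ → ℝ} (H : RegSol (lin q c) b d U V) (s : ℝ) :
    RegSol (lin q c) b (s * d) (fun θ => s * U θ) fun θ => s * V θ :=
  ⟨fun θ hθ => ⟨(H.sol θ hθ).1.const_mul s, ((H.sol θ hθ).2.const_mul s).congr_deriv
    (by simp only [lin]; ring)⟩, continuousOn_const.mul H.cu, continuousOn_const.mul H.cv,
    by rw [H.u0], by rw [H.v0, mul_zero]⟩

lemma RegSol.eq_smul {q c : ℝ → ℝ} (hl : LocLip (lin q c)) {U V x y : ℝ → ℝ} {d : ℝ}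
    (hU : RegSol (lin q c) Real.pi 1 U V) (hx : RegSol (lin q c) Real.pi d x y) :
    ∀ θ ∈ Ico 0 Real.pi, x θ = d * U θ ∧ y θ = d * V θ := by
  have h := hU.smul d
  rw [mul_one] at h
  exact RegSol.eq hl le_rfl hx h

lemma FullSol.value_ne_zero {q c : ℝ → ℝ} (hl : LocLip (lin q c)) {U V x y : ℝ → ℝ}
    (hU : RegSol (lin q c) Real.pi 1 U V) (hx : FullSol (lin q c) x y)
    (hne : ∃ θ ∈ Icc 0 Real.pi, x θ ≠ 0) : x 0 ≠ 0 := by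
  intro h0
  have h := hU.eq_smul hl hx.regSol
  obtain ⟨θ, hθ, hθ'⟩ := hne
  have hE : EqOn x 0 (Ioo 0 Real.pi) := fun t ht => by
    rw [(h t (Ioo_subset_Ico_self ht)).1, h0, zero_mul, Pi.zero_apply]
  exact hθ' (EqOn.of_subset_closure hE hx.cu continuousOn_const Ioo_subset_Icc_self
    (by rw [closure_Ioo Real.pi_pos.ne]) hθ)

/-- A nontrivial solution regular at both poles exists if and only if the solutions regular at
one pole match. -/
theorem exists_fullSol_lin_iff {q c : ℝ → ℝ} (hl : LocLip (lin q c))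
    (hl' : LocLip (mirror (lin q c))) {U V U' V' : ℝ → ℝ} (hU : RegSol (lin q c) Real.pi 1 U V)
    (hU' : RegSol (mirror (lin q c)) Real.pi 1 U' V') {θ : ℝ} (hθ : θ ∈ Ioo 0 Real.pi) :
    (∃ x y, FullSol (lin q c) x y ∧ ∃ θ ∈ Icc 0 Real.pi, x θ ≠ 0) ↔
      U θ * V' (Real.pi - θ) + V θ * U' (Real.pi - θ) = 0 := by
  have hml := mirror_lin q c
  constructor
  · rintro ⟨x, y, hx, hne⟩
    have hx' := hx.mirror
    have n1 := hx.value_ne_zero hl hU hne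
    have h1 := hU.eq_smul hl hx.regSol θ (Ioo_subset_Ico_self hθ)
    rw [hml] at hx' hl' hU'
    have n2 := hx'.value_ne_zero hl' hU' (by
      obtain ⟨t, ht, h⟩ := hne
      exact ⟨_, pi_sub_mem_Icc ht, by rwa [sub_sub_cancel]⟩)
    have h2 := hU'.eq_smul hl' hx'.regSol _ (Ioo_subset_Ico_self (pi_sub_mem_Ioo hθ))
    simp only [sub_sub_cancel, sub_zero] at h2 n2
    -- x is x 0 times U and, seen from the other pole, x π times U'. Both factors are nonzero.
    have : x 0 * x Real.pi * (U θ * V' (Real.pi - θ) + V θ * U' (Real.pi - θ)) = 0 := by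
      linear_combination (-(x Real.pi * V' (Real.pi - θ))) * h1.1
        - (x Real.pi * U' (Real.pi - θ)) * h1.2 - x θ * h2.2 - y θ * h2.1
    exact (mul_eq_zero.1 this).resolve_left (mul_ne_zero n1 n2)
  · intro hD
    -- The factor s is read off from the first components, or from the second ones where U'
    -- vanishes; U' and V' never vanish together.
    have key : ∃ s, U θ = s * U' (Real.pi - θ) ∧ V θ = -(s * V' (Real.pi - θ)) := by
      by_cases h0 : U' (Real.pi - θ) = 0
      · have hV : V' (Real.pi - θ) ≠ 0 := fun h => by
          rw [hml] at hl' hU'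
          exact hU'.ne_zero hl' one_ne_zero (Ioo_subset_Ico_self (pi_sub_mem_Ioo hθ)) ⟨h0, h⟩
        rw [h0, mul_zero, add_zero, mul_eq_zero] at hD
        exact ⟨-(V θ / V' (Real.pi - θ)), by rw [hD.resolve_right hV, h0, mul_zero],
          by field_simp⟩
      · refine ⟨U θ / U' (Real.pi - θ), by field_simp, ?_⟩
        field_simp
        linarith
    obtain ⟨s, e1, e2⟩ := key
    have hs : RegSol (mirror (lin q c)) Real.pi (s * 1) (fun θ => s * U' θ) fun θ => s * V' θ := by
      rw [hml] at hU' ⊢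
      exact hU'.smul s
    refine ⟨_, _, exists_fullSol hl hU hs hθ e1 e2, 0, ⟨le_rfl, Real.pi_pos.le⟩, ?_⟩
    rw [Function.update_of_ne Real.pi_pos.ne, hU.u0]
    exact one_ne_zero

/-- By the addition theorem, s (U V' + V U') = -r r' sin (ν + ν'). -/
lemma match_iff_angle {s U V U' V' r r' ν ν' : ℝ} (hs : 0 < s) (hr : 0 < r) (hr' : 0 < r')
    (h1 : U = r * cos ν) (h2 : s * V = -(r * sin ν)) (h3 : U' = r' * cos ν')
    (h4 : s * V' = -(r' * sin ν')) :
    U * V' + V * U' = 0 ↔ ∃ m : ℤ, ν + ν' = m * Real.pi := by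
  have : s * (U * V' + V * U') = -(r * r' * sin (ν + ν')) := by
    rw [Real.sin_add]
    linear_combination U * h4 + U' * h2 - r' * sin ν' * h1 - r * sin ν * h3
  have h5 : U * V' + V * U' = 0 ↔ sin (ν + ν') = 0 := by
    constructor <;> intro h
    · rw [h, mul_zero, eq_comm, neg_eq_zero] at this
      exact (mul_eq_zero.1 this).resolve_left (mul_pos hr hr').ne'
    · rw [h, mul_zero, neg_zero] at this
      exact (mul_eq_zero.1 this).resolve_left hs.ne'
  rw [h5, Real.sin_eq_zero_iff]
  simp only [eq_comm]

/-! ### Transversality -/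

/-- Both planes contain F, which points out of the plane of constant height. Modulo F it remains to
decide whether A and B are independent in ℝ². -/
lemma span_sup_span_eq_top_iff {F : ℝ × ℝ × ℝ} (hF : F.1 ≠ 0) {A B : ℝ × ℝ} (hA : A ≠ 0) :
    Submodule.span ℝ {F, ((0, A) : ℝ × ℝ × ℝ)} ⊔ Submodule.span ℝ {F, ((0, B) : ℝ × ℝ × ℝ)} = ⊤ ↔
      A.1 * B.2 - A.2 * B.1 ≠ 0 := by
  constructor
  · intro h hdet
    -- A functional that vanishes on F and (0, A), and on (0, B) if the determinant is zero, but
    -- takes the value F.1 (A.1² + A.2²) at (0, -A.2, A.1).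
    let φ : ℝ × ℝ × ℝ →ₗ[ℝ] ℝ :=
      { toFun := fun x => (F.1 * x.2.2 - F.2.2 * x.1) * A.1 - (F.1 * x.2.1 - F.2.1 * x.1) * A.2
        map_add' := fun x y => by simp only [Prod.fst_add, Prod.snd_add]; ring
        map_smul' := fun r x => by
          simp only [Prod.smul_fst, Prod.smul_snd, smul_eq_mul, RingHom.id_apply]; ring }
    have hφ : ∀ x, φ x =
      (F.1 * x.2.2 - F.2.2 * x.1) * A.1 - (F.1 * x.2.1 - F.2.1 * x.1) * A.2 := fun _ => rfl
    have hle : Submodule.span ℝ {F, ((0, A) : ℝ × ℝ × ℝ)} ⊔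
        Submodule.span ℝ {F, ((0, B) : ℝ × ℝ × ℝ)} ≤ LinearMap.ker φ := by
      refine sup_le (Submodule.span_le.2 ?_) (Submodule.span_le.2 ?_) <;>
      · rintro x (rfl | rfl) <;> rw [SetLike.mem_coe, LinearMap.mem_ker, hφ]
        · ring
        · simp only
          first
            | ring1
            | linear_combination F.1 * hdet
    rw [h] at hle
    have h1 : φ (0, -A.2, A.1) = 0 := hle Submodule.mem_top
    rw [hφ] at h1
    have h2 : F.1 * (A.1 ^ 2 + A.2 ^ 2) = 0 := by linear_combination h1
    have h3 := (mul_eq_zero.1 h2).resolve_left hF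
    exact hA (Prod.ext (by nlinarith [sq_nonneg A.1, sq_nonneg A.2] : A.1 = 0)
      (by nlinarith [sq_nonneg A.1, sq_nonneg A.2] : A.2 = 0))
  · intro hdet
    rw [eq_top_iff]
    intro x _
    set D := A.1 * B.2 - A.2 * B.1 with hD
    set y := x.2.1 - x.1 / F.1 * F.2.1 with hy
    set z := x.2.2 - x.1 / F.1 * F.2.2 with hz
    have hx : x = ((x.1 / F.1) • F + ((y * B.2 - z * B.1) / D) • ((0, A) : ℝ × ℝ × ℝ))
        + ((A.1 * z - A.2 * y) / D) • ((0, B) : ℝ × ℝ × ℝ) := by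
      have e1 : (y * B.2 - z * B.1) / D * A.1 + (A.1 * z - A.2 * y) / D * B.1 = y := by
        field_simp; rw [hD]; ring
      have e2 : (y * B.2 - z * B.1) / D * A.2 + (A.1 * z - A.2 * y) / D * B.2 = z := by
        field_simp; rw [hD]; ring
      refine Prod.ext ?_ (Prod.ext ?_ ?_)
      · simp; field_simp
      · simp only [Prod.fst_add, Prod.snd_add, Prod.smul_fst, Prod.smul_snd, smul_eq_mul]
        rw [add_assoc, e1, hy]; ring
      · simp only [Prod.snd_add, Prod.smul_snd, smul_eq_mul]
        rw [add_assoc, e2, hz]; ring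
    rw [hx]
    refine Submodule.add_mem _ (Submodule.mem_sup_left (Submodule.add_mem _ ?_ ?_))
      (Submodule.mem_sup_right ?_) <;>
    exact Submodule.smul_mem _ _ (Submodule.subset_span (by simp))

/-! ### Uniqueness of continuous angles -/

/-- A multiple of 2π of absolute value below π is 0, so by the intermediate value theorem g cannot
leave the value 0 that it takes along l. Applied to the difference of two lifts of the same angle.
-/
lemma eq_of_continuousOn_of_int {g : ℝ → ℝ} {a b : ℝ} (hg : ContinuousOn g (Ioo a b))
    (hi : ∀ t ∈ Ioo a b, ∃ m : ℤ, g t = m * (2 * Real.pi)) {l : Filter ℝ} [l.NeBot]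
    (hl : Ioo a b ∈ l) (h0 : Tendsto g l (𝓝 0)) : ∀ t ∈ Ioo a b, g t = 0 := by
  have hpi := Real.pi_pos
  have hsmall : ∀ s ∈ Ioo a b, |g s| < Real.pi → g s = 0 := by
    intro s hs h
    obtain ⟨m, hm⟩ := hi s hs
    rw [hm, abs_mul, abs_of_pos (by positivity : (0:ℝ) < 2 * Real.pi)] at h
    have : |(m : ℝ)| < 1 := by nlinarith [abs_nonneg (m : ℝ)]
    have : |m| < 1 := by exact_mod_cast this
    rw [hm, Int.abs_lt_one_iff.1 this, Int.cast_zero, zero_mul]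
  have hev : ∀ᶠ s in l, |g s| < Real.pi := by
    filter_upwards [h0 (Metric.ball_mem_nhds 0 hpi)] with s hs
    simpa [Real.dist_eq] using hs
  obtain ⟨s, h1, h2⟩ := (hev.and hl).exists
  have hs := hsmall s h2 h1
  intro t ht
  by_contra hne
  have hsub : uIcc s t ⊆ Ioo a b := fun r hr =>
    ⟨(lt_min h2.1 ht.1).trans_le hr.1, hr.2.trans_lt (max_lt h2.2 ht.2)⟩
  have hiv := intermediate_value_uIcc (hg.mono hsub).abs
  have hbig : Real.pi ≤ |g t| := by
    by_contra! h
    exact hne (hsmall t ht h)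
  obtain ⟨r, hr, hr'⟩ := hiv (show Real.pi / 2 ∈ uIcc |g s| |g t| by
    rw [hs, abs_zero, uIcc_of_le (abs_nonneg _)]
    exact ⟨by positivity, by linarith⟩)
  have := hsmall r (hsub hr) (by simp only at hr'; linarith)
  simp only [this, abs_zero] at hr'
  linarith

lemma exists_int_of_polar {r r' x y : ℝ} (hr : 0 < r) (hr' : 0 < r')
    (h : ((r * cos x, -(r * sin x)) : ℝ × ℝ) = (r' * cos y, -(r' * sin y))) :
    ∃ m : ℤ, x - y = m * (2 * Real.pi) := by
  rw [Prod.mk.injEq, neg_inj] at h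
  have h1 : r ^ 2 = r' ^ 2 := by
    linear_combination (r * cos x + r' * cos y) * h.1 + (r * sin x + r' * sin y) * h.2
      - r ^ 2 * Real.sin_sq_add_cos_sq x + r' ^ 2 * Real.sin_sq_add_cos_sq y
  have h2 : r = r' := by
    rcases sq_eq_sq_iff_eq_or_eq_neg.1 h1 with h | h
    · exact h
    · linarith
  rw [h2] at h
  have e1 := mul_left_cancel₀ hr'.ne' h.1
  have e2 := mul_left_cancel₀ hr'.ne' h.2
  have h3 : cos (x - y) = 1 := by
    rw [Real.cos_sub, e1, e2]
    linear_combination Real.sin_sq_add_cos_sq y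
  obtain ⟨m, hm⟩ := (Real.cos_eq_one_iff _).1 h3
  exact ⟨m, hm.symm⟩

lemma IsUnstableAngle.eq {a f : ℝ → ℝ → ℝ → ℝ} {d : ℝ} {ν ν' : ℝ → ℝ}
    (h : IsUnstableAngle a f d ν) (h' : IsUnstableAngle a f d ν') {θ : ℝ}
    (hθ : θ ∈ Ioo 0 Real.pi) : ν θ = ν' θ := by
  refine sub_eq_zero.1 (eq_of_continuousOn_of_int (h.continuousOn.sub h'.continuousOn)
    (fun t ht => ?_) (Ioo_mem_nhdsGT Real.pi_pos) ?_ θ hθ)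
  · obtain ⟨r, hr, e⟩ := h.polar t ht
    obtain ⟨r', hr', e'⟩ := h'.polar t ht
    exact exists_int_of_polar hr hr' (e.symm.trans e')
  · have := h.tendsto_zero.sub h'.tendsto_zero
    rw [sub_zero] at this
    exact this

lemma IsStableAngle.eq {a f : ℝ → ℝ → ℝ → ℝ} {d : ℝ} {ν ν' : ℝ → ℝ}
    (h : IsStableAngle a f d ν) (h' : IsStableAngle a f d ν') {θ : ℝ}
    (hθ : θ ∈ Ioo 0 Real.pi) : ν θ = ν' θ := by
  refine sub_eq_zero.1 (eq_of_continuousOn_of_int (h.continuousOn.sub h'.continuousOn)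
    (fun t ht => ?_) (Ioo_mem_nhdsLT Real.pi_pos) ?_ θ hθ)
  · obtain ⟨r, hr, e⟩ := h.polar t ht
    obtain ⟨r', hr', e'⟩ := h'.polar t ht
    exact exists_int_of_polar hr hr' (e.symm.trans e')
  · have := h.tendsto_zero.sub h'.tendsto_zero
    rw [sub_zero] at this
    exact this

/-! ### Spectral information along an equilibrium -/

/-- Extension by constants; the last clause transfers positivity to the extension. -/
lemma exists_continuous_extension {g : ℝ → ℝ} {a b : ℝ} (hab : a ≤ b)
    (hg : ContinuousOn g (Icc a b)) : ∃ G : ℝ → ℝ, Continuous G ∧ EqOn G g (Icc a b) ∧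
      ∀ t, ∃ s ∈ Icc a b, G t = g s :=
  ⟨fun t => g (projIcc a b hab t), hg.comp_continuous
    (continuous_subtype_val.comp continuous_projIcc) fun t => (projIcc a b hab t).2,
    fun t ht => by simp only [projIcc_of_mem hab ht], fun t => ⟨_, (projIcc a b hab t).2, rfl⟩⟩

/-- Continuous extensions of the coefficients of the linearization along `(u, v)`. -/
structure IsCoef (a f : ℝ → ℝ → ℝ → ℝ) (u v q c k : ℝ → ℝ) : Prop where
  cq : Continuous q
  cc : Continuous c
  ck : Continuous k
  pos : ∀ θ, 0 < k θ
  eq : EqOn q (coefU (rhs a f) u v) (Icc 0 Real.pi)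
  ec : EqOn c (coefP (rhs a f) u v) (Icc 0 Real.pi)
  ek : EqOn k (coefW a u v) (Icc 0 Real.pi)

lemma FullSol.exists_isCoef {a f : ℝ → ℝ → ℝ → ℝ} (H : Hyp a f) {u v : ℝ → ℝ}
    (hs : FullSol (rhs a f) u v) : ∃ q c k, IsCoef a f u v q c k := by
  have hpi := Real.pi_pos.le
  have hk : ContinuousOn (coefW a u v) (Icc 0 Real.pi) := by
    refine ContinuousOn.inv₀ ?_ fun t ht => (H.a_pos ht _ _).ne'
    exact H.ha.continuousOn.comp (f := fun θ => (θ, u θ, v θ))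
      (continuousOn_id.prodMk (hs.cu.prodMk hs.cv)) fun _ ht => ⟨ht, mem_univ _⟩
  obtain ⟨q, h1, h2, -⟩ := exists_continuous_extension hpi
    (H.c2.continuousOn_coefU subset_rfl hs.cu hs.cv)
  obtain ⟨c, h3, h4, -⟩ := exists_continuous_extension hpi
    (H.c2.continuousOn_coefP subset_rfl hs.cu hs.cv)
  obtain ⟨k, h5, h6, h7⟩ := exists_continuous_extension hpi hk
  refine ⟨q, c, k, h1, h3, h5, fun t => ?_, h2, h4, h6⟩
  obtain ⟨s, hs', e⟩ := h7 t
  rw [e]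
  exact inv_pos.2 (H.a_pos hs' _ _)

section
variable {a f : ℝ → ℝ → ℝ → ℝ} {u v q c k : ℝ → ℝ}

lemma IsCoef.im_eq_zero (H : Hyp a f) (hs : FullSol (rhs a f) u v) (hC : IsCoef a f u v q c k)
    {z : ℂ} (hz : IsEigenvalue a f u z) : z.im = 0 := by
  obtain ⟨w, hw⟩ := (isEigenvalue_iff H hs.sol z).1 hz
  exact (hw.congr hC.eq.symm hC.ec.symm hC.ek.symm).im_eq_zero hC.cc fun θ _ => hC.pos θ

/-- Eigenvalues are real, so 0 is the only candidate on the imaginary axis. -/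
lemma IsCoef.isHyperbolic_iff (H : Hyp a f) (hs : FullSol (rhs a f) u v)
    (hC : IsCoef a f u v q c k) : IsHyperbolic a f u ↔ ¬ IsEigenvalue a f u ((0 : ℝ) : ℂ) := by
  refine ⟨fun h => h _ (by simp), fun h z hz hz' => h ?_⟩
  have := Complex.ext (z := z) (w := ((0 : ℝ) : ℂ)) (by simp [hz])
    (by simp [hC.im_eq_zero H hs hz'])
  rwa [← this]

lemma locLip_lin (hq : Continuous q) (hc : Continuous c) : LocLip (lin q c) :=
  (globLip_lin hq.continuousOn hc.continuousOn).locLip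

lemma IsCoef.exists_solutions (hC : IsCoef a f u v q c k) :
    ∃ U V U' V' : ℝ → ℝ → ℝ, (∀ l, RegSol (lin (fun θ => q θ + l * k θ) c) Real.pi 1 (U l) (V l)) ∧
      ∀ l, RegSol (lin (fun θ => q (Real.pi - θ) + l * k (Real.pi - θ))
        fun θ => -c (Real.pi - θ)) Real.pi 1 (U' l) (V' l) := by
  have hq := hC.cq
  have hk := hC.ck
  have hc := hC.cc
  have h1 : ∀ l : ℝ, ∃ U V, RegSol (lin (fun θ => q θ + l * k θ) c) Real.pi 1 U V := fun l =>
    exists_regSol_lin (Continuous.continuousOn (by fun_prop)) hc.continuousOn 1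
  have h2 : ∀ l : ℝ, ∃ U V, RegSol (lin (fun θ => q (Real.pi - θ) + l * k (Real.pi - θ))
      fun θ => -c (Real.pi - θ)) Real.pi 1 U V := fun l =>
    exists_regSol_lin (Continuous.continuousOn (by fun_prop))
      (Continuous.continuousOn (by fun_prop)) 1
  choose U V hU using h1
  choose U' V' hU' using h2
  exact ⟨U, V, U', V', hU, hU'⟩

lemma IsCoef.isEigenvalue_iff (H : Hyp a f) (hs : FullSol (rhs a f) u v)
    (hC : IsCoef a f u v q c k) {l : ℝ} {U V U' V' : ℝ → ℝ}
    (hU : RegSol (lin (fun θ => q θ + l * k θ) c) Real.pi 1 U V)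
    (hU' : RegSol (lin (fun θ => q (Real.pi - θ) + l * k (Real.pi - θ))
        fun θ => -c (Real.pi - θ)) Real.pi 1 U' V') {θ : ℝ} (hθ : θ ∈ Ioo 0 Real.pi) :
    IsEigenvalue a f u (l : ℂ) ↔ U θ * V' (Real.pi - θ) + V θ * U' (Real.pi - θ) = 0 := by
  have hq := hC.cq
  have hk := hC.ck
  have hc := hC.cc
  have hml := mirror_lin (fun θ => q θ + l * k θ) c
  rw [AxisymShooting.isEigenvalue_iff H hs.sol, ← exists_fullSol_lin_iff
    (locLip_lin (by fun_prop) hc) (by rw [hml]; exact locLip_lin (by fun_prop) (by fun_prop)) hU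
    (by rw [hml]; exact hU') hθ, ← exists_isMode_iff hq.continuousOn hc.continuousOn
    hk.continuousOn]
  exact ⟨fun ⟨w, hw⟩ => ⟨w, hw.congr hC.eq.symm hC.ec.symm hC.ek.symm⟩,
    fun ⟨w, hw⟩ => ⟨w, hw.congr hC.eq hC.ec hC.ek⟩⟩

/-- The term `0 * k θ` presents the linearized equation as the member l = 0 of the spectral family.
-/
lemma IsCoef.unstableTangent_eq (H : Hyp a f) (hs : FullSol (rhs a f) u v)
    (hC : IsCoef a f u v q c k) {U V : ℝ → ℝ}
    (hU : RegSol (lin (fun θ => q θ + 0 * k θ) c) Real.pi 1 U V) {θ : ℝ} (hθ : θ ∈ Ioo 0 Real.pi) :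
    unstableTangent a f θ (u 0) = (U θ, sin θ * V θ) := by
  refine (hasDerivAt_unstableCurve H hs.regSol (hU.congr fun t ht => ?_) hθ).deriv
  have hm := Ioo_subset_Icc_self ht
  simp only [lin, zero_mul, add_zero, hC.eq hm, hC.ec hm]

lemma coefU_mirror (h : ℝ → ℝ → ℝ → ℝ) (u v : ℝ → ℝ) (θ : ℝ) :
    coefU (mirror h) (fun θ => u (Real.pi - θ)) (fun θ => -v (Real.pi - θ)) θ =
      coefU h u v (Real.pi - θ) := by
  simp only [coefU, dU, mirror, neg_neg]

lemma coefP_mirror (h : ℝ → ℝ → ℝ → ℝ) (u v : ℝ → ℝ) (θ : ℝ) :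
    coefP (mirror h) (fun θ => u (Real.pi - θ)) (fun θ => -v (Real.pi - θ)) θ =
      -coefP h u v (Real.pi - θ) := by
  simp only [coefP, dP, mirror]
  rw [deriv_comp_neg (fun q => h (Real.pi - θ) (u (Real.pi - θ)) q), neg_neg]

lemma IsCoef.stableTangent_eq (H : Hyp a f) (hs : FullSol (rhs a f) u v)
    (hC : IsCoef a f u v q c k) {U V : ℝ → ℝ}
    (hU : RegSol (lin (fun θ => q (Real.pi - θ) + 0 * k (Real.pi - θ))
        fun θ => -c (Real.pi - θ)) Real.pi 1 U V) {θ : ℝ} (hθ : θ ∈ Ioo 0 Real.pi) :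
    stableTangent a f θ (u Real.pi) = (U (Real.pi - θ), -(sin θ * V (Real.pi - θ))) := by
  have hr := hs.mirror.regSol
  simp only [sub_zero] at hr
  refine (hasDerivAt_stableCurve H hr (hU.congr fun t ht => ?_) hθ).deriv
  have hm := pi_sub_mem_Icc (Ioo_subset_Icc_self ht)
  simp only [lin, zero_mul, add_zero, coefU_mirror, coefP_mirror, hC.eq hm, hC.ec hm]

/-- Hyperbolicity is transversality of the shooting manifolds. -/
theorem FullSol.isHyperbolic_iff (H : Hyp a f) (hs : FullSol (rhs a f) u v) {θ : ℝ}
    (hθ : θ ∈ Ioo 0 Real.pi) :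
    IsHyperbolic a f u ↔ MeetTransversely a f θ (u 0) (u Real.pi) := by
  obtain ⟨q, c, k, hC⟩ := hs.exists_isCoef H
  obtain ⟨U, V, U', V', hU, hU'⟩ := hC.exists_solutions
  have hm := Ioo_subset_Icc_self hθ
  have e1 : unstableCurve a f θ (u 0) = (u θ, sin θ * v θ) := unstableCurve_eq H hs.regSol hθ
  have e2 : stableCurve a f θ (u Real.pi) = (u θ, sin θ * v θ) :=
    (existsUnique_mem_Ws H hθ _).unique
      (Classical.epsilon_spec (existsUnique_mem_Ws H hθ _).exists) (hs.mem_Ws H hm)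
  have hsin := (sin_pos_of_mem hθ).ne'
  rw [hC.isHyperbolic_iff H hs, hC.isEigenvalue_iff H hs (hU 0) (hU' 0) hθ, MeetTransversely,
    unstableTangentPlane, stableTangentPlane, e1, e2,
    span_sup_span_eq_top_iff hsin (regular_unstableCurve H hθ _).2,
    hC.unstableTangent_eq H hs (hU 0) hθ, hC.stableTangent_eq H hs (hU' 0) hθ, not_iff_not]
  simp only
  rw [show U 0 θ * -(sin θ * V' 0 (Real.pi - θ)) - sin θ * V 0 θ * U' 0 (Real.pi - θ) =
    -(sin θ * (U 0 θ * V' 0 (Real.pi - θ) + V 0 θ * U' 0 (Real.pi - θ))) by ring, neg_eq_zero,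
    mul_eq_zero, or_iff_right hsin]

lemma IsCoef.isUnstableAngle (H : Hyp a f) (hs : FullSol (rhs a f) u v)
    (hC : IsCoef a f u v q c k) {U V : ℝ → ℝ}
    (hU : RegSol (lin (fun θ => q θ + 0 * k θ) c) Real.pi 1 U V) :
    IsUnstableAngle a f (u 0) (angle (fun θ => q θ + 0 * k θ) c U V) := by
  have hq := hC.cq
  have hk := hC.ck
  obtain ⟨h1, h2, h3⟩ := angle_spec (Continuous.continuousOn (by fun_prop))
    hC.cc.continuousOn hU
  refine ⟨h1.mono Ioo_subset_Ico_self, fun θ hθ => ?_, ?_⟩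
  · obtain ⟨r, hr, e1, e2⟩ := h3 θ (Ioo_subset_Ico_self hθ)
    exact ⟨r, hr, by rw [hC.unstableTangent_eq H hs hU hθ, ← e1, ← e2]⟩
  · have := h1 0 ⟨le_rfl, Real.pi_pos⟩
    rw [ContinuousWithinAt, h2] at this
    rw [← nhdsWithin_Ioo_eq_nhdsGT Real.pi_pos]
    exact this.mono_left (nhdsWithin_mono _ Ioo_subset_Ico_self)

/-- Reflection changes the sign of the second tangent component, so the clockwise angle is the
negative of the one measured in the reflected problem. -/
lemma IsCoef.isStableAngle (H : Hyp a f) (hs : FullSol (rhs a f) u v)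
    (hC : IsCoef a f u v q c k) {U V : ℝ → ℝ}
    (hU : RegSol (lin (fun θ => q (Real.pi - θ) + 0 * k (Real.pi - θ))
        fun θ => -c (Real.pi - θ)) Real.pi 1 U V) :
    IsStableAngle a f (u Real.pi) fun θ => -angle
      (fun θ => q (Real.pi - θ) + 0 * k (Real.pi - θ)) (fun θ => -c (Real.pi - θ)) U V
      (Real.pi - θ) := by
  have hq := hC.cq
  have hk := hC.ck
  have hc := hC.cc
  obtain ⟨h1, h2, h3⟩ := angle_spec (Continuous.continuousOn (by fun_prop))
    (Continuous.continuousOn (by fun_prop)) hU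
  refine ⟨(h1.comp (by fun_prop) fun θ hθ => Ioo_subset_Ico_self (pi_sub_mem_Ioo hθ)).neg,
    fun θ hθ => ?_, ?_⟩
  · obtain ⟨r, hr, e1, e2⟩ := h3 _ (Ioo_subset_Ico_self (pi_sub_mem_Ioo hθ))
    rw [Real.sin_pi_sub] at e2
    refine ⟨r, hr, ?_⟩
    rw [hC.stableTangent_eq H hs hU hθ, e1, e2, Real.cos_neg, Real.sin_neg, mul_neg]
  · have := h1 0 ⟨le_rfl, Real.pi_pos⟩
    rw [ContinuousWithinAt, h2] at this
    have h4 := (this.mono_left (nhdsWithin_mono _ Ioo_subset_Ico_self)).neg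
    rw [nhdsWithin_Ioo_eq_nhdsGT Real.pi_pos, neg_zero] at h4
    exact h4.comp tendsto_pi_sub

/-- The Morse index in terms of the shooting angles. -/
theorem FullSol.morseIndex_eq (H : Hyp a f) (hs : FullSol (rhs a f) u v)
    (hh : IsHyperbolic a f u) {θ : ℝ} (hθ : θ ∈ Ioo 0 Real.pi) :
    ∃ ν ν', IsUnstableAngle a f (u 0) ν ∧ IsStableAngle a f (u Real.pi) ν' ∧
      ∃ n : ℕ, morseIndex a f u = n ∧ (n : ℤ) = 1 + ⌊(ν θ - ν' θ) / Real.pi⌋ := by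
  obtain ⟨q, c, k, hC⟩ := hs.exists_isCoef H
  obtain ⟨U, V, U', V', hU, hU'⟩ := hC.exists_solutions
  refine ⟨_, _, hC.isUnstableAngle H hs (hU 0), hC.isStableAngle H hs (hU' 0), ?_⟩
  have hq := hC.cq
  have hk := hC.ck
  have hc := hC.cc
  have hq' : Continuous fun θ => q (Real.pi - θ) := by fun_prop
  have hk' : Continuous fun θ => k (Real.pi - θ) := by fun_prop
  have hc' : Continuous fun θ => -c (Real.pi - θ) := by fun_prop
  have hθ' := pi_sub_mem_Ioo hθ
  -- The sum of the angles from the two poles. At l = 0 it is the difference of the shooting angles,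
  -- because the stable one carries a minus sign.
  set F : ℝ → ℝ := fun l => angle (fun θ => q θ + l * k θ) c (U l) (V l) θ +
    angle (fun θ => q (Real.pi - θ) + l * k (Real.pi - θ)) (fun θ => -c (Real.pi - θ)) (U' l) (V' l)
      (Real.pi - θ) with hF
  have hev : ∀ l : ℝ, IsEigenvalue a f u (l : ℂ) ↔ ∃ m : ℤ, F l = m * Real.pi := by
    intro l
    obtain ⟨-, -, h1⟩ := angle_spec (Continuous.continuousOn (by fun_prop)) hc.continuousOn (hU l)
    obtain ⟨-, -, h2⟩ := angle_spec (Continuous.continuousOn (by fun_prop)) hc'.continuousOn (hU' l)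
    obtain ⟨r, hr, e1, e2⟩ := h1 θ (Ioo_subset_Ico_self hθ)
    obtain ⟨r', hr', e3, e4⟩ := h2 _ (Ioo_subset_Ico_self hθ')
    rw [Real.sin_pi_sub] at e4
    rw [hC.isEigenvalue_iff H hs (hU l) (hU' l) hθ]
    exact match_iff_angle (sin_pos_of_mem hθ) hr hr' e1 e2 e3 e4
  obtain ⟨n, h1, h2⟩ := encard_multiples (f := F)
    ((continuous_angle hq hc hk hU hθ).add (continuous_angle hq' hc' hk' hU' hθ'))
    ((strictAnti_angle hq hc hk hC.pos hU hθ).add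
      (strictAnti_angle hq' hc' hk' (fun θ => hC.pos _) hU' hθ'))
    (by
      filter_upwards [eventually_angle_mem hq hc hk hC.pos hU hθ,
        eventually_angle_mem hq' hc' hk' (fun θ => hC.pos _) hU' hθ'] with l h1 h2
      exact ⟨by simp only [hF]; linarith [h1.1, h2.1], by simp only [hF]; linarith [h1.2, h2.2]⟩)
    (fun m hm => (hC.isHyperbolic_iff H hs).1 hh ((hev 0).2 ⟨m, hm⟩))
  refine ⟨n, ?_, ?_⟩
  · rw [← h1, morseIndex]
    simp only [hev]
  · rw [h2, sub_neg_eq_add]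

end

/-- d and e are the values at the poles of the regular solution through the given point, and by
uniqueness this solution is u. -/
lemma FullSol.parameters_eq {a f : ℝ → ℝ → ℝ → ℝ} (H : Hyp a f) {u v : ℝ → ℝ}
    (hs : FullSol (rhs a f) u v) {θ d e : ℝ} (hθ : θ ∈ Icc 0 Real.pi)
    (h : (θ, u θ, sin θ * v θ) ∈ Wu a f d ∩ Ws a f e) : u 0 = d ∧ u Real.pi = e := by
  obtain ⟨u', v', hs', h1, h2, hq⟩ := exists_fullSol_of_mem H hθ h.1 h.2
  have hE := hs.eq H hs' hθ hq
  exact ⟨(hE ⟨le_rfl, Real.pi_pos.le⟩).trans h1, (hE ⟨Real.pi_pos.le, le_rfl⟩).trans h2⟩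

end AxisymShooting

end

open AxisymShooting in
theorem mainTheorem6 (a f : ℝ → ℝ → ℝ → ℝ)
    (ha : ContDiffOn ℝ 2 (fun x : ℝ × ℝ × ℝ => a x.1 x.2.1 x.2.2) (Icc 0 Real.pi ×ˢ univ))
    (hf : ContDiffOn ℝ 2 (fun x : ℝ × ℝ × ℝ => f x.1 x.2.1 x.2.2) (Icc 0 Real.pi ×ˢ univ))
    (ε : ℝ) (hε : 0 < ε) (haε : ∀ θ ∈ Icc 0 Real.pi, ∀ u p, ε ≤ a θ u p)
    (κ : ℝ) (hκ : κ < 2) (f₁ f₂ : ℝ → ℝ) (hf₁ : Continuous f₁) (hf₂ : Continuous f₂)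
    (hgrowth : ∀ θ ∈ Icc 0 Real.pi, ∀ u p, |f θ u p| < f₁ u + f₂ u * |p| ^ κ)
    (hglobal : ∀ x : ℝ × ℝ × ℝ, x.1 ∈ Ioo 0 Real.pi → ∃ g, IsShootOrbit a f g ∧ g 0 = x) :
    -- the shooting curves are well-defined regular curves
    (∀ θ ∈ Ioo 0 Real.pi,
      (∀ d, ∃! q : ℝ × ℝ, (θ, q) ∈ Wu a f d) ∧
      (∀ e, ∃! q : ℝ × ℝ, (θ, q) ∈ Ws a f e) ∧
      Differentiable ℝ (unstableCurve a f θ) ∧ (∀ d, unstableTangent a f θ d ≠ 0) ∧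
      Differentiable ℝ (stableCurve a f θ) ∧ (∀ e, stableTangent a f θ e ≠ 0)) ∧
    -- equilibria correspond to intersections of the shooting curves
    (∀ θ ∈ Icc 0 Real.pi,
      BijOn (fun u : Icc (0 : ℝ) Real.pi → ℝ => phasePoint (IccExtend Real.pi_pos.le u) θ)
        (equilibria a f) (crossSection (Mu a f) θ ∩ crossSection (Ms a f) θ)) ∧
    -- hyperbolicity is transversality
    (∀ u : ℝ → ℝ, IsEquilibrium a f u → ∀ d e : ℝ, ∀ θ₀ ∈ Ioo 0 Real.pi,
      (θ₀, phasePoint u θ₀) ∈ Wu a f d ∩ Ws a f e →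
      (IsHyperbolic a f u ↔ MeetTransversely a f θ₀ d e)) ∧
    -- the Morse index is read off from the angle
    (∀ u : ℝ → ℝ, IsEquilibrium a f u → IsHyperbolic a f u →
      ∀ d e : ℝ, ∀ θ₀ ∈ Ioo 0 Real.pi,
      (θ₀, phasePoint u θ₀) ∈ Wu a f d ∩ Ws a f e →
      (∃ ν, IsUnstableAngle a f d ν) ∧ (∃ ν', IsStableAngle a f e ν') ∧
      ∀ ν ν' : ℝ → ℝ, IsUnstableAngle a f d ν → IsStableAngle a f e ν' →
        ∃ n : ℕ, morseIndex a f u = n ∧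
          (n : ℤ) = 1 + ⌊(ν θ₀ - ν' θ₀) / Real.pi⌋) := by
  have H : Hyp a f := ⟨ha, hf, ⟨ε, hε, haε⟩, ⟨κ, hκ, f₁, f₂, hf₁, hf₂, hgrowth⟩, hglobal⟩
  have key : ∀ u : ℝ → ℝ, IsEquilibrium a f u → ∀ d e : ℝ, ∀ θ₀ ∈ Ioo 0 Real.pi,
      (θ₀, phasePoint u θ₀) ∈ Wu a f d ∩ Ws a f e →
      ∃ v, FullSol (rhs a f) u v ∧ u 0 = d ∧ u Real.pi = e := fun u hu d e θ₀ hθ h => by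
    obtain ⟨v, hs, hd⟩ := hu.fullSol H
    rw [phasePoint_eq hd (Ioo_subset_Icc_self hθ)] at h
    exact ⟨v, hs, hs.parameters_eq H (Ioo_subset_Icc_self hθ) h⟩
  refine ⟨fun θ hθ => ⟨existsUnique_mem_Wu H hθ, existsUnique_mem_Ws H hθ,
    fun d => (regular_unstableCurve H hθ d).1, fun d => (regular_unstableCurve H hθ d).2,
    fun e => (regular_stableCurve H hθ e).1, fun e => (regular_stableCurve H hθ e).2⟩,
    fun θ hθ => bijOn_equilibria H hθ, fun u hu d e θ₀ hθ h => ?_, fun u hu hh d e θ₀ hθ h => ?_⟩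
  · obtain ⟨v, hs, rfl, rfl⟩ := key u hu d e θ₀ hθ h
    exact hs.isHyperbolic_iff H hθ
  · obtain ⟨v, hs, rfl, rfl⟩ := key u hu d e θ₀ hθ h
    obtain ⟨ν, ν', h1, h2, hn⟩ := hs.morseIndex_eq H hh hθ
    refine ⟨⟨ν, h1⟩, ⟨ν', h2⟩, fun μ μ' h3 h4 => ?_⟩
    -- The normalization determines the angles, so the given ones coincide with those constructed
    -- from the linearized equation.
    rwa [h3.eq h1 hθ, h4.eq h2 hθ]
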